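/- **Setting.** Let $m,n\ge 0$ with $N=m+n\ge 2$. Put $[i]=0$ for $i\le m$ and $[i]=1$ for $m<i\le N$, and give $E_{ij}\in \mathrm{End}(\mathbb C^{m|n})$ the grade $[i]+[j]$; all tensor products are $\mathbb Z_2$-graded. There are two cases, the super-Yangian ($\hbar\in\mathbb C$) and the quantum affine superalgebra ($q\in\mathbb C^\times$, with a chosen square root $q^{1/2}$). Put $R_{12}(u,v)=\mathfrak b(u,v)\,1\otimes 1+\sum_{i,j}\mathfrak w_{ij}(u,v)E_{ij}\otimes E_{ji}$, with $\mathfrak w_{ii}=\mathfrak a_i-\mathfrak b$ and $\mathfrak w_{ij}=\mathfrak c_{ij}$ for $i\ne j$, where * Yangian: $\mathfrak b=u-v$, $\mathfrak a_i=u-v-(-1)^{[i]}\hbar$, $\mathfrak c_{ij}=-(-1)^{[j]}\hbar$, $\iota(u)=-u$, $u^{(k)}=u+\frac{\hbar}{2}(-1)^{[k]}$; * quantum affine: $\mathfrak b=\frac uv-\frac vu$, $\mathfrak a_i=\frac uv q^{1-2[i]}-\frac vu q^{2[i]-1}$, $\mathfrak c_{ij}=(-1)^{[j]}(q-q^{-1})(u/v)^{\mathrm{sign}(j-i)}$,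 $\iota(u)=u^{-1}$, $u^{(k)}=u\,q^{-\frac12+[k]}$. A bar means that the second argument is replaced by its image under $\iota$: $\bar f(u,v)=f(u,\iota(v))$. Put $u^{(1\dots l)}=(\dots(u^{(1)})^{(2)}\dots)^{(l)}$ and $\psi_i(u)=\bar{\mathfrak c}_{i+1,i}(u,u)/\bar{\mathfrak a}_i(u,u)$. $\mathcal A_{m|n}$ is the superalgebra generated by the modes of $T(u)=\sum E_{ij}\otimes t_{ij}(u)$ with $R_{12}(u,v)T_1(u)T_2(v)=T_2(v)T_1(u)R_{12}(u,v)$; $T^{-1}(u)=\sum E_{ij}\otimes t'_{ij}(u)$ is the inverse matrix. For the Yangian $T(u)=1+O(u^{-1})$ is a series in $u^{-1}$. In the quantum affine case $\mathcal A_{m|n}$ is generated by the modes of $L^+(u)$ (a series in $u^2$) and $L^-(u)$ (a series in $u^{-2}$), with $R_{12}(u,v)L^{\epsilon}_1(u)L^{\epsilon'}_2(v)=L^{\epsilon'}_2(v)L^{\epsilon}_1(u)R_{12}(u,v)$ for $(\epsilon,\epsilon')=(+,+),(-,-),(+,-)$, whose zero modes are triangular ($L^{+(0)}_{ij}=0$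 for $i<j$, $L^{-(0)}_{ij}=0$ for $i>j$) with mutually inverse diagonal entries; here $T(u)=L^+(u)$, and $T^{-1}(\iota(u))$, with entries $t'_{ij}(\iota(u))$, is the inverse of $L^-$ at $u^{-1}$, so that both are series in $u^2$. The coproduct of $\mathcal A_{m|n}$ is $\Delta(T(u))=T(u)\dot\otimes T(u)$ (for $L^+$ and $L^-$ in the quantum affine case). The reflection algebra $\mathfrak D_{m|n}$ is generated by the modes of $D(u)=\sum E_{ij}\otimes d_{ij}(u)$, a Laurent series in $x=u^{-1}$ (Yangian) or $x=u$ (quantum affine) with pole of order at most a fixed $p\ge 0$, subject to $R_{12}(u_1,u_2)D_1(u_1)\bar R_{21}(u_1,u_2)D_2(u_2)=D_2(u_2)\bar R_{12}(u_1,u_2)D_1(u_1)R_{21}(u_1,u_2)$. For $1\le k\le N-1$ let $\mathcal J_k\subset\mathcal A_{m|n}$ be the left ideal generated by the modes of $t_{ij}(u),t'_{ij}(u)$, and $\mathcal I_k\subset\mathfrak D_{m|n}$ the left ideal generated by the modes of $d_{ij}(u)$, for $i>j$ and $j<k$. (In the quantum affine case $t_{ij}$ and $t'_{ij}$ are the entries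 of $L^+$ and of $(L^-)^{-1}$.) For $i,j\ge k$ put $$t^{(k)}_{ij}(u)=t_{ij}(u^{(1\dots k-1)}),\qquad t'^{(k)}_{ij}(\iota(u))=t'_{ij}(\iota(u^{(1\dots k-1)})),$$ $$d^{(k)}_{ij}(u)=d_{ij}(u^{(1\dots k-1)})-\delta_{ij}\sum_{a=1}^{k-1}q^{2(k-1-a)-4\sum_{l=a+1}^{k-1}[l]}\,\psi_a(u^{(a)})\,d_{aa}(u^{(1\dots k-1)})$$ (with $q=1$ in the last formula for the Yangian), and let $T^{(k)}(u)$, $(T^{-1})^{(k)}(\iota(u))$, $D^{(k)}(u)$ be the matrices $\sum_{i,j\ge k}E_{ij}\otimes(\cdot)$ of these series. **Theorem.** The coproduct of $\mathcal A_{m|n}$ exists and is unique, and there is a unique algebra homomorphism $\Delta:\mathfrak D_{m|n}\to\mathcal A_{m|n}\otimes\mathfrak D_{m|n}$ with $\Delta(D(u))=T(u)\,D(u)\,T^{-1}(\iota(u))$, the entries of $T$, $T^{-1}$ being in the first factor and those of $D$ in the second. It is the restriction of the coproduct of $\mathcal A_{m|n}$ in the following sense: for every even scalar solution $K(u)$ of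 the reflection equation (with pole of order at most $p$ in $x$) there is a unique homomorphism $\varphi:\mathfrak D_{m|n}\to\mathcal A_{m|n}$ with $\varphi(D(u))=T(u)K(u)T^{-1}(\iota(u))$, and $(\mathrm{id}\otimes\varphi)\circ\Delta=\Delta_{\mathcal A}\circ\varphi$. For every $1\le k\le N-1$ the coproduct of the reduced matrix keeps its form in the coset $\mathcal A_{m|n}/\mathcal J_k\otimes\mathfrak D_{m|n}/\mathcal I_k$: $$\Delta\big(D^{(k)}(u)\big)\equiv T^{(k)}(u)\,D^{(k)}(u)\,(T^{-1})^{(k)}(\iota(u)),$$ an identity between the classes of all coefficients of all entries $(i,j)$ with $i,j\ge k$, the right-hand side being the graded matrix product computed in $\mathcal A_{m|n}\otimes\mathfrak D_{m|n}$ before passing to the coset. -/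

import Mathlib

open scoped TensorProduct LaurentSeries

noncomputable section

namespace OpenChain

/-! ## Formal series -/

/-- Apply a ring homomorphism to every coefficient of a Laurent series. -/
def coeffHom {A B : Type} [Ring A] [Ring B] (φ : A →+* B) :
    LaurentSeries A →+* LaurentSeries B where
  toFun f := f.map φ
  map_zero' := by ext; simp
  map_one' := HahnSeries.map_one φ.toMonoidWithZeroHom
  map_add' x y := HahnSeries.map_add φ.toAddMonoidHom
  map_mul' x y := HahnSeries.map_mul φ.toNonUnitalRingHom

@[simp] lemma coeffHom_coeff {A B : Type} [Ring A] [Ring B] (φ : A →+* B)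
    (f : LaurentSeries A) (r : ℤ) : (coeffHom φ f).coeff r = φ (f.coeff r) := rfl

/-- Formal series in two independent variables: the outer Laurent variable is written `X`,
the inner one `Y`. -/
abbrev Series₂ (A : Type) [Ring A] : Type := LaurentSeries (LaurentSeries A)

/-- A scalar series, regarded as a series with coefficients in the algebra `A`. -/
def scal (A : Type) [Ring A] [Algebra ℂ A] : LaurentSeries ℂ →+* LaurentSeries A :=
  coeffHom (algebraMap ℂ A)

/-- The same in two variables. -/
def scal₂ (A : Type) [Ring A] [Algebra ℂ A] : Series₂ ℂ →+* Series₂ A :=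
  coeffHom (coeffHom (algebraMap ℂ A))

/-- A series in one variable, as a series in the first variable `X`. -/
def inX {A : Type} [Ring A] (f : LaurentSeries A) : Series₂ A :=
  coeffHom HahnSeries.C f

/-- A series in one variable, as a series in the second variable `Y`. -/
def inY {A : Type} [Ring A] (f : LaurentSeries A) : Series₂ A :=
  HahnSeries.C f

lemma subst_bddBelow {A : Type} [Ring A] [Algebra ℂ A] (f : LaurentSeries A)
    (y : LaurentSeries ℂ) :
    BddBelow (Function.support fun r : ℤ =>
      ∑ n ∈ Finset.Icc f.order r, (y ^ n).coeff r • f.coeff n) :=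
  ⟨f.order, fun r hr => by
    by_contra h
    exact hr (by simp [Finset.Icc_eq_empty h])⟩

/-- Substitution `f(y) = ∑ₙ fₙ yⁿ` of a scalar series `y` of order one (the only case that is
used) in a Laurent series `f = ∑ₙ fₙ xⁿ`. Since `yⁿ` has order `n`, only the terms
with `f.order ≤ n ≤ r` contribute to the coefficient of `xʳ`. -/
def subst {A : Type} [Ring A] [Algebra ℂ A] (f : LaurentSeries A) (y : LaurentSeries ℂ) :
    LaurentSeries A :=
  HahnSeries.ofSuppBddBelow
    (fun r : ℤ => ∑ n ∈ Finset.Icc f.order r, (y ^ n).coeff r • f.coeff n)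
    (subst_bddBelow f y)

@[simp] lemma subst_coeff {A : Type} [Ring A] [Algebra ℂ A] (f : LaurentSeries A)
    (y : LaurentSeries ℂ) (r : ℤ) :
    (subst f y).coeff r = ∑ n ∈ Finset.Icc f.order r, (y ^ n).coeff r • f.coeff n := rfl

/-! ## The models and their structure functions -/

/-- The two families: the super-Yangian `Y(m|n)` with parameter `ħ`, and the quantum affine
superalgebra `U_q(m|n)` with `q = s²`, so that `s` is the chosen square root of `q`. -/
inductive Model : Type
  | yangian (ħ : ℂ)
  | quantum (s : ℂˣ)

/-- The distinguished grade of the index `i ∈ {1, …, m+n}`. -/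
def gr (m i : ℕ) : ℕ := if i ≤ m then 0 else 1

/-- The grade of an index; the element `i` of `Fin N` stands for the index `i + 1`. -/
def deg (m : ℕ) {N : ℕ} (i : Fin N) : ℕ := gr m ((i : ℕ) + 1)

namespace Model

variable {S : Type} [Field S] [Algebra ℂ S]

/-- The power `s ^ e = q ^ (e / 2)`, in a field of functions of the spectral parameters. -/
def sPow (s : ℂˣ) (e : ℤ) : S := algebraMap ℂ S ((s : ℂ) ^ e)

/-- The map `ι` on spectral parameters. -/
def iota : Model → S → S
  | yangian _, u => -u
  | quantum _, u => u⁻¹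

/-- `𝔟(u,v)`. -/
def b : Model → S → S → S
  | yangian _, u, v => u - v
  | quantum _, u, v => u / v - v / u

/-- `𝔞_i(u,v)`. -/
def a (m : ℕ) : Model → ℕ → S → S → S
  | yangian ħ, i, u, v => u - v - (-1) ^ gr m i * algebraMap ℂ S ħ
  | quantum s, i, u, v =>
      u / v * sPow s (2 * (1 - 2 * (gr m i : ℤ))) - v / u * sPow s (2 * (2 * (gr m i : ℤ) - 1))

/-- `𝔠_{ij}(u,v)`. -/
def c (m : ℕ) : Model → ℕ → ℕ → S → S → S
  | yangian ħ, _, j, _, _ => -((-1) ^ gr m j * algebraMap ℂ S ħ)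
  | quantum s, i, j, u, v =>
      (-1) ^ gr m j * (sPow s 2 - sPow s (-2)) * (u / v) ^ Int.sign ((j : ℤ) - (i : ℤ))

/-- `𝔴_{ij}(u,v)`. -/
def w (m : ℕ) (M : Model) (i j : ℕ) (u v : S) : S :=
  if i = j then M.a m i u v - M.b u v else M.c m i j u v

/-- `ψ_i(u) = \bar 𝔠_{i+1,i}(u,u) / \bar 𝔞_i(u,u)`, where a bar means that the second
argument is replaced by its image under `ι`. -/
def psi (m : ℕ) (M : Model) (i : ℕ) (u : S) : S :=
  M.c m (i + 1) i u (M.iota u) / M.a m i u (M.iota u)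

/-- The shifted parameter `u^{(k)}`. -/
def shift (m : ℕ) : Model → ℕ → S → S
  | yangian ħ, k, u => u + algebraMap ℂ S (ħ / 2) * (-1) ^ gr m k
  | quantum s, k, u => u * sPow s (-1 + 2 * (gr m k : ℤ))

/-- The parameter `u^{(1…l)}`, which is `u` for `l = 0`. -/
def shiftUpTo (m : ℕ) (M : Model) : ℕ → S → S
  | 0, u => u
  | l + 1, u => M.shift m (l + 1) (M.shiftUpTo m l u)

/-- The factor `q^{2(k-1-a) - 4 ∑_{l=a+1}^{k-1} [l]}`, with `q = 1` for the Yangian. -/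
def qFactor (m : ℕ) : Model → ℕ → ℕ → S
  | yangian _, _, _ => 1
  | quantum s, k, a =>
      sPow s (2 * (2 * ((k : ℤ) - 1 - a) - 4 * ∑ l ∈ Finset.Ico (a + 1) k, (gr m l : ℤ)))

/-- The parameter in positive powers of which `T(u)` is expanded: `u⁻¹` for the Yangian,
`u` for the quantum affine algebra. It is an involution, so it also recovers `u`. -/
def loc : Model → S → S
  | yangian _, u => u⁻¹
  | quantum _, u => u

/-- `T(u)` is a series in `loc u` for the Yangian and in `(loc u)²` for the quantum affine
algebra. -/
def step : Model → ℕ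
  | yangian _ => 1
  | quantum _ => 2

/-- The spectral parameter `u`, as an element of `ℂ((x))` where `x = loc u`. -/
def u₀ (M : Model) : LaurentSeries ℂ := M.loc (HahnSeries.single 1 1)

end Model

/-! ## Graded matrices -/

section Matrices

variable {A : Type} [Ring A] {N : ℕ}

/-- The graded product of globally even matrices `∑ E_{ij} ⊗ x_{ij}`, where `x_{ij}` has grade
`[i] + [j]`. -/
def gmul (m : ℕ) (x y : Fin N → Fin N → A) : Fin N → Fin N → A := fun i j =>
  ∑ a, (-1) ^ ((deg m i + deg m a) * (deg m a + deg m j)) * (x i a * y a j)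

/-- `x i j k l` is the coefficient of `E_{ij} ⊗ E_{kl}`. -/
abbrev Mat₂ (N : ℕ) (A : Type) : Type := Fin N → Fin N → Fin N → Fin N → A

/-- The graded product of globally even elements `∑ E_{ij} ⊗ E_{kl} ⊗ x_{ijkl}`, where
`x_{ijkl}` has grade `[i] + [j] + [k] + [l]`. -/
def gmul₂ (m : ℕ) (x y : Mat₂ N A) : Mat₂ N A := fun i q k s =>
  ∑ j, ∑ l, (-1) ^ ((deg m k + deg m l) * (deg m j + deg m q) +
      (deg m i + deg m j + deg m k + deg m l) * (deg m j + deg m q + deg m l + deg m s)) *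
    (x i j k l * y j q l s)

/-- `x₁ = ∑ E_{ij} ⊗ 1 ⊗ x_{ij}`. -/
def inOne (x : Fin N → Fin N → A) : Mat₂ N A := fun i j k l => if k = l then x i j else 0

/-- `x₂ = ∑ 1 ⊗ E_{kl} ⊗ x_{kl}`. -/
def inTwo (x : Fin N → Fin N → A) : Mat₂ N A := fun i j k l => if i = j then x k l else 0

/-- The identity matrix. -/
def gone : Fin N → Fin N → A := fun i j => if i = j then 1 else 0

end Matrices

/-- `R₁₂(u,v) = 𝔟(u,v) 1 ⊗ 1 + ∑ 𝔴_{ij}(u,v) E_{ij} ⊗ E_{ji}`. -/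
def R₁₂ (M : Model) (m n : ℕ) {S : Type} [Field S] [Algebra ℂ S] (u v : S) : Mat₂ (m + n) S :=
  fun i j k l => (if i = j ∧ k = l then M.b u v else 0) +
    if k = j ∧ l = i then M.w m (i + 1) (j + 1) u v else 0

/-- `R₂₁(u,v)`, the graded flip of `R₁₂(u,v)`: the flip sends `E_{ji} ⊗ E_{ij}` to
`(-1)^{[i]+[j]} E_{ij} ⊗ E_{ji}`. -/
def R₂₁ (M : Model) (m n : ℕ) {S : Type} [Field S] [Algebra ℂ S] (u v : S) : Mat₂ (m + n) S :=
  fun i j k l => (if i = j ∧ k = l then M.b u v else 0) +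
    if k = j ∧ l = i then (-1) ^ (deg m i + deg m j) * M.w m (j + 1) (i + 1) u v else 0

/-- A matrix of scalar series in two variables, with entries regarded in `A((Y))((X))`. -/
def scalMat (A : Type) [Ring A] [Algebra ℂ A] {N : ℕ} (x : Mat₂ N (Series₂ ℂ)) :
    Mat₂ N (Series₂ A) := fun i j k l => scal₂ A (x i j k l)

/-! ## The algebra `A_{m|n}` -/

/-- The two monodromy matrices `T⁺ = L⁺` and `T⁻ = L⁻` of the quantum affine superalgebra
(they coincide for the Yangian). -/
inductive Side : Type
  | plus
  | minus

/-- Generators of `A_{m|n}`: the modes of `T⁺`, those of `T⁻`, and those of the inverse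
matrix of `T⁻`. The last ones are redundant, as the relations make them the modes of the
unique inverse. -/
inductive Gen (N : ℕ) : Type
  | t (ε : Side) (i j : Fin N) (r : ℕ)
  | t' (i j : Fin N) (r : ℕ)

/-- `∑_r g_r x^{e r}`. -/
def modeSeries {A : Type} [Ring A] (e : ℕ) (g : ℕ → A) : LaurentSeries A :=
  HahnSeries.ofPowerSeries ℤ A (PowerSeries.mk fun r => if e ∣ r then g (r / e) else 0)

/-- The free algebra on the generators. -/
abbrev FreeMono (N : ℕ) : Type := FreeAlgebra ℂ (Gen N)

/-- A generator, as an element of the free algebra. -/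
abbrev genι {N : ℕ} (g : Gen N) : FreeMono N := FreeAlgebra.ι ℂ g

/-- `t_{ij}(u)` (for each side), as a series with coefficients in the free algebra. -/
def freeT (M : Model) {N : ℕ} (ε : Side) (i j : Fin N) : LaurentSeries (FreeMono N) :=
  modeSeries M.step fun r => genι (.t ε i j r)

/-- `t'_{ij}(u)`, as a series with coefficients in the free algebra. -/
def freeT' (M : Model) {N : ℕ} (i j : Fin N) : LaurentSeries (FreeMono N) :=
  modeSeries M.step fun r => genι (.t' i j r)

/-- The spectral parameter of `T^ε` as a function of the variable `x` of its expansion: `T⁺` is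
a series in `x = loc u`, while `T⁻` is a series in `x = u⁻¹`. -/
def specVar (M : Model) {S : Type} [Field S] [Algebra ℂ S] : Side → S → S
  | .plus, x => M.loc x
  | .minus, x => x⁻¹

/-- The variables `X` and `Y`. -/
def varX : Series₂ ℂ := HahnSeries.single 1 1
/-- The variables `X` and `Y`. -/
def varY : Series₂ ℂ := HahnSeries.C (HahnSeries.single 1 1)

/-- `R₁₂(u,v) T^ε₁(u) T^ε'₂(v)`. -/
def rttL (M : Model) (m n : ℕ) (ε ε' : Side) : Mat₂ (m + n) (Series₂ (FreeMono (m + n))) :=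
  gmul₂ m (gmul₂ m (scalMat _ (R₁₂ M m n (specVar M ε varX) (specVar M ε' varY)))
    (inOne fun i j => inX (freeT M ε i j))) (inTwo fun i j => inY (freeT M ε' i j))

/-- `T^ε'₂(v) T^ε₁(u) R₁₂(u,v)`. -/
def rttR (M : Model) (m n : ℕ) (ε ε' : Side) : Mat₂ (m + n) (Series₂ (FreeMono (m + n))) :=
  gmul₂ m (gmul₂ m (inTwo fun i j => inY (freeT M ε' i j))
    (inOne fun i j => inX (freeT M ε i j)))
    (scalMat _ (R₁₂ M m n (specVar M ε varX) (specVar M ε' varY)))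

/-- The conditions on the zero modes. For the Yangian there is only one matrix `T(u)`, with
`T⁽⁰⁾ = 1`. For the quantum affine superalgebra `L⁺⁽⁰⁾` and `L⁻⁽⁰⁾` are
triangular, with mutually inverse diagonal entries. -/
inductive InitRel (N : ℕ) : Model → FreeMono N → FreeMono N → Prop
  | same (ħ : ℂ) (i j : Fin N) (r : ℕ) :
      InitRel N (.yangian ħ) (genι (.t .minus i j r)) (genι (.t .plus i j r))
  | unit (ħ : ℂ) (i j : Fin N) :
      InitRel N (.yangian ħ) (genι (.t .plus i j 0)) (gone i j)
  | lower (s : ℂˣ) (i j : Fin N) (h : i < j) :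
      InitRel N (.quantum s) (genι (.t .plus i j 0)) 0
  | upper (s : ℂˣ) (i j : Fin N) (h : j < i) :
      InitRel N (.quantum s) (genι (.t .minus i j 0)) 0
  | diag (s : ℂˣ) (i : Fin N) :
      InitRel N (.quantum s) (genι (.t .plus i i 0) * genι (.t .minus i i 0)) 1
  | diag' (s : ℂˣ) (i : Fin N) :
      InitRel N (.quantum s) (genι (.t .minus i i 0) * genι (.t .plus i i 0)) 1

/-- The defining relations of `A_{m|n}`, coefficient by coefficient. -/
inductive MonoRel (M : Model) (m n : ℕ) : FreeMono (m + n) → FreeMono (m + n) → Prop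
  | rtt (ε ε' : Side) (h : ¬ (ε = .minus ∧ ε' = .plus)) (i j k l : Fin (m + n)) (r s : ℤ) :
      MonoRel M m n (((rttL M m n ε ε' i j k l).coeff r).coeff s)
        (((rttR M m n ε ε' i j k l).coeff r).coeff s)
  | inv_right (i j : Fin (m + n)) (r : ℤ) :
      MonoRel M m n ((gmul m (freeT M .minus) (freeT' M) i j).coeff r)
        ((gone i j : LaurentSeries (FreeMono (m + n))).coeff r)
  | inv_left (i j : Fin (m + n)) (r : ℤ) :
      MonoRel M m n ((gmul m (freeT' M) (freeT M .minus) i j).coeff r)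
        ((gone i j : LaurentSeries (FreeMono (m + n))).coeff r)
  | init (x y : FreeMono (m + n)) (h : InitRel (m + n) M x y) : MonoRel M m n x y

/-- The algebra `A_{m|n}`: the super-Yangian `Y(m|n)`, or the quantum affine superalgebra
`U_q(m|n)` without central charge. -/
def Mono (M : Model) (m n : ℕ) : Type := RingQuot (MonoRel M m n)

instance (M : Model) (m n : ℕ) : Ring (Mono M m n) :=
  inferInstanceAs (Ring (RingQuot (MonoRel M m n)))
instance (M : Model) (m n : ℕ) : Algebra ℂ (Mono M m n) :=
  inferInstanceAs (Algebra ℂ (RingQuot (MonoRel M m n)))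

/-- The projection of the free algebra onto `A_{m|n}`. -/
def Mono.mk (M : Model) (m n : ℕ) : FreeMono (m + n) →ₐ[ℂ] Mono M m n :=
  RingQuot.mkAlgHom ℂ (MonoRel M m n)

/-! ## The reflection algebra `𝔇_{m|n}` -/

section Reflection

variable {A : Type} [Ring A] [Algebra ℂ A]

/-- `R₁₂(u₁,u₂) D₁(u₁) \bar R₂₁(u₁,u₂) D₂(u₂)`. -/
def reflL (M : Model) (m n : ℕ) (D : Fin (m + n) → Fin (m + n) → LaurentSeries A) :
    Mat₂ (m + n) (Series₂ A) :=
  gmul₂ m (gmul₂ m (gmul₂ m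
    (scalMat A (R₁₂ M m n (M.loc varX) (M.loc varY)))
    (inOne fun i j => inX (D i j)))
    (scalMat A (R₂₁ M m n (M.loc varX) (M.iota (M.loc varY)))))
    (inTwo fun i j => inY (D i j))

/-- `D₂(u₂) \bar R₁₂(u₁,u₂) D₁(u₁) R₂₁(u₁,u₂)`. -/
def reflR (M : Model) (m n : ℕ) (D : Fin (m + n) → Fin (m + n) → LaurentSeries A) :
    Mat₂ (m + n) (Series₂ A) :=
  gmul₂ m (gmul₂ m (gmul₂ m
    (inTwo fun i j => inY (D i j))
    (scalMat A (R₁₂ M m n (M.loc varX) (M.iota (M.loc varY)))))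
    (inOne fun i j => inX (D i j)))
    (scalMat A (R₂₁ M m n (M.loc varX) (M.loc varY)))

end Reflection

/-- Generators of the reflection algebra: the modes of `d_{ij}(u)`. -/
inductive ReflGen (N : ℕ) : Type
  | d (i j : Fin N) (r : ℕ)

/-- The free algebra on the modes of `d_{ij}(u)`. -/
abbrev FreeRefl (N : ℕ) : Type := FreeAlgebra ℂ (ReflGen N)

/-- `d_{ij}(u) = ∑_{r ≥ 0} d_{ij,r} x^{r-p}` with `x = loc u`: a Laurent series with a pole of
order at most `p`. -/
def freeD {N : ℕ} (p : ℕ) (i j : Fin N) : LaurentSeries (FreeRefl N) :=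
  HahnSeries.single (-(p : ℤ)) 1 * modeSeries 1 fun r => FreeAlgebra.ι ℂ (.d i j r)

/-- The reflection equation, coefficient by coefficient. -/
inductive ReflRel (M : Model) (m n p : ℕ) : FreeRefl (m + n) → FreeRefl (m + n) → Prop
  | refl (i j k l : Fin (m + n)) (r s : ℤ) :
      ReflRel M m n p (((reflL M m n (freeD p) i j k l).coeff r).coeff s)
        (((reflR M m n (freeD p) i j k l).coeff r).coeff s)

/-- The reflection algebra `𝔇_{m|n}`, whose matrix `D(u)` has a pole of order at
most `p` in the variable `x = loc u`. -/
def Refl (M : Model) (m n p : ℕ) : Type := RingQuot (ReflRel M m n p)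

instance (M : Model) (m n p : ℕ) : Ring (Refl M m n p) :=
  inferInstanceAs (Ring (RingQuot (ReflRel M m n p)))
instance (M : Model) (m n p : ℕ) : Algebra ℂ (Refl M m n p) :=
  inferInstanceAs (Algebra ℂ (RingQuot (ReflRel M m n p)))

/-- The projection of the free algebra onto the reflection algebra. -/
def Refl.mk (M : Model) (m n p : ℕ) : FreeRefl (m + n) →ₐ[ℂ] Refl M m n p :=
  RingQuot.mkAlgHom ℂ (ReflRel M m n p)

/-! ## The `ℤ/2`-gradings -/

section Parity

variable {A : Type} [Ring A] [Algebra ℂ A]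

/-- The `ℤ/2`-grading by the eigenspaces of an involutive automorphism `σ`: even elements are
fixed by `σ`, odd elements are negated. -/
def eigenGrading (σ : A →ₐ[ℂ] A) (i : ZMod 2) : Submodule ℂ A :=
  LinearMap.eqLocus σ.toLinearMap ((-1 : ℂ) ^ i.val • LinearMap.id)

lemma mem_eigenGrading {σ : A →ₐ[ℂ] A} {i : ZMod 2} {x : A} :
    x ∈ eigenGrading σ i ↔ σ x = (-1 : ℂ) ^ i.val • x := Iff.rfl

/-- The even part `(x + σ x) / 2` of an element. -/
def evenPart (σ : A →ₐ[ℂ] A) (h : ∀ x, σ (σ x) = x) : A →ₗ[ℂ] eigenGrading σ 0 :=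
  LinearMap.codRestrict _ ((1 / 2 : ℂ) • (LinearMap.id + σ.toLinearMap)) fun x => by
    simp [mem_eigenGrading, h, add_comm]

/-- The odd part `(x - σ x) / 2` of an element. -/
def oddPart (σ : A →ₐ[ℂ] A) (h : ∀ x, σ (σ x) = x) : A →ₗ[ℂ] eigenGrading σ 1 :=
  LinearMap.codRestrict _ ((1 / 2 : ℂ) • (LinearMap.id - σ.toLinearMap)) fun x => by
    rw [mem_eigenGrading, ZMod.val_one, pow_one, neg_one_smul]
    simp [h, ← smul_neg]

/-- If `σ` is an involution, its eigenspaces make `A` a graded algebra. -/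
@[reducible]
def eigenGradedAlgebra (σ : A →ₐ[ℂ] A) (h : ∀ x, σ (σ x) = x) :
    GradedAlgebra (eigenGrading σ) where
  one_mem := by simp [mem_eigenGrading]
  mul_mem := by
    intro i j x y hx hy
    rw [mem_eigenGrading] at *
    have e : ((-1 : ℂ) ^ (i + j).val) = (-1) ^ i.val * (-1) ^ j.val := by
      have key : ∀ i j : ZMod 2, (i + j).val % 2 = (i.val + j.val) % 2 := by decide
      rw [← pow_add, neg_one_pow_eq_pow_mod_two, key, ← neg_one_pow_eq_pow_mod_two]
    rw [map_mul, hx, hy, e, smul_mul_smul_comm]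
  decompose' x := DirectSum.of (fun i => eigenGrading σ i) 0 (evenPart σ h x) +
    DirectSum.of (fun i => eigenGrading σ i) 1 (oddPart σ h x)
  left_inv x := by
    simp only [map_add, DirectSum.coeAddMonoidHom_of, evenPart, oddPart,
      LinearMap.codRestrict_apply, LinearMap.smul_apply, LinearMap.add_apply,
      LinearMap.sub_apply, LinearMap.id_apply]
    rw [← smul_add, add_add_sub_cancel, ← two_smul ℂ x, smul_smul]
    norm_num
  right_inv x := by
    induction x using DirectSum.induction_on with
    | zero => simp
    | of i x =>
      obtain ⟨x, hx⟩ := x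
      rw [mem_eigenGrading] at hx
      simp only [DirectSum.coeAddMonoidHom_of]
      fin_cases i
      · have hx' : σ x = x := by simpa [ZMod.val] using hx
        have e0 : evenPart σ h x = ⟨x, hx⟩ := by
          ext
          simp only [evenPart, LinearMap.codRestrict_apply, LinearMap.smul_apply,
            LinearMap.add_apply, LinearMap.id_apply, AlgHom.toLinearMap_apply, hx']
          rw [← two_smul ℂ x, smul_smul]; norm_num
        have e1 : oddPart σ h x = 0 := by
          ext; simp [oddPart, hx']
        rw [e0, e1, map_zero, add_zero]; rfl
      · have hx' : σ x = -x := by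
          have h1 : ((-1 : ℂ) ^ (1 : ZMod 2).val) = -1 := by rw [ZMod.val_one]; simp
          have h2 : σ x = ((-1 : ℂ) ^ (1 : ZMod 2).val) • x := hx
          rw [h2, h1]; simp
        have e0 : evenPart σ h x = 0 := by
          ext; simp [evenPart, hx']
        have e1 : oddPart σ h x = ⟨x, hx⟩ := by
          ext
          simp only [oddPart, LinearMap.codRestrict_apply, LinearMap.smul_apply,
            LinearMap.sub_apply, LinearMap.id_apply, AlgHom.toLinearMap_apply, hx',
            sub_neg_eq_add]
          rw [← two_smul ℂ x, smul_smul]; norm_num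
        rw [e0, e1, map_zero, zero_add]; rfl
    | add x y hx hy =>
      simp only [map_add]
      rw [add_add_add_comm]
      exact congrArg₂ (· + ·) hx hy

/-- A matrix all of whose entries `x_{ij}` have grade `[i] + [j]` for the automorphism `θ`. -/
def IsEven {B : Type} [Ring B] {N : ℕ} (m : ℕ) (θ : B →+* B) (x : Fin N → Fin N → B) : Prop :=
  ∀ i j, θ (x i j) = (-1) ^ (deg m i + deg m j) * x i j

/-- The same for two tensor factors. -/
def IsEven₂ {B : Type} [Ring B] {N : ℕ} (m : ℕ) (θ : B →+* B) (x : Mat₂ N B) : Prop :=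
  ∀ i j k l, θ (x i j k l) = (-1) ^ (deg m i + deg m j + deg m k + deg m l) * x i j k l

/-- The automorphism of a free algebra that multiplies the generator `g` by `(-1) ^ p g`. -/
def freeParity {G : Type} (p : G → ℕ) : FreeAlgebra ℂ G →ₐ[ℂ] FreeAlgebra ℂ G :=
  FreeAlgebra.lift ℂ fun g => (-1) ^ p g * FreeAlgebra.ι ℂ g

lemma freeParity_ι {G : Type} (p : G → ℕ) (g : G) :
    freeParity p (FreeAlgebra.ι ℂ g) = (-1) ^ p g * FreeAlgebra.ι ℂ g := by
  simp [freeParity]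

lemma coeff_neg_one_pow_mul {B : Type} [Ring B] (e : ℕ) (f : LaurentSeries B) (r : ℤ) :
    ((-1) ^ e * f).coeff r = (-1) ^ e * f.coeff r := by
  rcases neg_one_pow_eq_or (LaurentSeries B) e with h | h <;>
  rcases Nat.even_or_odd e with he | he <;> simp [he.neg_one_pow]

lemma neg_one_pow_mul_left {B : Type} [Ring B] (e : ℕ) (x y : B) :
    x * ((-1) ^ e * y) = (-1) ^ e * (x * y) := by
  rcases Nat.even_or_odd e with he | he <;> simp [he.neg_one_pow]

lemma neg_one_pow_congr {B : Type} [Ring B] {e f : ℕ} (h : e % 2 = f % 2) :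
    ((-1 : B)) ^ e = (-1) ^ f := by
  rw [neg_one_pow_eq_pow_mod_two, h, ← neg_one_pow_eq_pow_mod_two]

lemma neg_one_pow_aux {B : Type} [Ring B] (s a b t : ℕ) (x y : B) (h : (a + b) % 2 = t % 2) :
    (-1) ^ s * ((-1) ^ a * x * ((-1) ^ b * y)) = (-1) ^ t * ((-1) ^ s * (x * y)) := by
  rw [← neg_one_pow_congr h, pow_add]
  rcases Nat.even_or_odd s with hs | hs <;> rcases Nat.even_or_odd a with ha | ha <;>
    rcases Nat.even_or_odd b with hb | hb <;>
    simp [hs.neg_one_pow, ha.neg_one_pow, hb.neg_one_pow]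

section EvenLemmas

variable {B : Type} [Ring B] {N m : ℕ} {θ : B →+* B}

lemma IsEven.gmul {x y : Fin N → Fin N → B} (hx : IsEven m θ x) (hy : IsEven m θ y) :
    IsEven m θ (gmul m x y) := by
  intro i j
  simp only [OpenChain.gmul, map_sum, map_mul, map_pow, map_neg, map_one, hx _ _, hy _ _,
    Finset.mul_sum]
  refine Finset.sum_congr rfl fun a _ => ?_
  exact neg_one_pow_aux _ _ _ _ _ _ (by omega)

lemma IsEven₂.gmul₂ {x y : Mat₂ N B} (hx : IsEven₂ m θ x) (hy : IsEven₂ m θ y) :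
    IsEven₂ m θ (gmul₂ m x y) := by
  intro i q k s
  simp only [OpenChain.gmul₂, map_sum, map_mul, map_pow, map_neg, map_one, hx _ _ _ _,
    hy _ _ _ _, Finset.mul_sum]
  refine Finset.sum_congr rfl fun j _ => Finset.sum_congr rfl fun l _ => ?_
  exact neg_one_pow_aux _ _ _ _ _ _ (by omega)

lemma IsEven.inOne {x : Fin N → Fin N → B} (hx : IsEven m θ x) : IsEven₂ m θ (inOne x) := by
  intro i j k l
  by_cases h : k = l
  · subst h
    simp only [OpenChain.inOne, if_true, hx i j]
    congr 1
    exact neg_one_pow_congr (by omega)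
  · simp [OpenChain.inOne, h]

lemma IsEven.inTwo {x : Fin N → Fin N → B} (hx : IsEven m θ x) : IsEven₂ m θ (inTwo x) := by
  intro i j k l
  by_cases h : i = j
  · subst h
    simp only [OpenChain.inTwo, if_true, hx k l]
    congr 1
    exact neg_one_pow_congr (by omega)
  · simp [OpenChain.inTwo, h]

end EvenLemmas

variable {m : ℕ}

lemma isEven_inX {B : Type} [Ring B] {N : ℕ} {θ : B →+* B} {x : Fin N → Fin N → LaurentSeries B}
    (hx : IsEven m (coeffHom θ) x) :
    IsEven m (coeffHom (coeffHom θ)) fun i j => inX (x i j) := by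
  intro i j
  have h : coeffHom (coeffHom θ) (inX (x i j)) = inX (coeffHom θ (x i j)) := by
    ext r s
    simp only [inX, coeffHom_coeff, HahnSeries.C_apply, HahnSeries.coeff_single]
    split_ifs <;> simp
  rw [h, hx i j]
  simp [inX]

lemma isEven_inY {B : Type} [Ring B] {N : ℕ} {θ : B →+* B} {x : Fin N → Fin N → LaurentSeries B}
    (hx : IsEven m (coeffHom θ) x) :
    IsEven m (coeffHom (coeffHom θ)) fun i j => inY (x i j) := by
  intro i j
  have h : coeffHom (coeffHom θ) (inY (x i j)) = inY (coeffHom θ (x i j)) := by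
    ext r s
    simp only [inY, coeffHom_coeff, HahnSeries.C_apply, HahnSeries.coeff_single]
    split_ifs <;> simp
  rw [h, hx i j]
  simp only [inY, map_mul, map_pow, map_neg, map_one]

lemma isEven_scalMat {N : ℕ} (θ : A →ₐ[ℂ] A) {x : Mat₂ N (Series₂ ℂ)}
    (hx : ∀ i j k l, x i j k l = 0 ∨ (deg m i + deg m j + deg m k + deg m l) % 2 = 0) :
    IsEven₂ m (coeffHom (coeffHom (θ : A →+* A))) (scalMat A x) := by
  intro i j k l
  have h : coeffHom (coeffHom (θ : A →+* A)) (scalMat A x i j k l) = scalMat A x i j k l := by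
    ext r s
    simp [scalMat, scal₂]
  rw [h]
  rcases hx i j k l with h0 | h0
  · simp [scalMat, h0]
  · rw [neg_one_pow_congr (f := 0) (by omega)]; simp

lemma R₁₂_even (M : Model) (n : ℕ) {S : Type} [Field S] [Algebra ℂ S] (u v : S)
    (i j k l : Fin (m + n)) :
    R₁₂ M m n u v i j k l = 0 ∨ (deg m i + deg m j + deg m k + deg m l) % 2 = 0 := by
  by_cases h1 : i = j ∧ k = l
  · obtain ⟨rfl, rfl⟩ := h1; right; omega
  by_cases h2 : k = j ∧ l = i
  · obtain ⟨rfl, rfl⟩ := h2; right; omega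
  left; simp [R₁₂, h1, h2]

lemma R₂₁_even (M : Model) (n : ℕ) {S : Type} [Field S] [Algebra ℂ S] (u v : S)
    (i j k l : Fin (m + n)) :
    R₂₁ M m n u v i j k l = 0 ∨ (deg m i + deg m j + deg m k + deg m l) % 2 = 0 := by
  by_cases h1 : i = j ∧ k = l
  · obtain ⟨rfl, rfl⟩ := h1; right; omega
  by_cases h2 : k = j ∧ l = i
  · obtain ⟨rfl, rfl⟩ := h2; right; omega
  left; simp [R₂₁, h1, h2]

lemma coeffHom_modeSeries {B : Type} [Ring B] (θ : B →+* B) (e q : ℕ) (g : ℕ → B)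
    (h : ∀ r, θ (g r) = (-1) ^ q * g r) :
    coeffHom θ (modeSeries e g) = (-1) ^ q * modeSeries e g := by
  ext r
  rw [coeff_neg_one_pow_mul, coeffHom_coeff]
  by_cases hr : 0 ≤ r
  · obtain ⟨r, rfl⟩ := Int.eq_ofNat_of_zero_le hr
    simp only [modeSeries]
    erw [HahnSeries.ofPowerSeries_apply_coeff]
    simp only [PowerSeries.coeff_mk]
    split_ifs <;> simp [h]
  · have : (modeSeries e g).coeff r = 0 := by
      rw [modeSeries, HahnSeries.ofPowerSeries_apply]
      apply HahnSeries.embDomain_of_notMem_range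
      rintro ⟨x, hx⟩
      apply hr
      rw [← hx]
      simp
    rw [this]; simp

/-- If the relations of a presented algebra are preserved up to a sign by the parity
automorphism of the free algebra, that automorphism descends to the quotient. -/
def descend {G : Type} (rel : FreeAlgebra ℂ G → FreeAlgebra ℂ G → Prop) (p : G → ℕ)
    (h : ∀ x y, rel x y → ∃ e : ℕ, freeParity p x = (-1) ^ e * x ∧
      freeParity p y = (-1) ^ e * y) :
    RingQuot rel →ₐ[ℂ] RingQuot rel :=
  RingQuot.liftAlgHom ℂ ⟨(RingQuot.mkAlgHom ℂ rel).comp (freeParity p), fun x y hxy => by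
    obtain ⟨e, hx, hy⟩ := h x y hxy
    simp only [AlgHom.comp_apply, hx, hy, map_mul, RingQuot.mkAlgHom_rel ℂ hxy]⟩

lemma descend_descend {G : Type} (rel : FreeAlgebra ℂ G → FreeAlgebra ℂ G → Prop) (p : G → ℕ)
    (h : ∀ x y, rel x y → ∃ e : ℕ, freeParity p x = (-1) ^ e * x ∧
      freeParity p y = (-1) ^ e * y) (x : RingQuot rel) :
    descend rel p h (descend rel p h x) = x := by
  have : (descend rel p h).comp (descend rel p h) = AlgHom.id ℂ _ := by
    apply RingQuot.ringQuot_ext'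
    ext g
    simp only [descend, AlgHom.comp_apply, Function.comp_apply, RingQuot.liftAlgHom_mkAlgHom_apply,
      freeParity_ι, map_mul, map_pow, map_neg, map_one, AlgHom.id_apply]
    rw [← mul_assoc, ← pow_add, neg_one_pow_congr (f := 0) (by omega)]
    simp
  exact DFunLike.congr_fun this x

end Parity

/-- The grade of a generator of `A_{m|n}`. -/
def Gen.deg (m : ℕ) {N : ℕ} : Gen N → ℕ
  | .t _ i j _ => OpenChain.deg m i + OpenChain.deg m j
  | .t' i j _ => OpenChain.deg m i + OpenChain.deg m j

/-- The grade of a generator of the reflection algebra. -/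
def ReflGen.deg (m : ℕ) {N : ℕ} : ReflGen N → ℕ
  | .d i j _ => OpenChain.deg m i + OpenChain.deg m j

/-- The parity automorphism of the free algebra. -/
abbrev Gen.par (m N : ℕ) : FreeMono N →+* FreeMono N :=
  RingHomClass.toRingHom (freeParity (Gen.deg (N := N) m))

lemma isEven_freeT (M : Model) (m : ℕ) {N : ℕ} (ε : Side) :
    IsEven m (coeffHom (Gen.par m N)) (freeT M ε) :=
  fun _ _ => coeffHom_modeSeries _ _ _ _ fun _ => freeParity_ι _ _

lemma isEven_freeT' (M : Model) (m : ℕ) {N : ℕ} :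
    IsEven m (coeffHom (Gen.par m N)) (freeT' M) :=
  fun _ _ => coeffHom_modeSeries _ _ _ _ fun _ => freeParity_ι _ _

lemma isEven_gone {B : Type} [Ring B] (m : ℕ) {N : ℕ} (θ : B →+* B) :
    IsEven m θ (gone : Fin N → Fin N → B) := by
  intro i j
  by_cases h : i = j
  · subst h
    rw [neg_one_pow_congr (f := 0) (by omega)]
    simp [gone]
  · simp [gone, h]

/-- The parity automorphism of the free algebra. -/
abbrev ReflGen.par (m N : ℕ) : FreeRefl N →+* FreeRefl N :=
  RingHomClass.toRingHom (freeParity (ReflGen.deg (N := N) m))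

lemma isEven_freeD (m p : ℕ) {N : ℕ} :
    IsEven m (coeffHom (ReflGen.par m N)) (freeD p) := by
  intro i j
  have h1 : coeffHom (ReflGen.par m N)
      (HahnSeries.single (-(p : ℤ)) 1) = HahnSeries.single (-(p : ℤ)) 1 := by
    ext r
    simp only [coeffHom_coeff, HahnSeries.coeff_single]
    split_ifs <;> simp
  rw [freeD, map_mul, h1, coeffHom_modeSeries (q := OpenChain.deg m i + OpenChain.deg m j),
    neg_one_pow_mul_left]
  exact fun _ => freeParity_ι _ _

lemma MonoRel.parity {M : Model} {m n : ℕ} (x y : FreeMono (m + n)) (h : MonoRel M m n x y) :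
    ∃ e : ℕ, freeParity (Gen.deg m) x = (-1) ^ e * x ∧
      freeParity (Gen.deg m) y = (-1) ^ e * y := by
  have key : ∀ (e : ℕ) (f : Series₂ (FreeMono (m + n))) (r s : ℤ),
      coeffHom (coeffHom (Gen.par m (m + n))) f = (-1) ^ e * f →
      freeParity (Gen.deg m) ((f.coeff r).coeff s) = (-1) ^ e * (f.coeff r).coeff s := by
    intro e f r s hf
    have := congrArg (fun g : Series₂ (FreeMono (m + n)) => (g.coeff r).coeff s) hf
    simpa [coeff_neg_one_pow_mul] using this
  have key₁ : ∀ (e : ℕ) (f : LaurentSeries (FreeMono (m + n))) (r : ℤ),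
      coeffHom (Gen.par m (m + n)) f = (-1) ^ e * f →
      freeParity (Gen.deg m) (f.coeff r) = (-1) ^ e * f.coeff r := by
    intro e f r hf
    have := congrArg (fun g : LaurentSeries (FreeMono (m + n)) => g.coeff r) hf
    simpa [coeff_neg_one_pow_mul] using this
  cases h with
  | rtt ε ε' h i j k l r s =>
    have hR := isEven_scalMat (m := m) (freeParity (Gen.deg (N := m + n) m))
      (R₁₂_even M n (specVar M ε varX) (specVar M ε' varY))
    have h1 := (isEven_inX (isEven_freeT M m (N := m + n) ε)).inOne
    have h2 := (isEven_inY (isEven_freeT M m (N := m + n) ε')).inTwo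
    exact ⟨_, key _ _ r s (((hR.gmul₂ h1).gmul₂ h2) i j k l),
      key _ _ r s (((h2.gmul₂ h1).gmul₂ hR) i j k l)⟩
  | inv_right i j r =>
    exact ⟨_, key₁ _ _ r (((isEven_freeT M m .minus).gmul (isEven_freeT' M m)) i j),
      key₁ _ _ r (isEven_gone m _ i j)⟩
  | inv_left i j r =>
    exact ⟨_, key₁ _ _ r (((isEven_freeT' M m).gmul (isEven_freeT M m .minus)) i j),
      key₁ _ _ r (isEven_gone m _ i j)⟩
  | init x y h =>
    cases h with
    | same ħ i j r => exact ⟨_, freeParity_ι _ _, freeParity_ι _ _⟩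
    | unit ħ i j =>
      exact ⟨_, freeParity_ι _ _,
        isEven_gone m (Gen.par m (m + n)) i j⟩
    | lower s i j h => exact ⟨_, freeParity_ι _ _, by simp⟩
    | upper s i j h => exact ⟨_, freeParity_ι _ _, by simp⟩
    | diag s i =>
      refine ⟨0, ?_, by simp⟩
      rw [map_mul, freeParity_ι, freeParity_ι,
        neg_one_pow_congr (e := Gen.deg m (.t .plus i i 0)) (f := 0)
          (by simp only [Gen.deg]; omega),
        neg_one_pow_congr (e := Gen.deg m (.t .minus i i 0)) (f := 0)
          (by simp only [Gen.deg]; omega)]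
      simp
    | diag' s i =>
      refine ⟨0, ?_, by simp⟩
      rw [map_mul, freeParity_ι, freeParity_ι,
        neg_one_pow_congr (e := Gen.deg m (.t .plus i i 0)) (f := 0)
          (by simp only [Gen.deg]; omega),
        neg_one_pow_congr (e := Gen.deg m (.t .minus i i 0)) (f := 0)
          (by simp only [Gen.deg]; omega)]
      simp

lemma ReflRel.parity {M : Model} {m n p : ℕ} (x y : FreeRefl (m + n))
    (h : ReflRel M m n p x y) :
    ∃ e : ℕ, freeParity (ReflGen.deg m) x = (-1) ^ e * x ∧
      freeParity (ReflGen.deg m) y = (-1) ^ e * y := by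
  have key : ∀ (e : ℕ) (f : Series₂ (FreeRefl (m + n))) (r s : ℤ),
      coeffHom (coeffHom (ReflGen.par m (m + n))) f
        = (-1) ^ e * f →
      freeParity (ReflGen.deg m) ((f.coeff r).coeff s) = (-1) ^ e * (f.coeff r).coeff s := by
    intro e f r s hf
    have := congrArg (fun g : Series₂ (FreeRefl (m + n)) => (g.coeff r).coeff s) hf
    simpa [coeff_neg_one_pow_mul] using this
  cases h with
  | refl i j k l r s =>
    have hR (u v : Series₂ ℂ) := isEven_scalMat (m := m)
      (freeParity (ReflGen.deg (N := m + n) m)) (R₁₂_even M n u v)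
    have hR' (u v : Series₂ ℂ) := isEven_scalMat (m := m)
      (freeParity (ReflGen.deg (N := m + n) m)) (R₂₁_even M n u v)
    have h1 := (isEven_inX (isEven_freeD m p (N := m + n))).inOne
    have h2 := (isEven_inY (isEven_freeD m p (N := m + n))).inTwo
    exact ⟨_, key _ _ r s (((((hR _ _).gmul₂ h1).gmul₂ (hR' _ _)).gmul₂ h2) i j k l),
      key _ _ r s ((((h2.gmul₂ (hR _ _)).gmul₂ h1).gmul₂ (hR' _ _)) i j k l)⟩

/-- The parity automorphism of `A_{m|n}`: `t_{ij}(u)` and `t'_{ij}(u)` have grade `[i] + [j]`. -/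
def Mono.parity (M : Model) (m n : ℕ) : Mono M m n →ₐ[ℂ] Mono M m n :=
  descend (MonoRel M m n) (Gen.deg m) MonoRel.parity

/-- The parity automorphism of the reflection algebra: `d_{ij}(u)` has grade `[i] + [j]`. -/
def Refl.parity (M : Model) (m n p : ℕ) : Refl M m n p →ₐ[ℂ] Refl M m n p :=
  descend (ReflRel M m n p) (ReflGen.deg m) ReflRel.parity

/-- The `ℤ/2`-grading of `A_{m|n}`. -/
def Mono.grading (M : Model) (m n : ℕ) : ZMod 2 → Submodule ℂ (Mono M m n) :=
  eigenGrading (Mono.parity M m n)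

/-- The `ℤ/2`-grading of the reflection algebra. -/
def Refl.grading (M : Model) (m n p : ℕ) : ZMod 2 → Submodule ℂ (Refl M m n p) :=
  eigenGrading (Refl.parity M m n p)

instance (M : Model) (m n : ℕ) : GradedAlgebra (Mono.grading M m n) :=
  eigenGradedAlgebra _ (descend_descend (MonoRel M m n) (Gen.deg m) MonoRel.parity)

instance (M : Model) (m n p : ℕ) : GradedAlgebra (Refl.grading M m n p) :=
  eigenGradedAlgebra _ (descend_descend (ReflRel M m n p) (ReflGen.deg m) ReflRel.parity)

/-- The graded tensor product `A_{m|n} ⊗ A_{m|n}`. -/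
abbrev MonoMono (M : Model) (m n : ℕ) : Type :=
  Mono.grading M m n ᵍ⊗[ℂ] Mono.grading M m n

/-- The graded tensor product `A_{m|n} ⊗ 𝔇_{m|n}`. -/
abbrev MonoRefl (M : Model) (m n p : ℕ) : Type :=
  Mono.grading M m n ᵍ⊗[ℂ] Refl.grading M m n p

/-! ## The monodromy matrices -/

section Statement

variable (M : Model) (m n p : ℕ)

/-- `T⁺(u)` or `T⁻(u)`, as a series in the variable of its expansion. -/
def tSeries (ε : Side) (i j : Fin (m + n)) : LaurentSeries (Mono M m n) :=
  coeffHom (Mono.mk M m n : FreeMono (m + n) →+* Mono M m n) (freeT M ε i j)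

/-- The inverse of `T⁻(u)`, as a series in `u⁻¹`. -/
def t'Series (i j : Fin (m + n)) : LaurentSeries (Mono M m n) :=
  coeffHom (Mono.mk M m n : FreeMono (m + n) →+* Mono M m n) (freeT' M i j)

/-- `D(u)`, as a series in `x = loc u`. -/
def dSeries (i j : Fin (m + n)) : LaurentSeries (Refl M m n p) :=
  coeffHom (Refl.mk M m n p : FreeRefl (m + n) →+* Refl M m n p) (freeD p i j)

/-- `T(z) = T⁺(z)` at a spectral parameter `z` (a series in `x = loc u`). -/
def T (z : LaurentSeries ℂ) (i j : Fin (m + n)) : LaurentSeries (Mono M m n) :=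
  subst (tSeries M m n .plus i j) (M.loc z)

/-- `T⁻¹(ι(z))` at a spectral parameter `z`. For the quantum affine superalgebra this is the
inverse of `L⁻`, whose expansion in inverse powers of its argument makes sense at `ι(z) = z⁻¹`. -/
def Tinv (z : LaurentSeries ℂ) (i j : Fin (m + n)) : LaurentSeries (Mono M m n) :=
  subst (t'Series M m n i j) (M.iota z)⁻¹

/-- `D(z)` at a spectral parameter `z`. -/
def D (z : LaurentSeries ℂ) (i j : Fin (m + n)) : LaurentSeries (Refl M m n p) :=
  subst (dSeries M m n p i j) (M.loc z)

/-! ## Coproducts -/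

/-- `Δ` is the coproduct of `A_{m|n}`: `Δ(T^±(u)) = T^±_{[1]}(u) T^±_{[2]}(u)`. -/
def IsCoproduct (Δ : Mono M m n →ₐ[ℂ] MonoMono M m n) : Prop :=
  ∀ ε i j, coeffHom (Δ : Mono M m n →+* MonoMono M m n) (tSeries M m n ε i j) =
    gmul m
      (fun i j => coeffHom (GradedTensorProduct.includeLeft (Mono.grading M m n)
        (Mono.grading M m n) : Mono M m n →+* MonoMono M m n) (tSeries M m n ε i j))
      (fun i j => coeffHom (GradedTensorProduct.includeRight (Mono.grading M m n)
        (Mono.grading M m n) : Mono M m n →+* MonoMono M m n) (tSeries M m n ε i j)) i j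

/-- The graded matrix product `X Y Z` with entries in `A_{m|n} ⊗ 𝔇_{m|n}`, where `X` and `Z` have
entries in `A_{m|n}` and `Y` has entries in `𝔇_{m|n}`. -/
def sandwich (X : Fin (m + n) → Fin (m + n) → LaurentSeries (Mono M m n))
    (Y : Fin (m + n) → Fin (m + n) → LaurentSeries (Refl M m n p))
    (Z : Fin (m + n) → Fin (m + n) → LaurentSeries (Mono M m n)) :
    Fin (m + n) → Fin (m + n) → LaurentSeries (MonoRefl M m n p) :=
  gmul m
    (gmul m
      (fun i j => coeffHom (GradedTensorProduct.includeLeft (Mono.grading M m n)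
        (Refl.grading M m n p) : Mono M m n →+* MonoRefl M m n p) (X i j))
      (fun i j => coeffHom (GradedTensorProduct.includeRight (Mono.grading M m n)
        (Refl.grading M m n p) : Refl M m n p →+* MonoRefl M m n p) (Y i j)))
    (fun i j => coeffHom (GradedTensorProduct.includeLeft (Mono.grading M m n)
      (Refl.grading M m n p) : Mono M m n →+* MonoRefl M m n p) (Z i j))

/-- `Δ` is the coproduct of the coideal `𝔇_{m|n}`: `Δ(D(u)) = T(u) D(u) T⁻¹(ι(u))`. -/
def IsCoaction (Δ : Refl M m n p →ₐ[ℂ] MonoRefl M m n p) : Prop :=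
  ∀ i j, coeffHom (Δ : Refl M m n p →+* MonoRefl M m n p) (D M m n p M.u₀ i j) =
    sandwich M m n p (T M m n M.u₀) (D M m n p M.u₀) (Tinv M m n M.u₀) i j

/-- A boundary matrix `K⁻(u)`: an even matrix of scalar Laurent series in `x = loc u`, with a
pole of order at most `p`, that satisfies the reflection equation. -/
structure IsBoundary (K : Fin (m + n) → Fin (m + n) → LaurentSeries ℂ) : Prop where
  even : ∀ i j, deg m i ≠ deg m j → K i j = 0
  pole : ∀ i j, ∀ r : ℤ, r < -(p : ℤ) → (K i j).coeff r = 0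
  refl : reflL M m n K = reflR M m n K

/-- `φ` realizes the reflection algebra in `A_{m|n}`, by `D(u) ↦ T(u) K(u) T⁻¹(ι(u))`. -/
def IsDressing (K : Fin (m + n) → Fin (m + n) → LaurentSeries ℂ)
    (φ : Refl M m n p →ₐ[ℂ] Mono M m n) : Prop :=
  ∀ i j, coeffHom (φ : Refl M m n p →+* Mono M m n) (D M m n p M.u₀ i j) =
    gmul m (gmul m (T M m n M.u₀) fun i j => scal (Mono M m n) (K i j)) (Tinv M m n M.u₀) i j

/-- `id ⊗ φ : A_{m|n} ⊗ 𝔇_{m|n} → A_{m|n} ⊗ A_{m|n}`. -/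
def idTensor (φ : Refl M m n p →ₐ[ℂ] Mono M m n) : MonoRefl M m n p →ₗ[ℂ] MonoMono M m n :=
  (GradedTensorProduct.of ℂ (Mono.grading M m n) (Mono.grading M m n)).toLinearMap ∘ₗ
    TensorProduct.map LinearMap.id φ.toLinearMap ∘ₗ
    (GradedTensorProduct.of ℂ (Mono.grading M m n) (Refl.grading M m n p)).symm.toLinearMap

/-! ## The ideals and the reduced generators -/

/-- The left ideal `J_k` of `A_{m|n}` generated by the modes of `t_{ij}(u)` and `t'_{ij}(u)` with
`i > j` and `j < k`. -/
def idealJ (k : ℕ) : Ideal (Mono M m n) :=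
  Ideal.span {x | ∃ (i j : Fin (m + n)) (r : ℤ), j < i ∧ (j : ℕ) + 1 < k ∧
    (x = (tSeries M m n .plus i j).coeff r ∨ x = (t'Series M m n i j).coeff r)}

/-- The left ideal `I_k` of `𝔇_{m|n}` generated by the modes of `d_{ij}(u)` with
`i > j` and `j < k`. -/
def idealI (k : ℕ) : Ideal (Refl M m n p) :=
  Ideal.span {x | ∃ (i j : Fin (m + n)) (r : ℤ), j < i ∧ (j : ℕ) + 1 < k ∧
    x = (dSeries M m n p i j).coeff r}

/-- The projection of `A_{m|n} ⊗ 𝔇_{m|n}` onto `(A_{m|n} / J_k) ⊗ (𝔇_{m|n} / I_k)`. -/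
def coset (k : ℕ) : MonoRefl M m n p →ₗ[ℂ]
    (Mono M m n ⧸ (idealJ M m n k).restrictScalars ℂ) ⊗[ℂ]
      (Refl M m n p ⧸ (idealI M m n p k).restrictScalars ℂ) :=
  TensorProduct.map ((idealJ M m n k).restrictScalars ℂ).mkQ
      ((idealI M m n p k).restrictScalars ℂ).mkQ ∘ₗ
    (GradedTensorProduct.of ℂ (Mono.grading M m n) (Refl.grading M m n p)).symm.toLinearMap

/-- The part of a matrix with both indices in `{k, …, m+n}`. -/
def cut {A : Type} [Ring A] {N : ℕ} (k : ℕ) (x : Fin N → Fin N → A) : Fin N → Fin N → A :=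
  fun i j => if k ≤ (i : ℕ) + 1 ∧ k ≤ (j : ℕ) + 1 then x i j else 0

/-- `T^{(k)}(u)`, with entries `t_{ij}(u^{(1…k-1)})` for `i, j ≥ k`. -/
def Tred (k : ℕ) : Fin (m + n) → Fin (m + n) → LaurentSeries (Mono M m n) :=
  cut k (T M m n (M.shiftUpTo m (k - 1) M.u₀))

/-- `(T⁻¹)^{(k)}(ι(u))`, with entries `t'_{ij}(ι(u^{(1…k-1)}))` for `i, j ≥ k`. -/
def Tinvred (k : ℕ) : Fin (m + n) → Fin (m + n) → LaurentSeries (Mono M m n) :=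
  cut k (Tinv M m n (M.shiftUpTo m (k - 1) M.u₀))

/-- `D^{(k)}(u)`, with entries, for `i, j ≥ k`,
`d_{ij}(u^{(1…k-1)}) - δ_{ij} ∑_{a<k} q^{2(k-1-a)-4∑_{l=a+1}^{k-1}[l]} ψ_a(u^{(a)}) d_{aa}(u^{(1…k-1)})`. -/
def Dred (k : ℕ) : Fin (m + n) → Fin (m + n) → LaurentSeries (Refl M m n p) :=
  cut k fun i j => D M m n p (M.shiftUpTo m (k - 1) M.u₀) i j -
    if i = j then
      ∑ a : Fin (m + n), if (a : ℕ) + 1 < k then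
        scal (Refl M m n p) (M.qFactor m k (a + 1) * M.psi m (a + 1) (M.shift m (a + 1) M.u₀)) *
          D M m n p (M.shiftUpTo m (k - 1) M.u₀) a a
      else 0
    else 0

end Statement

end OpenChain

end

open OpenChain

open scoped TensorProduct LaurentSeries
noncomputable section
namespace OpenChain

/-! ### Laurent series in one and two variables: products, exchange of variables, restriction to the
diagonal. -/

section Series

variable {A : Type} [Ring A]

/-! The existence and uniqueness claims are universal properties. Both algebras are given by
generators and relations, so a homomorphism out of them is the same as matrices satisfying the
relations (`IsMonodromy.exists_lift`, `Refl.exists_lift`). A product of two supercommuting monodromy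
matrices is again one (`IsMonodromy.gmul`); this gives the coproduct. If `D` solves the reflection
equation and supercommutes with `T`, then `T(u) D(u) T⁻¹(ι(u))` solves it as well
(`IsMonodromy.dress`, with the word manipulation in `reflection_dressing`); the generating matrix
`D` gives the coaction and a scalar `K` gives `φ`. Compatibility holds because both composites send
`D` to `T_[1] T_[2] K T⁻¹_[2] T⁻¹_[1]`.

For the reduced matrices put `K = k - 1` and `z = u^{(1…K)}`. Up to signs, `Δ(d_{ij}(z))` is the sum
of `t_{ia}(z) t'_{bj}(ι(z)) ⊗ d_{ab}(z)`. In the coset only two kinds of terms survive: those with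
all of `i, j, a, b` larger than `K`, and those with `a = b ≤ K`. Most other terms vanish because
`d_{ab}` or `t'_{bj}` lies in the ideal; for the rest one needs that the product `t_{ia} t'_{bj}`
lies in `J_k` (`Exchange.xy_eq_zero`). Write `τ_{ij}(a)` for the signed product `t_{ia} t'_{aj}` and
`f_c` for the coefficient of `d_{cc}` in `D^{(k)}`. Comparing what multiplies `d_{cc}`, `c ≤ K`, on
both sides, the theorem reduces to `τ_{ij}(c) + f_c ∑_{a>K} τ_{ij}(a) ≡ δ_{ij} ∑_{a≤K} f_a
τ_{aa}(c)` modulo `J_k` (`Exchange.reduced`).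

Everything needed about these products comes from one relation, `T₁ R(z,ι(z)) T₂⁻¹ = T₂⁻¹ R(z,ι(z))
T₁`, obtained by setting the two spectral parameters equal (`IsMonodromy.exchange_u₀`,
`T_exchange`). Modulo `J_k` its components are linear equations over the field `ℂ((x))`. An
off-diagonal coefficient of `R` depends on its second index and on the order of the two indices
only, so in terms of partial sums the equations become first-order recurrences, which are solved in
closed form (`Regular.upper`, `Regular.lower`); the diagonal equations couple the two families
(`Rows.weighted_sums`). The system is nondegenerate because `z` is a non-constant function of `u`
(`exchange_regular`), and its solution contains the weights `λ_c / (1 + Λ_K)`. These are exactly the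
coefficients `f_c` (`coefficient_mul`), which explains the shifts and the functions `ψ` in the
definition of `D^{(k)}`. -/

lemma exists_coeff_eq_zero_of_lt (f : LaurentSeries A) : ∃ a : ℤ, ∀ r < a, f.coeff r = 0 :=
  ⟨f.order, fun _ h => HahnSeries.coeff_eq_zero_of_lt_order h⟩

/-- The freedom in `S` allows several products to be compared over a common index set. -/
lemma coeff_mul_eq_sum {f g : LaurentSeries A} {a b : ℤ} (hf : ∀ r < a, f.coeff r = 0)
    (hg : ∀ r < b, g.coeff r = 0) (n : ℤ) {S : Finset ℤ} (hS : Finset.Icc a (n - b) ⊆ S) :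
    (f * g).coeff n = ∑ r ∈ S, f.coeff r * g.coeff (n - r) := by
  classical
  rw [HahnSeries.coeff_mul]
  refine Finset.sum_of_injOn Prod.fst ?_ ?_ ?_ ?_
  · rintro ⟨x, y⟩ hx ⟨x', y'⟩ hx' h
    simp only [Finset.mem_coe, Finset.mem_antidiagonal] at hx hx'
    have h' : x = x' := h
    ext
    · exact h'
    · simp only; omega
  · rintro ⟨x, y⟩ hx
    simp only [Finset.mem_coe, Finset.mem_antidiagonal, HahnSeries.mem_support] at hx
    apply hS
    have h1 : ¬ x < a := fun h => hx.1 (hf x h)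
    have h2 : ¬ y < b := fun h => hx.2.1 (hg y h)
    rw [Finset.mem_Icc]
    omega
  · intro r _ hr
    by_contra h
    apply hr
    refine ⟨(r, n - r), ?_, rfl⟩
    simp only [Finset.mem_coe, Finset.mem_antidiagonal, HahnSeries.mem_support]
    exact ⟨left_ne_zero_of_mul h, right_ne_zero_of_mul h, by ring⟩
  · rintro ⟨x, y⟩ hx
    simp only [Finset.mem_antidiagonal] at hx
    have : y = n - x := by omega
    simp [this]

lemma coeffHom_comp {B C : Type} [Ring B] [Ring C] (φ : A →+* B) (ψ : B →+* C)
    (f : LaurentSeries A) : coeffHom ψ (coeffHom φ f) = coeffHom (ψ.comp φ) f := rfl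

lemma coeffHom_coeffHom_inX {B : Type} [Ring B] (φ : A →+* B) (f : LaurentSeries A) :
    coeffHom (coeffHom φ) (inX f) = inX (coeffHom φ f) := by
  ext r s
  simp only [inX, coeffHom_coeff, HahnSeries.C_apply, HahnSeries.coeff_single]
  split_ifs <;> simp

lemma coeffHom_coeffHom_inY {B : Type} [Ring B] (φ : A →+* B) (f : LaurentSeries A) :
    coeffHom (coeffHom φ) (inY f) = inY (coeffHom φ f) := by
  ext r s
  simp only [inY, coeffHom_coeff, HahnSeries.C_apply, HahnSeries.coeff_single]
  split_ifs <;> simp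

lemma inX_coeff_coeff (f : LaurentSeries A) (r s : ℤ) :
    ((inX f).coeff r).coeff s = if s = 0 then f.coeff r else 0 := by
  simp [inX, HahnSeries.coeff_single]

lemma inY_coeff_coeff (f : LaurentSeries A) (r s : ℤ) :
    ((inY f).coeff r).coeff s = if r = 0 then f.coeff s else 0 := by
  simp only [inY, HahnSeries.C_apply, HahnSeries.coeff_single]
  split_ifs <;> simp

@[simp] lemma inX_one : inX (1 : LaurentSeries A) = 1 := map_one _

lemma coeff_inX_mul_inY (f g : LaurentSeries A) (r s : ℤ) :
    ((inX f * inY g).coeff r).coeff s = f.coeff r * g.coeff s := by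
  rw [inY, HahnSeries.C_apply, HahnSeries.coeff_mul_single_zero]
  simp [inX]

lemma coeff_inY_mul_inX (f g : LaurentSeries A) (r s : ℤ) :
    ((inY g * inX f).coeff r).coeff s = g.coeff s * f.coeff r := by
  rw [inY, HahnSeries.C_apply, HahnSeries.coeff_single_zero_mul]
  simp [inX]

/-- If all coefficients of `f` and `g` commute up to the sign `(-1) ^ e`, so do `f(X)`, `g(Y)`. -/
lemma inX_mul_inY_comm {f g : LaurentSeries A} {e : ℕ}
    (h : ∀ r s, f.coeff r * g.coeff s = (-1) ^ e * (g.coeff s * f.coeff r)) :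
    inX f * inY g = (-1) ^ e * (inY g * inX f) := by
  ext r s
  rw [coeff_neg_one_pow_mul, coeff_neg_one_pow_mul, coeff_inX_mul_inY, coeff_inY_mul_inX, h]

lemma mul_comm_of_coeff {f g : LaurentSeries A} {e : ℕ}
    (h : ∀ r s, f.coeff r * g.coeff s = (-1) ^ e * (g.coeff s * f.coeff r)) :
    f * g = (-1) ^ e * (g * f) := by
  obtain ⟨a, ha⟩ := exists_coeff_eq_zero_of_lt f
  obtain ⟨b, hb⟩ := exists_coeff_eq_zero_of_lt g
  ext n
  rw [coeff_neg_one_pow_mul, coeff_mul_eq_sum ha hb n subset_rfl,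
    coeff_mul_eq_sum hb ha n subset_rfl, Finset.mul_sum]
  refine Finset.sum_nbij' (fun r => n - r) (fun r => n - r) ?_ ?_ ?_ ?_ ?_
  · intro r hr; rw [Finset.mem_Icc] at *; omega
  · intro r hr; rw [Finset.mem_Icc] at *; omega
  · intro r _; ring
  · intro r _; ring
  · intro r _; rw [h, sub_sub_cancel]

section Scalars

variable [Algebra ℂ A]

lemma scal_commute (f : LaurentSeries ℂ) (g : LaurentSeries A) :
    scal A f * g = g * scal A f := by
  have := mul_comm_of_coeff (f := scal A f) (g := g) (e := 0) fun r s => by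
    simp [scal, Algebra.commutes]
  simpa using this

lemma coeffHom_scal {B : Type} [Ring B] [Algebra ℂ B] (φ : A →ₐ[ℂ] B) (f : LaurentSeries ℂ) :
    coeffHom (φ : A →+* B) (scal A f) = scal B f := by
  ext r; simp [scal]

lemma coeffHom_scal₂ {B : Type} [Ring B] [Algebra ℂ B] (φ : A →ₐ[ℂ] B) (f : Series₂ ℂ) :
    coeffHom (coeffHom (φ : A →+* B)) (scal₂ A f) = scal₂ B f := by
  ext r; simp [scal₂]

end Scalars

/-! ### Exchange of the two variables -/

/-- `G(X,Y) = F(Y,X)`. -/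
def Swap (F G : Series₂ A) : Prop := ∀ r s, (G.coeff r).coeff s = (F.coeff s).coeff r

namespace Swap

variable {F G F' G' : Series₂ A}

lemma unique (h : Swap F G) (h' : Swap F G') : G = G' := by
  ext r s; rw [h, h']

lemma zero : Swap (0 : Series₂ A) 0 := fun _ _ => by simp

lemma one : Swap (1 : Series₂ A) 1 := fun r s => by
  simp only [HahnSeries.coeff_one]
  split_ifs <;> simp_all

lemma add (h : Swap F G) (h' : Swap F' G') : Swap (F + F') (G + G') := fun r s => by
  simp [h r s, h' r s]

lemma neg (h : Swap F G) : Swap (-F) (-G) := fun r s => by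
  simp [h r s]

/-- An element of `A((Y))((X))` may have poles in `Y` of unbounded order, so exchange is a relation
and not a map. When both `F` and its exchange exist, each bounds the inner poles of the other; the
coefficients of the product are then finite double sums whose order can be interchanged. -/
lemma mul (h : Swap F G) (h' : Swap F' G') : Swap (F * F') (G * G') := by
  obtain ⟨a, ha⟩ := exists_coeff_eq_zero_of_lt F
  obtain ⟨b, hb⟩ := exists_coeff_eq_zero_of_lt G
  obtain ⟨a', ha'⟩ := exists_coeff_eq_zero_of_lt F'
  obtain ⟨b', hb'⟩ := exists_coeff_eq_zero_of_lt G'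
  have hFb : ∀ r, ∀ s < b, (F.coeff r).coeff s = 0 := fun r s hs => by
    rw [← h, hb s hs]; rfl
  have hFb' : ∀ r, ∀ s < b', (F'.coeff r).coeff s = 0 := fun r s hs => by
    rw [← h', hb' s hs]; rfl
  have hGa : ∀ r, ∀ s < a, (G.coeff r).coeff s = 0 := fun r s hs => by
    rw [h, ha s hs]; rfl
  have hGa' : ∀ r, ∀ s < a', (G'.coeff r).coeff s = 0 := fun r s hs => by
    rw [h', ha' s hs]; rfl
  intro r s
  rw [coeff_mul_eq_sum hb hb' r subset_rfl, coeff_mul_eq_sum ha ha' s subset_rfl,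
    HahnSeries.coeff_sum, HahnSeries.coeff_sum]
  rw [Finset.sum_congr rfl fun x _ => coeff_mul_eq_sum (hGa x) (hGa' (r - x)) s subset_rfl,
    Finset.sum_comm,
    Finset.sum_congr rfl fun x _ => coeff_mul_eq_sum (hFb x) (hFb' (s - x)) r subset_rfl]
  exact Finset.sum_congr rfl fun x _ => Finset.sum_congr rfl fun y _ => by rw [h, h']

lemma inX (f : LaurentSeries A) : Swap (inX f) (inY f) := fun r s => by
  rw [inX_coeff_coeff, inY_coeff_coeff]

lemma inY (f : LaurentSeries A) : Swap (OpenChain.inY f) (OpenChain.inX f) := fun r s => by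
  rw [inX_coeff_coeff, inY_coeff_coeff]

lemma scal₂ [Algebra ℂ A] {f g : Series₂ ℂ} (h : Swap f g) :
    Swap (scal₂ A f) (OpenChain.scal₂ A g) := fun r s => by
  simp [OpenChain.scal₂, h r s]

end Swap

/-! ### Equating the two variables -/

/-- `f(x) = F(x,x)`. -/
def Diag (F : Series₂ A) (f : LaurentSeries A) : Prop :=
  ∃ a b : ℤ, (∀ r s, r < a ∨ s < b → (F.coeff r).coeff s = 0) ∧
    ∀ n, f.coeff n = ∑ r ∈ Finset.Icc a (n - b), (F.coeff r).coeff (n - r)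

namespace Diag

variable {F F' : Series₂ A} {f f' : LaurentSeries A}

/-- The bounds in `Diag` are existential; since coefficients outside any valid bounds vanish, every
choice yields the same diagonal sum. Uniqueness and additivity rest on this. -/
lemma coeff_eq {a b : ℤ} (hF : ∀ r s, r < a ∨ s < b → (F.coeff r).coeff s = 0)
    (h : Diag F f) (n : ℤ) {S : Finset ℤ} (hS : Finset.Icc a (n - b) ⊆ S) :
    f.coeff n = ∑ r ∈ S, (F.coeff r).coeff (n - r) := by
  obtain ⟨a', b', hF', h'⟩ := h
  rw [h' n]
  have key : ∀ a b : ℤ, (∀ r s, r < a ∨ s < b → (F.coeff r).coeff s = 0) → ∀ S : Finset ℤ,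
      Finset.Icc a (n - b) ⊆ S → ∑ r ∈ Finset.Icc a (n - b), (F.coeff r).coeff (n - r) =
        ∑ r ∈ S, (F.coeff r).coeff (n - r) := fun a b hF S hS =>
    Finset.sum_subset hS fun r _ hr => hF _ _ (by rw [Finset.mem_Icc] at hr; omega)
  rw [key _ _ hF' _ (Finset.subset_union_left (s₂ := Finset.Icc a (n - b))),
    ← key _ _ hF _ hS, key _ _ hF _ (Finset.subset_union_right (s₁ := Finset.Icc a' (n - b')))]

lemma unique (h : Diag F f) (h' : Diag F f') : f = f' := by
  obtain ⟨a, b, hF, h1⟩ := h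
  ext n
  rw [h1, coeff_eq hF h' n subset_rfl]

lemma zero : Diag (0 : Series₂ A) 0 := ⟨0, 0, by simp, by simp⟩

lemma add (h : Diag F f) (h' : Diag F' f') : Diag (F + F') (f + f') := by
  obtain ⟨a, b, hF, -⟩ := id h
  obtain ⟨a', b', hF', -⟩ := id h'
  refine ⟨min a a', min b b', fun r s hrs => ?_, fun n => ?_⟩
  · simp [hF r s (by omega), hF' r s (by omega)]
  · rw [HahnSeries.coeff_add, coeff_eq hF h n (S := Finset.Icc (min a a') (n - min b b')),
      coeff_eq hF' h' n (S := Finset.Icc (min a a') (n - min b b')), ← Finset.sum_add_distrib]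
    · simp
    · exact Finset.Icc_subset_Icc (by omega) (by omega)
    · exact Finset.Icc_subset_Icc (by omega) (by omega)

lemma neg (h : Diag F f) : Diag (-F) (-f) := by
  obtain ⟨a, b, hF, h⟩ := h
  exact ⟨a, b, fun r s hrs => by simp [hF r s hrs], fun n => by simp [h n]⟩

lemma inX (f : LaurentSeries A) : Diag (inX f) f := by
  obtain ⟨a, ha⟩ := exists_coeff_eq_zero_of_lt f
  refine ⟨a, 0, fun r s h => ?_, fun n => ?_⟩
  · rw [inX_coeff_coeff]
    split_ifs with hs
    · exact ha r (by omega)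
    · rfl
  · simp only [inX_coeff_coeff, sub_eq_zero, sub_zero]
    rw [Finset.sum_ite_eq]
    split_ifs with h
    · rfl
    · exact ha n (by rw [Finset.mem_Icc] at h; omega)

lemma inY (f : LaurentSeries A) : Diag (OpenChain.inY f) f := by
  obtain ⟨a, ha⟩ := exists_coeff_eq_zero_of_lt f
  refine ⟨0, a, fun r s h => ?_, fun n => ?_⟩
  · rw [inY_coeff_coeff]
    split_ifs with hs
    · exact ha s (by omega)
    · rfl
  · simp only [inY_coeff_coeff]
    rw [Finset.sum_ite_eq']
    split_ifs with h
    · simp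
    · exact ha n (by rw [Finset.mem_Icc] at h; omega)

lemma one : Diag (1 : Series₂ A) 1 := by simpa using inX (1 : LaurentSeries A)

lemma mul (h : Diag F f) (h' : Diag F' f') : Diag (F * F') (f * f') := by
  obtain ⟨a, b, hF, h⟩ := h
  obtain ⟨a', b', hF', h'⟩ := h'
  have hFa : ∀ r < a, F.coeff r = 0 := fun r hr => by ext s; exact hF r s (Or.inl hr)
  have hFa' : ∀ r < a', F'.coeff r = 0 := fun r hr => by ext s; exact hF' r s (Or.inl hr)
  have hf : ∀ n < a + b, f.coeff n = 0 := fun n hn => by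
    rw [h, Finset.Icc_eq_empty (by omega), Finset.sum_empty]
  have hf' : ∀ n < a' + b', f'.coeff n = 0 := fun n hn => by
    rw [h', Finset.Icc_eq_empty (by omega), Finset.sum_empty]
  have hco : ∀ R s, ((F * F').coeff R).coeff s = ∑ x ∈ Finset.Icc a (R - a'),
      ∑ y ∈ Finset.Icc b (s - b'), (F.coeff x).coeff y * (F'.coeff (R - x)).coeff (s - y) := by
    intro R s
    rw [coeff_mul_eq_sum hFa hFa' R subset_rfl, HahnSeries.coeff_sum]
    exact Finset.sum_congr rfl fun x _ => coeff_mul_eq_sum (fun y hy => hF x y (Or.inr hy))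
      (fun y hy => hF' _ y (Or.inr hy)) s subset_rfl
  refine ⟨a + a', b + b', fun r s hrs => ?_, fun n => ?_⟩
  · rw [hco]
    rcases hrs with hr | hs
    · rw [Finset.Icc_eq_empty (by omega), Finset.sum_empty]
    · rw [Finset.Icc_eq_empty (a := b) (by omega)]; simp
  · rw [coeff_mul_eq_sum hf hf' n subset_rfl]
    simp only [hco, h, h', Finset.sum_mul, Finset.mul_sum, Finset.sum_sigma']
    -- On one side the indices are the total degree taken from the first factor and the two
    -- `X`-exponents; on the other the `X`-exponent of the product and both exponents of the first
    -- factor.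
    refine Finset.sum_nbij' (fun p => ⟨p.2.2 + p.2.1, p.2.2, p.1 - p.2.2⟩)
      (fun p => ⟨p.2.1 + p.2.2, p.1 - p.2.1, p.2.1⟩) ?_ ?_ ?_ ?_ ?_
    · rintro ⟨m, r, r'⟩ hm
      simp only [Finset.mem_sigma, Finset.mem_Icc] at hm ⊢
      omega
    · rintro ⟨m, r, r'⟩ hm
      simp only [Finset.mem_sigma, Finset.mem_Icc] at hm ⊢
      omega
    · rintro ⟨m, r, r'⟩ _; simp
    · rintro ⟨m, r, r'⟩ _; simp
    · rintro ⟨m, r, r'⟩ _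
      simp only [add_sub_cancel_left]
      congr 2
      ring

lemma scal₂ [Algebra ℂ A] {F : Series₂ ℂ} {f : LaurentSeries ℂ} (h : Diag F f) :
    Diag (scal₂ A F) (scal A f) := by
  obtain ⟨a, b, hF, h⟩ := h
  exact ⟨a, b, fun r s hrs => by simp [OpenChain.scal₂, hF r s hrs],
    fun n => by simp [OpenChain.scal₂, scal, h n]⟩

end Diag

end Series

end OpenChain
end

open scoped TensorProduct LaurentSeries
noncomputable section
namespace OpenChain

/-! ### Substitution of a series of order one. -/

section Substitution

lemma order_zpow_of_order_eq_one {y : LaurentSeries ℂ} (hy : y.order = 1) (n : ℤ) :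
    (y ^ n).order = n := by
  have h0 : y ≠ 0 := by rintro rfl; simp at hy
  have hinv : (y⁻¹).order = -1 := by
    have := HahnSeries.order_mul h0 (inv_ne_zero h0)
    rw [mul_inv_cancel₀ h0, HahnSeries.order_one, hy] at this
    omega
  induction n using Int.induction_on with
  | zero => simp
  | succ n ih => rw [zpow_add_one₀ h0, HahnSeries.order_mul (zpow_ne_zero _ h0) h0, ih, hy]
  | pred n ih =>
    rw [zpow_sub_one₀ h0, HahnSeries.order_mul (zpow_ne_zero _ h0) (inv_ne_zero h0), ih, hinv]
    ring

lemma zpow_coeff_eq_zero {y : LaurentSeries ℂ} (hy : y.order = 1) {n r : ℤ} (h : r < n) :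
    (y ^ n).coeff r = 0 :=
  HahnSeries.coeff_eq_zero_of_lt_order (by rwa [order_zpow_of_order_eq_one hy])

variable {A : Type} [Ring A] [Algebra ℂ A]

/-- Since `yⁿ` has order `n`, terms with `n > r` vanish, and terms with `n < a` vanish with `f`; so
the range of summation can be enlarged at will. -/
lemma subst_coeff_eq_sum {y : LaurentSeries ℂ} (hy : y.order = 1) {f : LaurentSeries A} {a : ℤ}
    (hf : ∀ n < a, f.coeff n = 0) (r : ℤ) {S : Finset ℤ} (hS : Finset.Icc a r ⊆ S) :
    (subst f y).coeff r = ∑ n ∈ S, (y ^ n).coeff r • f.coeff n := by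
  have key : ∀ a, (∀ n < a, f.coeff n = 0) → ∀ S : Finset ℤ, Finset.Icc a r ⊆ S →
      ∑ n ∈ Finset.Icc a r, (y ^ n).coeff r • f.coeff n =
        ∑ n ∈ S, (y ^ n).coeff r • f.coeff n := fun a ha S hS =>
    Finset.sum_subset hS fun n _ hn => by
      rw [Finset.mem_Icc] at hn
      rcases lt_or_ge n a with h | h
      · simp [ha n h]
      · simp [zpow_coeff_eq_zero hy (n := n) (r := r) (by omega)]
  have hord : ∀ n < f.order, f.coeff n = 0 := fun _ h => HahnSeries.coeff_eq_zero_of_lt_order h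
  rw [subst_coeff, key _ hord _ (Finset.subset_union_left (s₂ := S)), ← key _ hf _ hS,
    key _ hf _ (hS.trans (Finset.subset_union_right (s₁ := Finset.Icc f.order r)))]

/-- Substitution of a series of order one is a ring homomorphism. -/
def substHom (A : Type) [Ring A] [Algebra ℂ A] {y : LaurentSeries ℂ} (hy : y.order = 1) :
    LaurentSeries A →+* LaurentSeries A where
  toFun f := subst f y
  map_zero' := by ext r; simp
  map_one' := by
    ext r
    rw [subst_coeff_eq_sum hy (a := 0) (fun n hn => by simp [HahnSeries.coeff_one, hn.ne]) r
      (S := insert 0 (Finset.Icc 0 r)) (Finset.subset_insert _ _)]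
    rw [Finset.sum_eq_single 0]
    · simp only [zpow_zero, HahnSeries.coeff_one]
      split_ifs <;> simp
    · intro n _ hn; simp [HahnSeries.coeff_one, hn]
    · simp
  map_add' f g := by
    ext r
    obtain ⟨a, ha⟩ := exists_coeff_eq_zero_of_lt f
    obtain ⟨b, hb⟩ := exists_coeff_eq_zero_of_lt g
    rw [HahnSeries.coeff_add,
      subst_coeff_eq_sum hy ha r (Finset.Icc_subset_Icc_left (min_le_left a b)),
      subst_coeff_eq_sum hy hb r (Finset.Icc_subset_Icc_left (min_le_right a b)),
      subst_coeff_eq_sum hy (f := f + g) (a := min a b) (fun n hn => by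
        rw [HahnSeries.coeff_add, ha n (by omega), hb n (by omega), add_zero]) r subset_rfl,
      ← Finset.sum_add_distrib]
    exact Finset.sum_congr rfl fun n _ => by rw [HahnSeries.coeff_add, smul_add]
  map_mul' f g := by
    have h0 : y ≠ 0 := by rintro rfl; simp at hy
    obtain ⟨a, ha⟩ := exists_coeff_eq_zero_of_lt f
    obtain ⟨b, hb⟩ := exists_coeff_eq_zero_of_lt g
    have hfa : ∀ r < a, (subst f y).coeff r = 0 := fun r hr => by
      rw [subst_coeff_eq_sum hy ha r subset_rfl, Finset.Icc_eq_empty (by omega), Finset.sum_empty]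
    have hgb : ∀ r < b, (subst g y).coeff r = 0 := fun r hr => by
      rw [subst_coeff_eq_sum hy hb r subset_rfl, Finset.Icc_eq_empty (by omega), Finset.sum_empty]
    have hfg : ∀ r < a + b, (f * g).coeff r = 0 := fun r hr => by
      rw [coeff_mul_eq_sum ha hb r subset_rfl, Finset.Icc_eq_empty (by omega), Finset.sum_empty]
    ext r
    rw [subst_coeff_eq_sum hy hfg r subset_rfl, coeff_mul_eq_sum hfa hgb r subset_rfl]
    have h1 : ∀ n ∈ Finset.Icc (a + b) r, (y ^ n).coeff r • (f * g).coeff n =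
        ∑ l ∈ Finset.Icc a (r - b), (y ^ n).coeff r • (f.coeff l * g.coeff (n - l)) := by
      intro n hn
      rw [Finset.mem_Icc] at hn
      rw [coeff_mul_eq_sum ha hb n (Finset.Icc_subset_Icc_right (by omega : n - b ≤ r - b)),
        Finset.smul_sum]
    have h2 : ∀ t ∈ Finset.Icc a (r - b), (subst f y).coeff t * (subst g y).coeff (r - t) =
        ∑ l ∈ Finset.Icc a (r - b), ∑ s ∈ Finset.Icc b (r - a),
          ((y ^ l).coeff t * (y ^ s).coeff (r - t)) • (f.coeff l * g.coeff s) := by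
      intro t ht
      rw [Finset.mem_Icc] at ht
      rw [subst_coeff_eq_sum hy ha t (Finset.Icc_subset_Icc_right (by omega : t ≤ r - b)),
        subst_coeff_eq_sum hy hb (r - t) (Finset.Icc_subset_Icc_right (by omega : r - t ≤ r - a)),
        Finset.sum_mul_sum]
      exact Finset.sum_congr rfl fun l _ => Finset.sum_congr rfl fun s _ => by
        rw [smul_mul_smul_comm]
    rw [Finset.sum_congr rfl h1, Finset.sum_congr rfl h2, Finset.sum_comm,
      Finset.sum_comm (s := Finset.Icc a (r - b)) (t := Finset.Icc a (r - b))]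
    refine Finset.sum_congr rfl fun l hl => ?_
    rw [Finset.mem_Icc] at hl
    rw [Finset.sum_comm]
    have h3 : ∀ s ∈ Finset.Icc b (r - a), ∑ t ∈ Finset.Icc a (r - b),
        ((y ^ l).coeff t * (y ^ s).coeff (r - t)) • (f.coeff l * g.coeff s) =
          (y ^ (l + s)).coeff r • (f.coeff l * g.coeff s) := by
      intro s hs
      rw [Finset.mem_Icc] at hs
      rw [← Finset.sum_smul, zpow_add₀ h0, coeff_mul_eq_sum (a := l) (b := s)
        (fun _ h => zpow_coeff_eq_zero hy h) (fun _ h => zpow_coeff_eq_zero hy h) r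
        (Finset.Icc_subset_Icc (by omega) (by omega) : _ ⊆ Finset.Icc a (r - b))]
    rw [Finset.sum_congr rfl h3]
    -- Both ranges may be cut down to `[l + b, r]`: below it the coefficient of `g` vanishes, above
    -- it `yⁿ` does not reach degree `r`.
    have h4 : ∑ n ∈ Finset.Icc (a + b) r, (y ^ n).coeff r • (f.coeff l * g.coeff (n - l)) =
        ∑ n ∈ Finset.Icc (l + b) (l + (r - a)),
          (y ^ n).coeff r • (f.coeff l * g.coeff (n - l)) := by
      have e : ∀ n, n ∈ Finset.Icc (l + b) r ↔
          n ∈ Finset.Icc (a + b) r ∧ n ∈ Finset.Icc (l + b) (l + (r - a)) := fun n => by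
        simp only [Finset.mem_Icc]; omega
      trans ∑ n ∈ Finset.Icc (l + b) r, (y ^ n).coeff r • (f.coeff l * g.coeff (n - l))
      · refine (Finset.sum_subset (fun n hn => ((e n).1 hn).1) fun n hn hn' => ?_).symm
        rw [hb _ (by simp only [Finset.mem_Icc] at hn hn'; omega), mul_zero, smul_zero]
      · refine Finset.sum_subset (fun n hn => ((e n).1 hn).2) fun n hn hn' => ?_
        rw [zpow_coeff_eq_zero hy (by simp only [Finset.mem_Icc] at hn hn'; omega), zero_smul]
    rw [h4]
    refine Finset.sum_nbij' (fun n => n - l) (fun s => l + s) ?_ ?_ ?_ ?_ ?_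
    · intro n hn; simp only [Finset.mem_Icc] at *; omega
    · intro n hn; simp only [Finset.mem_Icc] at *; omega
    · intro n _; ring
    · intro n _; ring
    · intro n _; simp

lemma substHom_apply {y : LaurentSeries ℂ} (hy : y.order = 1) (f : LaurentSeries A) :
    substHom A hy f = subst f y := rfl

lemma coeffHom_subst {B : Type} [Ring B] [Algebra ℂ B] (φ : A →ₐ[ℂ] B) {y : LaurentSeries ℂ}
    (hy : y.order = 1) (f : LaurentSeries A) :
    coeffHom (φ : A →+* B) (subst f y) = subst (coeffHom (φ : A →+* B) f) y := by
  obtain ⟨a, ha⟩ := exists_coeff_eq_zero_of_lt f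
  ext r
  rw [coeffHom_coeff, subst_coeff_eq_sum hy ha r subset_rfl,
    subst_coeff_eq_sum hy (a := a) (fun n hn => by simp [ha n hn]) r subset_rfl, map_sum]
  exact Finset.sum_congr rfl fun n _ => by simp [map_smul]

lemma single_zpow (c : ℂ) (hc : c ≠ 0) (n : ℤ) :
    (HahnSeries.single 1 c : LaurentSeries ℂ) ^ n = HahnSeries.single n (c ^ n) := by
  have h0 : (HahnSeries.single 1 c : LaurentSeries ℂ) ≠ 0 := HahnSeries.single_ne_zero hc
  have hinv : (HahnSeries.single 1 c : LaurentSeries ℂ)⁻¹ = HahnSeries.single (-1) c⁻¹ := by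
    rw [inv_eq_iff_eq_inv, eq_comm]
    apply inv_eq_of_mul_eq_one_left
    simp [HahnSeries.single_mul_single, hc]
  induction n using Int.induction_on with
  | zero => simp
  | succ n ih => rw [zpow_add_one₀ h0, ih, HahnSeries.single_mul_single, zpow_add_one₀ hc]
  | pred n ih =>
    rw [zpow_sub_one₀ h0, ih, hinv, HahnSeries.single_mul_single, zpow_sub_one₀ hc]
    rfl

lemma order_single_one {c : ℂ} (hc : c ≠ 0) :
    (HahnSeries.single 1 c : LaurentSeries ℂ).order = 1 := HahnSeries.order_single hc

lemma subst_single_coeff {c : ℂ} (hc : c ≠ 0) (f : LaurentSeries A) (r : ℤ) :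
    (subst f (HahnSeries.single 1 c)).coeff r = c ^ r • f.coeff r := by
  obtain ⟨a, ha⟩ := exists_coeff_eq_zero_of_lt f
  rw [subst_coeff_eq_sum (order_single_one hc) ha r (Finset.subset_insert r _),
    Finset.sum_eq_single r]
  · simp [single_zpow c hc]
  · intro n _ hn
    rw [single_zpow c hc, HahnSeries.coeff_single_of_ne hn.symm, zero_smul]
  · simp

lemma subst_single_one (f : LaurentSeries A) : subst f (HahnSeries.single 1 1) = f := by
  ext r; rw [subst_single_coeff one_ne_zero, one_zpow, one_smul]

lemma order_C_mul {c : ℂ} (hc : c ≠ 0) {y : LaurentSeries ℂ} (hy : y.order = 1) :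
    (HahnSeries.C c * y).order = 1 := by
  have h0 : y ≠ 0 := by rintro rfl; simp at hy
  rw [HahnSeries.order_mul (by simpa using hc) h0, hy]
  simp [HahnSeries.C_apply, HahnSeries.order_single hc]

/-- Transports `T⁻¹(ι(u))`, a rescaled series in `x`, to other values of the spectral parameter. -/
lemma subst_subst_single {c : ℂ} (hc : c ≠ 0) {y : LaurentSeries ℂ} (hy : y.order = 1)
    (f : LaurentSeries A) :
    subst (subst f (HahnSeries.single 1 c)) y = subst f (HahnSeries.C c * y) := by
  obtain ⟨a, ha⟩ := exists_coeff_eq_zero_of_lt f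
  ext r
  rw [subst_coeff_eq_sum hy (a := a) (fun n hn => by
      rw [subst_single_coeff hc, ha n hn, smul_zero]) r
      subset_rfl, subst_coeff_eq_sum (order_C_mul hc hy) ha r subset_rfl]
  refine Finset.sum_congr rfl fun n _ => ?_
  rw [subst_single_coeff hc, smul_smul, mul_zpow, ← map_zpow₀, mul_comm, HahnSeries.C_apply,
    HahnSeries.coeff_single_zero_mul]

lemma subst_scal {y : LaurentSeries ℂ} (hy : y.order = 1) (f : LaurentSeries ℂ) :
    subst (scal A f) y = scal A (subst f y) :=
  (coeffHom_subst (Algebra.ofId ℂ A) hy f).symm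

lemma subst_self_var {y : LaurentSeries ℂ} (hy : y.order = 1) :
    subst (HahnSeries.single 1 1 : LaurentSeries ℂ) y = y := by
  ext r
  rw [subst_coeff_eq_sum hy (a := 1) (fun n hn => by
    simp [HahnSeries.coeff_single_of_ne hn.ne]) r (Finset.subset_insert 1 _),
    Finset.sum_eq_single 1]
  · simp
  · intro n _ hn; simp [HahnSeries.coeff_single_of_ne hn]
  · simp

lemma algebraMap_laurent (c : ℂ) : algebraMap ℂ (LaurentSeries ℂ) c = HahnSeries.C c := by
  rw [HahnSeries.algebraMap_apply', PowerSeries.algebraMap_apply, HahnSeries.ofPowerSeries_C]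
  rfl

lemma algebraMap_series₂ (c : ℂ) :
    algebraMap ℂ (Series₂ ℂ) c = HahnSeries.C (HahnSeries.C c) := by
  rw [HahnSeries.algebraMap_apply', PowerSeries.algebraMap_apply, HahnSeries.ofPowerSeries_C,
    algebraMap_laurent]

lemma subst_algebraMap {y : LaurentSeries ℂ} (hy : y.order = 1) (c : ℂ) :
    substHom ℂ hy (algebraMap ℂ (LaurentSeries ℂ) c) = algebraMap ℂ (LaurentSeries ℂ) c := by
  have h : ∀ n : ℤ, n ≠ 0 → (HahnSeries.C c : LaurentSeries ℂ).coeff n = 0 := fun n hn => by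
    rw [HahnSeries.C_apply, HahnSeries.coeff_single_of_ne hn]
  rw [algebraMap_laurent]
  ext r
  rw [substHom_apply, subst_coeff_eq_sum hy (a := 0) (fun n hn => h n hn.ne) r
    (Finset.subset_insert 0 _), Finset.sum_eq_single 0]
  · simp only [HahnSeries.C_apply, HahnSeries.coeff_single, zpow_zero, HahnSeries.coeff_one]
    split_ifs <;> simp
  · intro n _ hn; rw [h n hn, smul_zero]
  · simp

end Substitution
end OpenChain
end

open scoped TensorProduct LaurentSeries
noncomputable section
namespace OpenChain

/-! ### Graded matrices as ordinary matrices. -/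

section GradedMatrices

lemma deg_eq_zero_or_one (m : ℕ) {N : ℕ} (i : Fin N) : deg m i = 0 ∨ deg m i = 1 := by
  unfold deg gr; split_ifs <;> simp

section Signs

variable {A : Type} [Ring A]

lemma sign_mul_sign_mul (a b : ℕ) (x y : A) :
    (-1) ^ a * x * ((-1) ^ b * y) = (-1) ^ (a + b) * (x * y) := by
  rw [neg_one_pow_mul_left, mul_assoc, ← mul_assoc, ← pow_add, add_comm]

lemma sign_mul_sign (a b : ℕ) (x : A) : (-1) ^ a * ((-1) ^ b * x) = (-1) ^ (a + b) * x := by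
  rw [← mul_assoc, pow_add]

lemma sign_mul_congr {a b : ℕ} (h : a % 2 = b % 2) (x : A) : (-1) ^ a * x = (-1) ^ b * x := by
  rw [neg_one_pow_congr h]

lemma sign_mul_self (a : ℕ) (x : A) : (-1) ^ a * ((-1) ^ a * x) = x := by
  rw [sign_mul_sign, sign_mul_congr (b := 0) (by omega), pow_zero, one_mul]

lemma sign_mul_injective (a : ℕ) {x y : A} (h : (-1) ^ a * x = (-1) ^ a * y) : x = y := by
  rw [← sign_mul_self a x, h, sign_mul_self]

end Signs

variable {A : Type} [Ring A] {N : ℕ} (m : ℕ)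

/-- The matrix of a globally even element acting on graded vectors; it turns the graded product
into the usual one. -/
def toMat (x : Fin N → Fin N → A) : Matrix (Fin N) (Fin N) A := fun i j =>
  (-1) ^ (deg m i * (deg m j + 1)) * x i j

/-- The matrix of a globally even element with two matrix factors acting on graded vectors. -/
def toMat₂ (x : Mat₂ N A) : Matrix (Fin N × Fin N) (Fin N × Fin N) A := fun I J =>
  (-1) ^ ((deg m I.2 + deg m J.2) * deg m J.1 +
    (deg m I.1 + deg m I.2) * (deg m J.1 + deg m J.2 + 1)) * x I.1 J.1 I.2 J.2

lemma toMat_injective : Function.Injective (toMat m : (Fin N → Fin N → A) → _) := by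
  intro x y h
  ext i j
  exact sign_mul_injective _ (congrFun (congrFun h i) j)

lemma toMat₂_injective : Function.Injective (toMat₂ m : Mat₂ N A → _) := by
  intro x y h
  ext i j k l
  exact sign_mul_injective _ (congrFun (congrFun h (i, k)) (j, l))

/-- The sign of the graded product is a coboundary: modulo 2, `[i]([j]+1) + ([i]+[a])([a]+[j])`
equals `[i]([a]+1) + [a]([j]+1)`. Associativity and the unit laws are thus inherited from ordinary
matrices. -/
lemma toMat_gmul (x y : Fin N → Fin N → A) : toMat m (gmul m x y) = toMat m x * toMat m y := by
  ext i j
  rw [Matrix.mul_apply]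
  simp only [toMat, gmul, Finset.mul_sum, sign_mul_sign_mul, sign_mul_sign]
  refine Finset.sum_congr rfl fun a _ => sign_mul_congr ?_ _
  rcases deg_eq_zero_or_one m i with h1 | h1 <;> rcases deg_eq_zero_or_one m j with h2 | h2 <;>
    rcases deg_eq_zero_or_one m a with h3 | h3 <;> simp [h1, h2, h3]

/-- With injectivity of `toMat₂`, relations with two matrix factors can be manipulated as words in
an ordinary associative ring, without further signs. -/
lemma toMat₂_gmul₂ (x y : Mat₂ N A) : toMat₂ m (gmul₂ m x y) = toMat₂ m x * toMat₂ m y := by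
  ext ⟨i, k⟩ ⟨q, s⟩
  rw [Matrix.mul_apply, Fintype.sum_prod_type]
  simp only [toMat₂, gmul₂, Finset.mul_sum, sign_mul_sign_mul, sign_mul_sign]
  refine Finset.sum_congr rfl fun j _ => Finset.sum_congr rfl fun l _ => sign_mul_congr ?_ _
  rcases deg_eq_zero_or_one m i with h1 | h1 <;> rcases deg_eq_zero_or_one m j with h2 | h2 <;>
    rcases deg_eq_zero_or_one m k with h3 | h3 <;> rcases deg_eq_zero_or_one m l with h4 | h4 <;>
    rcases deg_eq_zero_or_one m q with h5 | h5 <;> rcases deg_eq_zero_or_one m s with h6 | h6 <;>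
    simp only [h1, h2, h3, h4, h5, h6]

lemma toMat_gone : toMat m (gone : Fin N → Fin N → A) = 1 := by
  ext i j
  rw [Matrix.one_apply, toMat, gone]
  split_ifs with h
  · subst h
    rcases deg_eq_zero_or_one m i with h1 | h1 <;> simp [h1]
  · simp

lemma gmul_assoc (x y z : Fin N → Fin N → A) :
    gmul m (gmul m x y) z = gmul m x (gmul m y z) :=
  toMat_injective m (by simp only [toMat_gmul, mul_assoc])

/-- The identity with two matrix factors. -/
def gone₂ : Mat₂ N A := fun i j k l => if i = j ∧ k = l then 1 else 0

lemma toMat₂_gone₂ : toMat₂ m (gone₂ : Mat₂ N A) = 1 := by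
  ext ⟨i, k⟩ ⟨j, l⟩
  rw [Matrix.one_apply, toMat₂, gone₂]
  simp only [Prod.mk.injEq]
  split_ifs with h
  · obtain ⟨rfl, rfl⟩ := h
    rw [mul_one, neg_one_pow_congr (f := 0), pow_zero]
    rcases deg_eq_zero_or_one m i with h1 | h1 <;> rcases deg_eq_zero_or_one m k with h2 | h2 <;>
      simp only [h1, h2]
  · simp

lemma inOne_gone : inOne (gone : Fin N → Fin N → A) = gone₂ := by
  ext i j k l
  by_cases h1 : i = j <;> by_cases h2 : k = l <;> simp [inOne, gone, gone₂, h1, h2]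

lemma inTwo_gone : inTwo (gone : Fin N → Fin N → A) = gone₂ := by
  ext i j k l
  by_cases h1 : i = j <;> by_cases h2 : k = l <;> simp [inTwo, gone, gone₂, h1, h2]

lemma inOne_gmul (x y : Fin N → Fin N → A) :
    inOne (gmul m x y) = gmul₂ m (inOne x) (inOne y) := by
  ext i q k s
  simp only [inOne, gmul₂, gmul, mul_ite, ite_mul, mul_zero, zero_mul]
  by_cases h : k = s
  · subst h
    simp only [if_true]
    refine Finset.sum_congr rfl fun j _ => ?_
    simp only [Finset.sum_ite_eq', Finset.mem_univ, if_true]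
    apply sign_mul_congr
    rcases deg_eq_zero_or_one m i with h1 | h1 <;> rcases deg_eq_zero_or_one m j with h2 | h2 <;>
      rcases deg_eq_zero_or_one m k with h3 | h3 <;> rcases deg_eq_zero_or_one m q with h5 | h5 <;>
      simp only [h1, h2, h3, h5]
  · simp only [h, if_false]
    symm
    refine Finset.sum_eq_zero fun j _ => Finset.sum_eq_zero fun l _ => ?_
    split_ifs <;> simp_all

lemma inTwo_gmul (x y : Fin N → Fin N → A) :
    inTwo (gmul m x y) = gmul₂ m (inTwo x) (inTwo y) := by
  ext i q k s
  simp only [inTwo, gmul₂, gmul, mul_ite, ite_mul, mul_zero, zero_mul]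
  by_cases h : i = q
  · subst h
    simp only [if_true]
    rw [Finset.sum_comm]
    refine Finset.sum_congr rfl fun j _ => ?_
    rw [Finset.sum_eq_single i]
    · simp only [if_true]
      apply sign_mul_congr
      rcases deg_eq_zero_or_one m i with h1 | h1 <;> rcases deg_eq_zero_or_one m j with h2 | h2 <;>
        rcases deg_eq_zero_or_one m k with h3 | h3 <;>
        rcases deg_eq_zero_or_one m s with h5 | h5 <;> simp only [h1, h2, h3, h5]
    · intro b _ hb; simp [hb]
    · simp
  · simp only [h, if_false]
    symm
    refine Finset.sum_eq_zero fun j _ => Finset.sum_eq_zero fun l _ => ?_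
    split_ifs <;> simp_all

lemma gmul₂_inOne_inTwo (x y : Fin N → Fin N → A) (i j k l : Fin N) :
    gmul₂ m (inOne x) (inTwo y) i j k l =
      (-1) ^ ((deg m i + deg m j) * (deg m k + deg m l)) * (x i j * y k l) := by
  simp only [inOne, inTwo, gmul₂, mul_ite, ite_mul, mul_zero, zero_mul]
  rw [Finset.sum_eq_single j, Finset.sum_eq_single k]
  · simp only [if_true]
    apply sign_mul_congr
    rcases deg_eq_zero_or_one m i with h1 | h1 <;> rcases deg_eq_zero_or_one m j with h2 | h2 <;>
      rcases deg_eq_zero_or_one m k with h3 | h3 <;> rcases deg_eq_zero_or_one m l with h5 | h5 <;>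
      simp only [h1, h2, h3, h5]
  · intro b _ hb; simp [Ne.symm hb]
  · simp
  · intro b _ hb; simp [hb]
  · simp

lemma gmul₂_inTwo_inOne (x y : Fin N → Fin N → A) (i j k l : Fin N) :
    gmul₂ m (inTwo y) (inOne x) i j k l = y k l * x i j := by
  simp only [inOne, inTwo, gmul₂, mul_ite, ite_mul, mul_zero, zero_mul]
  rw [Finset.sum_eq_single i, Finset.sum_eq_single l]
  · simp only [if_true]
    rw [sign_mul_congr (b := 0), pow_zero, one_mul]
    rcases deg_eq_zero_or_one m i with h1 | h1 <;> rcases deg_eq_zero_or_one m j with h2 | h2 <;>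
      rcases deg_eq_zero_or_one m k with h3 | h3 <;> rcases deg_eq_zero_or_one m l with h5 | h5 <;>
      simp only [h1, h2, h3, h5]
  · intro b _ hb; simp [hb]
  · simp
  · intro b _ hb; simp [Ne.symm hb]
  · simp

/-- Entries of `x` and `y` commute in the graded sense. -/
def SuperCommute (x y : Fin N → Fin N → A) : Prop := ∀ i j k l,
  x i j * y k l = (-1) ^ ((deg m i + deg m j) * (deg m k + deg m l)) * (y k l * x i j)

variable {m}

lemma SuperCommute.symm {x y : Fin N → Fin N → A} (h : SuperCommute m x y) :
    SuperCommute m y x := fun i j k l => by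
  rw [h k l i j, mul_comm (deg m i + deg m j), sign_mul_self]

/-- The sign from moving the matrix units past each other cancels the sign from moving the entries.
-/
lemma SuperCommute.inOne_inTwo {x y : Fin N → Fin N → A} (h : SuperCommute m x y) :
    gmul₂ m (inOne x) (inTwo y) = gmul₂ m (inTwo y) (inOne x) := by
  ext i j k l
  rw [gmul₂_inOne_inTwo, gmul₂_inTwo_inOne, h i j k l, sign_mul_self]

variable (m)

/-- The graded flip of the two matrix factors. -/
def gflip (x : Mat₂ N A) : Mat₂ N A := fun i j k l =>
  (-1) ^ ((deg m i + deg m j) * (deg m k + deg m l)) * x k l i j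

/-- Multiplicativity of the flip turns a relation with `R₁₂` into one with `R₂₁`. -/
lemma gflip_gmul₂ (x y : Mat₂ N A) :
    gflip m (gmul₂ m x y) = gmul₂ m (gflip m x) (gflip m y) := by
  ext i q k s
  simp only [gflip, gmul₂, Finset.mul_sum, sign_mul_sign_mul, sign_mul_sign]
  rw [Finset.sum_comm]
  refine Finset.sum_congr rfl fun j _ => Finset.sum_congr rfl fun l _ => sign_mul_congr ?_ _
  rcases deg_eq_zero_or_one m i with h1 | h1 <;> rcases deg_eq_zero_or_one m j with h2 | h2 <;>
    rcases deg_eq_zero_or_one m k with h3 | h3 <;> rcases deg_eq_zero_or_one m l with h4 | h4 <;>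
    rcases deg_eq_zero_or_one m q with h5 | h5 <;> rcases deg_eq_zero_or_one m s with h6 | h6 <;>
    simp only [h1, h2, h3, h4, h5, h6]

lemma gflip_inOne (x : Fin N → Fin N → A) : gflip m (inOne x) = inTwo x := by
  ext i j k l
  simp only [gflip, inOne, inTwo]
  split_ifs with h
  · subst h
    rw [sign_mul_congr (b := 0), pow_zero, one_mul]
    rw [← two_mul, mul_assoc, Nat.mul_mod_right]
  · simp

lemma gflip_inTwo (x : Fin N → Fin N → A) : gflip m (inTwo x) = inOne x := by
  ext i j k l
  simp only [gflip, inOne, inTwo]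
  split_ifs with h
  · subst h
    rw [sign_mul_congr (b := 0), pow_zero, one_mul]
    rw [← two_mul, mul_left_comm, Nat.mul_mod_right]
  · simp

lemma gflip_scalMat [Algebra ℂ A] (x : Mat₂ N (Series₂ ℂ)) :
    gflip m (scalMat A x) = scalMat A (gflip m x) := by
  ext1 i; ext1 j; ext1 k; ext1 l
  simp only [gflip, scalMat, map_mul, map_pow, map_neg, map_one]

lemma gflip_R₁₂ (M : Model) (n : ℕ) {S : Type} [Field S] [Algebra ℂ S] (u v : S) :
    gflip m (R₁₂ M m n u v) = R₂₁ M m n u v := by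
  ext i j k l
  simp only [gflip, R₁₂, R₂₁, mul_add]
  congr 1
  · by_cases h : i = j ∧ k = l
    · obtain ⟨rfl, rfl⟩ := h
      rw [neg_one_pow_congr (f := 0), pow_zero, one_mul]
      · simp
      · rw [← two_mul, Nat.mul_mod_right]
    · have h' : ¬ (k = l ∧ i = j) := fun h' => h h'.symm
      simp [h, h']
  · by_cases h : k = j ∧ l = i
    · obtain ⟨rfl, rfl⟩ := h
      simp only [and_self, if_true]
      apply sign_mul_congr
      rcases deg_eq_zero_or_one m l with h1 | h1 <;> rcases deg_eq_zero_or_one m k with h2 | h2 <;>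
        simp [h1, h2]
    · have h' : ¬ (i = l ∧ j = k) := fun h' => h ⟨h'.2.symm, h'.1.symm⟩
      simp [h, h']

section Maps

variable {B : Type} [Ring B]

lemma map_gmul (φ : A →+* B) (x y : Fin N → Fin N → A) (i j : Fin N) :
    φ (gmul m x y i j) = gmul m (fun i j => φ (x i j)) (fun i j => φ (y i j)) i j := by
  simp only [gmul, map_sum, map_mul, map_pow, map_neg, map_one]

lemma map_gmul₂ (φ : A →+* B) (x y : Mat₂ N A) (i j k l : Fin N) :
    φ (gmul₂ m x y i j k l) =
      gmul₂ m (fun i j k l => φ (x i j k l)) (fun i j k l => φ (y i j k l)) i j k l := by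
  simp only [gmul₂, map_sum, map_mul, map_pow, map_neg, map_one]

lemma map_inOne (φ : A →+* B) (x : Fin N → Fin N → A) :
    (fun i j k l => φ (inOne x i j k l)) = inOne fun i j => φ (x i j) := by
  ext i j k l; simp only [inOne]; split_ifs <;> simp

lemma map_inTwo (φ : A →+* B) (x : Fin N → Fin N → A) :
    (fun i j k l => φ (inTwo x i j k l)) = inTwo fun i j => φ (x i j) := by
  ext i j k l; simp only [inTwo]; split_ifs <;> simp

lemma map_gone (φ : A →+* B) :
    (fun i j => φ (gone i j)) = (gone : Fin N → Fin N → B) := by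
  ext i j; simp only [gone]; split_ifs <;> simp

end Maps

lemma inX_gmul (x y : Fin N → Fin N → LaurentSeries A) :
    (fun i j => inX (gmul m x y i j)) = gmul m (fun i j => inX (x i j)) fun i j => inX (y i j) := by
  ext1 i; ext1 j
  exact map_gmul m (coeffHom (HahnSeries.C : A →+* LaurentSeries A)) x y i j

lemma inY_gmul (x y : Fin N → Fin N → LaurentSeries A) :
    (fun i j => inY (gmul m x y i j)) = gmul m (fun i j => inY (x i j)) fun i j => inY (y i j) := by
  ext1 i; ext1 j
  exact map_gmul m (HahnSeries.C : LaurentSeries A →+* Series₂ A) x y i j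

end GradedMatrices
end OpenChain
end

open scoped TensorProduct LaurentSeries
noncomputable section
namespace OpenChain

/-! ### Mode expansions and universal properties of the two algebras. -/

section Modes

variable {A : Type} [Ring A]

lemma modeSeries_coeff (e : ℕ) (g : ℕ → A) (r : ℤ) :
    (modeSeries e g).coeff r = if 0 ≤ r ∧ (e : ℤ) ∣ r then g (r.toNat / e) else 0 := by
  by_cases hr : 0 ≤ r
  · obtain ⟨r, rfl⟩ := Int.eq_ofNat_of_zero_le hr
    rw [modeSeries]
    erw [HahnSeries.ofPowerSeries_apply_coeff]
    rw [PowerSeries.coeff_mk]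
    simp [Int.natCast_dvd_natCast]
  · rw [if_neg (fun h => hr h.1), modeSeries, HahnSeries.ofPowerSeries_apply]
    apply HahnSeries.embDomain_of_notMem_range
    rintro ⟨x, hx⟩
    apply hr
    rw [← hx]
    simp

/-- `f` is a series in nonnegative powers of `x ^ e`. -/
def IsMode (e : ℕ) (f : LaurentSeries A) : Prop :=
  ∀ r : ℤ, ¬ (0 ≤ r ∧ (e : ℤ) ∣ r) → f.coeff r = 0

lemma isMode_modeSeries (e : ℕ) (g : ℕ → A) : IsMode e (modeSeries e g) := fun r hr => by
  rw [modeSeries_coeff, if_neg hr]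

lemma IsMode.eq_modeSeries {e : ℕ} {f : LaurentSeries A} (h : IsMode e f) (he : 0 < e) :
    f = modeSeries e fun r => f.coeff (e * r) := by
  ext r
  rw [modeSeries_coeff]
  split_ifs with hr
  · obtain ⟨h0, k, rfl⟩ := hr
    have hk : 0 ≤ k := nonneg_of_mul_nonneg_right h0 (by exact_mod_cast he)
    obtain ⟨k, rfl⟩ := Int.eq_ofNat_of_zero_le hk
    have : ((e : ℤ) * (k : ℤ)).toNat = e * k := by rw [← Nat.cast_mul, Int.toNat_natCast]
    rw [this, Nat.mul_div_cancel_left _ he]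
  · exact h r hr

lemma IsMode.sum {ι : Type} {s : Finset ι} {e : ℕ} {f : ι → LaurentSeries A}
    (h : ∀ i ∈ s, IsMode e (f i)) : IsMode e (∑ i ∈ s, f i) := fun r hr => by
  rw [HahnSeries.coeff_sum]
  exact Finset.sum_eq_zero fun i hi => h i hi r hr

lemma IsMode.sign_mul {e : ℕ} {f : LaurentSeries A} (k : ℕ) (h : IsMode e f) :
    IsMode e ((-1) ^ k * f) := fun r hr => by rw [coeff_neg_one_pow_mul, h r hr, mul_zero]

lemma IsMode.coeff_eq_zero_of_neg {e : ℕ} {f : LaurentSeries A} (h : IsMode e f) :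
    ∀ r < 0, f.coeff r = 0 := fun r hr => h r fun h' => by omega

lemma IsMode.mul {e : ℕ} {f g : LaurentSeries A} (hf : IsMode e f) (hg : IsMode e g) :
    IsMode e (f * g) := fun r hr => by
  rw [coeff_mul_eq_sum hf.coeff_eq_zero_of_neg hg.coeff_eq_zero_of_neg r subset_rfl]
  refine Finset.sum_eq_zero fun k hk => ?_
  rw [Finset.mem_Icc] at hk
  by_cases h1 : (e : ℤ) ∣ k
  · rw [hg (r - k), mul_zero]
    rintro ⟨h0, h2⟩
    exact hr ⟨by omega, by simpa using dvd_add h2 h1⟩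
  · rw [hf k (fun h => h1 h.2), zero_mul]

lemma IsMode.gmul {N e m : ℕ} {x y : Fin N → Fin N → LaurentSeries A}
    (hx : ∀ i j, IsMode e (x i j)) (hy : ∀ i j, IsMode e (y i j)) (i j : Fin N) :
    IsMode e (gmul m x y i j) :=
  IsMode.sum fun a _ => ((hx i a).mul (hy a j)).sign_mul _

lemma IsMode.coeffHom {B : Type} [Ring B] {e : ℕ} {f : LaurentSeries A} (h : IsMode e f)
    (φ : A →+* B) : IsMode e (coeffHom φ f) := fun r hr => by
  rw [coeffHom_coeff, h r hr, map_zero]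

/-- The constant term of a product of series without polar part. -/
lemma IsMode.coeff_mul_zero {e : ℕ} {f g : LaurentSeries A} (hf : IsMode e f) (hg : IsMode e g) :
    (f * g).coeff 0 = f.coeff 0 * g.coeff 0 := by
  rw [coeff_mul_eq_sum hf.coeff_eq_zero_of_neg hg.coeff_eq_zero_of_neg 0 subset_rfl]
  simp

lemma IsMode.coeff_gmul_zero {N e m : ℕ} {x y : Fin N → Fin N → LaurentSeries A}
    (hx : ∀ i j, IsMode e (x i j)) (hy : ∀ i j, IsMode e (y i j)) (i j : Fin N) :
    (OpenChain.gmul m x y i j).coeff 0 =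
      OpenChain.gmul m (fun i j => (x i j).coeff 0) (fun i j => (y i j).coeff 0) i j := by
  simp only [OpenChain.gmul, HahnSeries.coeff_sum, coeff_neg_one_pow_mul]
  exact Finset.sum_congr rfl fun a _ => by rw [(hx i a).coeff_mul_zero (hy a j)]

lemma coeffHom_modeSeries_apply {B : Type} [Ring B] (φ : A →+* B) (e : ℕ) (g : ℕ → A) :
    coeffHom φ (modeSeries e g) = modeSeries e fun r => φ (g r) := by
  ext r
  rw [coeffHom_coeff, modeSeries_coeff, modeSeries_coeff]
  split_ifs <;> simp

end Modes

lemma Model.step_pos (M : Model) : 0 < M.step := by cases M <;> simp [Model.step]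

/-! ### Homomorphisms out of `A_{m|n}` and out of the reflection algebra -/

section Universal

variable (M : Model) (m n : ℕ) {B : Type} [Ring B] [Algebra ℂ B]

/-- The relation `R₁₂ x₁(X) y₂(Y) = y₂(Y) x₁(X) R₁₂` for a scalar matrix `R`. -/
def Intertwines (R : Mat₂ (m + n) (Series₂ ℂ))
    (x y : Fin (m + n) → Fin (m + n) → LaurentSeries B) : Prop :=
  gmul₂ m (gmul₂ m (scalMat B R) (inOne fun i j => inX (x i j))) (inTwo fun i j => inY (y i j)) =
    gmul₂ m (gmul₂ m (inTwo fun i j => inY (y i j)) (inOne fun i j => inX (x i j))) (scalMat B R)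

/-- The value of a generator of `A_{m|n}`, read off from the matrices `T^±` and `(T⁻)⁻¹`. -/
def genVal (T : Side → Fin (m + n) → Fin (m + n) → LaurentSeries B)
    (T' : Fin (m + n) → Fin (m + n) → LaurentSeries B) : Gen (m + n) → B
  | .t ε i j r => (T ε i j).coeff (M.step * r)
  | .t' i j r => (T' i j).coeff (M.step * r)

/-- Matrices over `B` that satisfy the defining relations of `A_{m|n}`. -/
structure IsMonodromy (T : Side → Fin (m + n) → Fin (m + n) → LaurentSeries B)
    (T' : Fin (m + n) → Fin (m + n) → LaurentSeries B) : Prop where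
  mode : ∀ ε i j, IsMode M.step (T ε i j)
  mode' : ∀ i j, IsMode M.step (T' i j)
  rtt : ∀ ε ε', ¬ (ε = Side.minus ∧ ε' = Side.plus) →
    Intertwines m n (R₁₂ M m n (specVar M ε varX) (specVar M ε' varY)) (T ε) (T ε')
  inv_right : gmul m (T .minus) T' = gone
  inv_left : gmul m T' (T .minus) = gone
  init : ∀ x y, InitRel (m + n) M x y →
    FreeAlgebra.lift ℂ (genVal M m n T T') x = FreeAlgebra.lift ℂ (genVal M m n T T') y

variable {M m n}

lemma scalMat_map {A : Type} [Ring A] [Algebra ℂ A] (φ : A →ₐ[ℂ] B) {N : ℕ}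
    (R : Mat₂ N (Series₂ ℂ)) :
    (fun i j k l => coeffHom (coeffHom (φ : A →+* B)) (scalMat A R i j k l)) = scalMat B R := by
  ext1 i; ext1 j; ext1 k; ext1 l
  exact coeffHom_scal₂ φ _

section Images

variable {A : Type} [Ring A] [Algebra ℂ A] (φ : A →ₐ[ℂ] B)
  (R : Mat₂ (m + n) (Series₂ ℂ)) (x y : Fin (m + n) → Fin (m + n) → LaurentSeries A)
  (i j k l : Fin (m + n))

lemma map_rttL :
    coeffHom (coeffHom (φ : A →+* B)) (gmul₂ m (gmul₂ m (scalMat A R)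
      (inOne fun i j => inX (x i j))) (inTwo fun i j => inY (y i j)) i j k l) =
    gmul₂ m (gmul₂ m (scalMat B R) (inOne fun i j => inX (coeffHom (φ : A →+* B) (x i j))))
      (inTwo fun i j => inY (coeffHom (φ : A →+* B) (y i j))) i j k l := by
  simp only [map_gmul₂, map_inOne, map_inTwo, scalMat_map, coeffHom_coeffHom_inX,
    coeffHom_coeffHom_inY]

lemma map_rttR :
    coeffHom (coeffHom (φ : A →+* B)) (gmul₂ m (gmul₂ m (inTwo fun i j => inY (y i j))
      (inOne fun i j => inX (x i j))) (scalMat A R) i j k l) =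
    gmul₂ m (gmul₂ m (inTwo fun i j => inY (coeffHom (φ : A →+* B) (y i j)))
      (inOne fun i j => inX (coeffHom (φ : A →+* B) (x i j)))) (scalMat B R) i j k l := by
  simp only [map_gmul₂, map_inOne, map_inTwo, scalMat_map, coeffHom_coeffHom_inX,
    coeffHom_coeffHom_inY]

lemma map_reflL : coeffHom (coeffHom (φ : A →+* B)) (reflL M m n x i j k l) =
    reflL M m n (fun i j => coeffHom (φ : A →+* B) (x i j)) i j k l := by
  simp only [reflL, map_gmul₂, map_inOne, map_inTwo, scalMat_map, coeffHom_coeffHom_inX,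
    coeffHom_coeffHom_inY]

lemma map_reflR : coeffHom (coeffHom (φ : A →+* B)) (reflR M m n x i j k l) =
    reflR M m n (fun i j => coeffHom (φ : A →+* B) (x i j)) i j k l := by
  simp only [reflR, map_gmul₂, map_inOne, map_inTwo, scalMat_map, coeffHom_coeffHom_inX,
    coeffHom_coeffHom_inY]

end Images

namespace IsMonodromy

variable {T : Side → Fin (m + n) → Fin (m + n) → LaurentSeries B}
  {T' : Fin (m + n) → Fin (m + n) → LaurentSeries B}

lemma coeffHom_lift_freeT (h : IsMonodromy M m n T T') (ε : Side) (i j : Fin (m + n)) :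
    coeffHom (FreeAlgebra.lift ℂ (genVal M m n T T') : FreeMono (m + n) →+* B)
      (freeT M ε i j) = T ε i j := by
  rw [freeT, coeffHom_modeSeries_apply, (h.mode ε i j).eq_modeSeries M.step_pos]
  congr 1
  funext r
  simp [genVal]

lemma coeffHom_lift_freeT' (h : IsMonodromy M m n T T') (i j : Fin (m + n)) :
    coeffHom (FreeAlgebra.lift ℂ (genVal M m n T T') : FreeMono (m + n) →+* B)
      (freeT' M i j) = T' i j := by
  rw [freeT', coeffHom_modeSeries_apply, (h.mode' i j).eq_modeSeries M.step_pos]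
  congr 1
  funext r
  simp [genVal]

/-- The mode conditions ensure that the matrices are recovered from the values on generators;
applied coefficientwise, the lift then carries each defining relation to the corresponding field of
`IsMonodromy`. -/
lemma exists_lift (h : IsMonodromy M m n T T') : ∃ φ : Mono M m n →ₐ[ℂ] B,
    (∀ ε i j, coeffHom (φ : Mono M m n →+* B) (tSeries M m n ε i j) = T ε i j) ∧
    ∀ i j, coeffHom (φ : Mono M m n →+* B) (t'Series M m n i j) = T' i j := by
  set F := FreeAlgebra.lift ℂ (genVal M m n T T') with hF
  have hT := h.coeffHom_lift_freeT
  have hT' := h.coeffHom_lift_freeT'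
  rw [← hF] at hT hT'
  have hrel : ∀ ⦃x y⦄, MonoRel M m n x y → F x = F y := by
    intro x y hxy
    cases hxy with
    | rtt ε ε' hε i j k l r s =>
      have key := congrFun (congrFun (congrFun (congrFun (h.rtt ε ε' hε) i) j) k) l
      have e1 := map_rttL F (R₁₂ M m n (specVar M ε varX) (specVar M ε' varY))
        (freeT M ε) (freeT M ε') i j k l
      have e2 := map_rttR F (R₁₂ M m n (specVar M ε varX) (specVar M ε' varY))
        (freeT M ε) (freeT M ε') i j k l
      simp only [hT] at e1 e2
      have e := e1.trans (key.trans e2.symm)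
      exact congrArg (fun f : Series₂ B => (f.coeff r).coeff s) e
    | inv_right i j r =>
      have e := map_gmul m (coeffHom (F : FreeMono (m + n) →+* B)) (freeT M .minus) (freeT' M) i j
      simp only [hT, hT', h.inv_right] at e
      have e2 := congrFun (congrFun (map_gone (N := m + n)
        (coeffHom (F : FreeMono (m + n) →+* B))) i) j
      exact congrArg (fun f : LaurentSeries B => f.coeff r) (e.trans e2.symm)
    | inv_left i j r =>
      have e := map_gmul m (coeffHom (F : FreeMono (m + n) →+* B)) (freeT' M) (freeT M .minus) i j
      simp only [hT, hT', h.inv_left] at e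
      have e2 := congrFun (congrFun (map_gone (N := m + n)
        (coeffHom (F : FreeMono (m + n) →+* B))) i) j
      exact congrArg (fun f : LaurentSeries B => f.coeff r) (e.trans e2.symm)
    | init x y hxy => exact h.init x y hxy
  refine ⟨RingQuot.liftAlgHom ℂ ⟨F, hrel⟩, fun ε i j => ?_, fun i j => ?_⟩
  · rw [← hT ε i j, tSeries, coeffHom_comp]
    ext r
    exact RingQuot.liftAlgHom_mkAlgHom_apply ℂ F hrel _
  · rw [← hT' i j, t'Series, coeffHom_comp]
    ext r
    exact RingQuot.liftAlgHom_mkAlgHom_apply ℂ F hrel _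

end IsMonodromy

lemma freeT_coeff {N : ℕ} (ε : Side) (i j : Fin N) (r : ℕ) :
    (freeT M ε i j).coeff (M.step * r) = genι (.t ε i j r) := by
  rw [freeT, modeSeries_coeff, if_pos ⟨by positivity, dvd_mul_right _ _⟩, ← Nat.cast_mul,
    Int.toNat_natCast, Nat.mul_div_cancel_left _ M.step_pos]

lemma freeT'_coeff {N : ℕ} (i j : Fin N) (r : ℕ) :
    (freeT' M i j).coeff (M.step * r) = genι (.t' i j r) := by
  rw [freeT', modeSeries_coeff, if_pos ⟨by positivity, dvd_mul_right _ _⟩, ← Nat.cast_mul,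
    Int.toNat_natCast, Nat.mul_div_cancel_left _ M.step_pos]

variable (M m n)

/-- The tautological monodromy matrices of `A_{m|n}`. -/
lemma isMonodromy_tSeries : IsMonodromy M m n (tSeries M m n) (t'Series M m n) where
  mode ε i j := (isMode_modeSeries _ _).coeffHom _
  mode' i j := (isMode_modeSeries _ _).coeffHom _
  rtt ε ε' hε := by
    ext i j k l r s
    have e1 := map_rttL (Mono.mk M m n) (R₁₂ M m n (specVar M ε varX) (specVar M ε' varY))
        (freeT M ε) (freeT M ε') i j k l
    have e2 := map_rttR (Mono.mk M m n) (R₁₂ M m n (specVar M ε varX) (specVar M ε' varY))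
        (freeT M ε) (freeT M ε') i j k l
    have e := RingQuot.mkAlgHom_rel ℂ (MonoRel.rtt (M := M) ε ε' hε i j k l r s)
    have e1' := congrArg (fun f : Series₂ (Mono M m n) => (f.coeff r).coeff s) e1
    have e2' := congrArg (fun f : Series₂ (Mono M m n) => (f.coeff r).coeff s) e2
    exact e1'.symm.trans (Eq.trans e e2')
  inv_right := by
    ext i j r
    have e1 := map_gmul m (coeffHom (Mono.mk M m n : FreeMono (m + n) →+* Mono M m n))
      (freeT M .minus) (freeT' M) i j
    have e2 := congrFun (congrFun (map_gone (N := m + n)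
      (coeffHom (Mono.mk M m n : FreeMono (m + n) →+* Mono M m n))) i) j
    have e := RingQuot.mkAlgHom_rel ℂ (MonoRel.inv_right (M := M) (m := m) (n := n) i j r)
    exact (congrArg (fun f : LaurentSeries (Mono M m n) => f.coeff r) e1).symm.trans
      (Eq.trans e (congrArg (fun f : LaurentSeries (Mono M m n) => f.coeff r) e2))
  inv_left := by
    ext i j r
    have e1 := map_gmul m (coeffHom (Mono.mk M m n : FreeMono (m + n) →+* Mono M m n))
      (freeT' M) (freeT M .minus) i j
    have e2 := congrFun (congrFun (map_gone (N := m + n)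
      (coeffHom (Mono.mk M m n : FreeMono (m + n) →+* Mono M m n))) i) j
    have e := RingQuot.mkAlgHom_rel ℂ (MonoRel.inv_left (M := M) (m := m) (n := n) i j r)
    exact (congrArg (fun f : LaurentSeries (Mono M m n) => f.coeff r) e1).symm.trans
      (Eq.trans e (congrArg (fun f : LaurentSeries (Mono M m n) => f.coeff r) e2))
  init x y hxy := by
    have e : FreeAlgebra.lift ℂ (genVal M m n (tSeries M m n) (t'Series M m n)) =
        Mono.mk M m n := by
      ext g
      cases g with
      | t ε i j r => simp [genVal, tSeries, freeT_coeff]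
      | t' i j r => simp [genVal, t'Series, freeT'_coeff]
    rw [e]
    exact RingQuot.mkAlgHom_rel ℂ (MonoRel.init x y hxy)

variable {M m n}

lemma Mono.algHom_ext {φ ψ : Mono M m n →ₐ[ℂ] B}
    (h : ∀ ε i j, coeffHom (φ : Mono M m n →+* B) (tSeries M m n ε i j) =
      coeffHom (ψ : Mono M m n →+* B) (tSeries M m n ε i j))
    (h' : ∀ i j, coeffHom (φ : Mono M m n →+* B) (t'Series M m n i j) =
      coeffHom (ψ : Mono M m n →+* B) (t'Series M m n i j)) : φ = ψ := by
  apply RingQuot.ringQuot_ext'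
  ext g
  cases g with
  | t ε i j r =>
    have := congrArg (fun f : LaurentSeries B => f.coeff (M.step * r)) (h ε i j)
    simpa [tSeries, freeT_coeff] using! this
  | t' i j r =>
    have := congrArg (fun f : LaurentSeries B => f.coeff (M.step * r)) (h' i j)
    simpa [t'Series, freeT'_coeff] using! this

lemma freeD_coeff {N : ℕ} (p : ℕ) (i j : Fin N) (r : ℤ) :
    (freeD p i j).coeff r =
      if 0 ≤ r + p then FreeAlgebra.ι ℂ (.d i j (r + p).toNat) else 0 := by
  rw [freeD, HahnSeries.coeff_single_mul, one_mul, modeSeries_coeff, sub_neg_eq_add]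
  simp

variable {p : ℕ}

lemma Refl.algHom_ext {φ ψ : Refl M m n p →ₐ[ℂ] B}
    (h : ∀ i j, coeffHom (φ : Refl M m n p →+* B) (dSeries M m n p i j) =
      coeffHom (ψ : Refl M m n p →+* B) (dSeries M m n p i j)) : φ = ψ := by
  apply RingQuot.ringQuot_ext'
  ext g
  cases g with
  | d i j r =>
    have := congrArg (fun f : LaurentSeries B => f.coeff (r - p)) (h i j)
    simpa [dSeries, freeD_coeff] using! this

/-- The generators record only the coefficients from degree `-p` on, so the pole bound is what makes
the image of the generating matrix equal to all of `D`. -/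
lemma Refl.exists_lift {D : Fin (m + n) → Fin (m + n) → LaurentSeries B}
    (hp : ∀ i j, ∀ r : ℤ, r < -(p : ℤ) → (D i j).coeff r = 0)
    (hD : reflL M m n D = reflR M m n D) : ∃ φ : Refl M m n p →ₐ[ℂ] B,
    ∀ i j, coeffHom (φ : Refl M m n p →+* B) (dSeries M m n p i j) = D i j := by
  set F : FreeRefl (m + n) →ₐ[ℂ] B := FreeAlgebra.lift ℂ fun g : ReflGen (m + n) =>
    match g with
    | .d i j r => (D i j).coeff (r - p) with hF
  have hT : ∀ i j, coeffHom (F : FreeRefl (m + n) →+* B) (freeD p i j) = D i j := by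
    intro i j
    ext r
    rw [coeffHom_coeff, freeD_coeff]
    split_ifs with h
    · simp [hF, h]
    · rw [map_zero, hp i j r (by omega)]
  have hrel : ∀ ⦃x y⦄, ReflRel M m n p x y → F x = F y := by
    intro x y hxy
    cases hxy with
    | refl i j k l r s =>
      have key := congrFun (congrFun (congrFun (congrFun hD i) j) k) l
      have e1 := map_reflL (M := M) F (freeD p) i j k l
      have e2 := map_reflR (M := M) F (freeD p) i j k l
      simp only [hT] at e1 e2
      exact congrArg (fun f : Series₂ B => (f.coeff r).coeff s) (e1.trans (key.trans e2.symm))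
  refine ⟨RingQuot.liftAlgHom ℂ ⟨F, hrel⟩, fun i j => ?_⟩
  rw [← hT i j, dSeries, coeffHom_comp]
  ext r
  exact RingQuot.liftAlgHom_mkAlgHom_apply ℂ F hrel _

variable (M m n p)

lemma dSeries_reflection : reflL M m n (dSeries M m n p) = reflR M m n (dSeries M m n p) := by
  ext i j k l r s
  have e1 := map_reflL (M := M) (Refl.mk M m n p) (freeD p) i j k l
  have e2 := map_reflR (M := M) (Refl.mk M m n p) (freeD p) i j k l
  have e := RingQuot.mkAlgHom_rel ℂ (ReflRel.refl (M := M) (p := p) i j k l r s)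
  exact (congrArg (fun f : Series₂ (Refl M m n p) => (f.coeff r).coeff s) e1).symm.trans
    (Eq.trans e (congrArg (fun f : Series₂ (Refl M m n p) => (f.coeff r).coeff s) e2))

lemma dSeries_pole (i j : Fin (m + n)) (r : ℤ) (hr : r < -(p : ℤ)) :
    (dSeries M m n p i j).coeff r = 0 := by
  rw [dSeries, coeffHom_coeff, freeD_coeff, if_neg (by omega), map_zero]

end Universal
end OpenChain
end

open scoped TensorProduct LaurentSeries
noncomputable section
namespace OpenChain

/-! ### Supercommuting matrices and the coproduct of `A_{m|n}` -/

section Coproduct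

variable {N : ℕ} {A B : Type} [Ring A] [Ring B]

/-- All coefficients of the entries of `x` and `y` commute in the graded sense. -/
def CoeffSuperCommute (m : ℕ) (x y : Fin N → Fin N → LaurentSeries A) : Prop :=
  ∀ r s, SuperCommute m (fun i j => (x i j).coeff r) (fun i j => (y i j).coeff s)

namespace CoeffSuperCommute

variable {m : ℕ} {x y z : Fin N → Fin N → LaurentSeries A}

lemma symm (h : CoeffSuperCommute m x y) : CoeffSuperCommute m y x := fun r s => (h s r).symm

lemma inX_inY (h : CoeffSuperCommute m x y) :
    SuperCommute m (fun i j => inX (x i j)) (fun i j => inY (y i j)) := fun i j k l =>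
  inX_mul_inY_comm fun r s => h r s i j k l

lemma superCommute (h : CoeffSuperCommute m x y) : SuperCommute m x y := fun i j k l =>
  mul_comm_of_coeff fun r s => h r s i j k l

end CoeffSuperCommute

lemma gone_gmul (m : ℕ) (x : Fin N → Fin N → A) : gmul m gone x = x :=
  toMat_injective m (by rw [toMat_gmul, toMat_gone, one_mul])

lemma gmul_gone (m : ℕ) (x : Fin N → Fin N → A) : gmul m x gone = x :=
  toMat_injective m (by rw [toMat_gmul, toMat_gone, mul_one])

lemma gmul_left_inv_eq_right_inv {m : ℕ} {x y z : Fin N → Fin N → A} (h : gmul m y x = gone)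
    (h' : gmul m x z = gone) : y = z := by
  rw [← gmul_gone m y, ← h', ← gmul_assoc, h, gone_gmul]

lemma gmul_gmul_inv {m : ℕ} {x y x' y' : Fin N → Fin N → A} (hx : gmul m x x' = gone)
    (hy : gmul m y y' = gone) : gmul m (gmul m x y) (gmul m y' x') = gone := by
  rw [gmul_assoc, ← gmul_assoc m y, hy, gone_gmul, hx]

variable {M : Model} {m n : ℕ} [Algebra ℂ A] [Algebra ℂ B]

/-- The train argument: `R x₁ x'₁ y₂ y'₂ = R x₁ y₂ x'₁ y'₂ = y₂ x₁ R x'₁ y'₂ = y₂ x₁ y'₂ x'₁ R = y₂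
y'₂ x₁ x'₁ R`. -/
lemma Intertwines.gmul {R : Mat₂ (m + n) (Series₂ ℂ)}
    {x y x' y' : Fin (m + n) → Fin (m + n) → LaurentSeries A}
    (h : Intertwines m n R x y) (h' : Intertwines m n R x' y')
    (c : CoeffSuperCommute m x' y) (c' : CoeffSuperCommute m x y') :
    Intertwines m n R (gmul m x x') (gmul m y y') := by
  have e1 := congrArg (toMat₂ m) c.inX_inY.inOne_inTwo
  have e2 := congrArg (toMat₂ m) c'.inX_inY.inOne_inTwo
  have e3 := congrArg (toMat₂ m) h
  have e4 := congrArg (toMat₂ m) h'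
  apply toMat₂_injective m
  rw [inX_gmul, inY_gmul, inOne_gmul, inTwo_gmul]
  simp only [toMat₂_gmul₂] at *
  generalize toMat₂ m (scalMat A R) = r at *
  simp only [mul_assoc] at *
  rw [← mul_assoc _ _ (toMat₂ m (inTwo fun i j => inY (y' i j))), e1]
  simp only [mul_assoc]
  rw [← mul_assoc (toMat₂ m (inOne fun i j => inX (x i j))), ← mul_assoc r, e3]
  simp only [mul_assoc]
  rw [e4, ← mul_assoc (toMat₂ m (inOne fun i j => inX (x i j))), e2]
  simp only [mul_assoc]

lemma Intertwines.map {R : Mat₂ (m + n) (Series₂ ℂ)}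
    {x y : Fin (m + n) → Fin (m + n) → LaurentSeries A}
    (h : Intertwines m n R x y) (φ : A →ₐ[ℂ] B) :
    Intertwines m n R (fun i j => coeffHom (φ : A →+* B) (x i j))
      (fun i j => coeffHom (φ : A →+* B) (y i j)) := by
  ext1 i; ext1 j; ext1 k; ext1 l
  have := congrArg (coeffHom (coeffHom (φ : A →+* B)))
    (congrFun (congrFun (congrFun (congrFun h i) j) k) l)
  rwa [map_rttL, map_rttR] at this

omit [Algebra ℂ A] [Algebra ℂ B] in
lemma gmul_eq_gone_map {x y : Fin N → Fin N → LaurentSeries A} (h : gmul m x y = gone)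
    (φ : A →+* B) :
    gmul m (fun i j => coeffHom φ (x i j)) (fun i j => coeffHom φ (y i j)) = gone := by
  ext1 i; ext1 j
  rw [← map_gmul, h, ← map_gone (coeffHom φ)]

namespace IsMonodromy

variable {T₁ T₂ : Side → Fin (m + n) → Fin (m + n) → LaurentSeries A}
  {T₁' T₂' : Fin (m + n) → Fin (m + n) → LaurentSeries A}

lemma map (h : IsMonodromy M m n T₁ T₁') (φ : A →ₐ[ℂ] B) :
    IsMonodromy M m n (fun ε i j => coeffHom (φ : A →+* B) (T₁ ε i j))
      (fun i j => coeffHom (φ : A →+* B) (T₁' i j)) where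
  mode ε i j := (h.mode ε i j).coeffHom _
  mode' i j := (h.mode' i j).coeffHom _
  rtt ε ε' hε := (h.rtt ε ε' hε).map φ
  inv_right := gmul_eq_gone_map h.inv_right _
  inv_left := gmul_eq_gone_map h.inv_left _
  init x y hxy := by
    have e : FreeAlgebra.lift ℂ (genVal M m n (fun ε i j => coeffHom (φ : A →+* B) (T₁ ε i j))
        (fun i j => coeffHom (φ : A →+* B) (T₁' i j))) =
        φ.comp (FreeAlgebra.lift ℂ (genVal M m n T₁ T₁')) := by
      ext g
      cases g <;> simp [genVal]
    rw [e, AlgHom.comp_apply, AlgHom.comp_apply, h.init x y hxy]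

lemma minus_eq_plus {ħ : ℂ} (h : IsMonodromy (.yangian ħ) m n T₁ T₁') :
    T₁ .minus = T₁ .plus := by
  ext1 i; ext1 j
  rw [(h.mode .minus i j).eq_modeSeries (Model.step_pos _),
    (h.mode .plus i j).eq_modeSeries (Model.step_pos _)]
  congr 1
  funext r
  simpa [genVal] using h.init _ _ (.same ħ i j r)

lemma coeff_zero_yangian {ħ : ℂ} (h : IsMonodromy (.yangian ħ) m n T₁ T₁') :
    (fun i j => (T₁ .plus i j).coeff 0) = gone := by
  ext1 i; ext1 j
  have := h.init _ _ (.unit ħ i j)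
  rw [FreeAlgebra.lift_ι_apply] at this
  have e := congrFun (congrFun (map_gone (N := m + n)
    (FreeAlgebra.lift ℂ (genVal (.yangian ħ) m n T₁ T₁') : FreeMono (m + n) →+* A)) i) j
  simpa [genVal] using this.trans e

lemma coeff_zero_lower {s : ℂˣ} (h : IsMonodromy (.quantum s) m n T₁ T₁') {i j : Fin (m + n)}
    (hij : i < j) : (T₁ .plus i j).coeff 0 = 0 := by
  simpa [genVal] using h.init _ _ (.lower s i j hij)

lemma coeff_zero_upper {s : ℂˣ} (h : IsMonodromy (.quantum s) m n T₁ T₁') {i j : Fin (m + n)}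
    (hij : j < i) : (T₁ .minus i j).coeff 0 = 0 := by
  simpa [genVal] using h.init _ _ (.upper s i j hij)

lemma coeff_zero_diag {s : ℂˣ} (h : IsMonodromy (.quantum s) m n T₁ T₁') (i : Fin (m + n)) :
    (T₁ .plus i i).coeff 0 * (T₁ .minus i i).coeff 0 = 1 := by
  simpa [genVal] using h.init _ _ (.diag s i)

lemma coeff_zero_diag' {s : ℂˣ} (h : IsMonodromy (.quantum s) m n T₁ T₁') (i : Fin (m + n)) :
    (T₁ .minus i i).coeff 0 * (T₁ .plus i i).coeff 0 = 1 := by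
  simpa [genVal] using h.init _ _ (.diag' s i)

/-- The product of two supercommuting monodromy matrices is a monodromy matrix. -/
lemma gmul (h₁ : IsMonodromy M m n T₁ T₁') (h₂ : IsMonodromy M m n T₂ T₂')
    (c : ∀ ε ε', CoeffSuperCommute m (T₁ ε) (T₂ ε')) :
    IsMonodromy M m n (fun ε => gmul m (T₁ ε) (T₂ ε)) (OpenChain.gmul m T₂' T₁') where
  mode ε := IsMode.gmul (h₁.mode ε) (h₂.mode ε)
  mode' := IsMode.gmul h₂.mode' h₁.mode'
  rtt ε ε' hε := (h₁.rtt ε ε' hε).gmul (h₂.rtt ε ε' hε) (c ε' ε).symm (c ε ε')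
  inv_right := gmul_gmul_inv h₁.inv_right h₂.inv_right
  inv_left := gmul_gmul_inv h₂.inv_left h₁.inv_left
  init x y hxy := by
    -- For triangular zero modes only the diagonal term contributes to a diagonal entry of the
    -- product.
    have key : ∀ ε i, (∀ a, a ≠ i → (T₁ ε i a).coeff 0 * (T₂ ε a i).coeff 0 = 0) →
        (OpenChain.gmul m (T₁ ε) (T₂ ε) i i).coeff 0 =
          (T₁ ε i i).coeff 0 * (T₂ ε i i).coeff 0 := by
      intro ε i hi
      rw [IsMode.coeff_gmul_zero (h₁.mode ε) (h₂.mode ε), OpenChain.gmul,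
        Finset.sum_eq_single i]
      · rw [neg_one_pow_congr (f := 0), pow_zero, one_mul]
        rw [← two_mul, mul_assoc, Nat.mul_mod_right]
      · intro a _ ha; rw [hi a ha, mul_zero]
      · simp
    -- Diagonal entries are even, so here supercommuting means commuting.
    have hcomm : ∀ ε ε' i, (T₂ ε i i).coeff 0 * (T₁ ε' i i).coeff 0 =
        (T₁ ε' i i).coeff 0 * (T₂ ε i i).coeff 0 := by
      intro ε ε' i
      have := (c ε' ε).symm 0 0 i i i i
      simp only at this
      rw [this, neg_one_pow_congr (f := 0), pow_zero, one_mul]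
      rw [← two_mul, mul_assoc, Nat.mul_mod_right]
    cases hxy with
    | same ħ i j r => simp [genVal, h₁.minus_eq_plus, h₂.minus_eq_plus]
    | unit ħ i j =>
      have e := congrFun (congrFun (map_gone (N := m + n) (FreeAlgebra.lift ℂ
        (genVal (.yangian ħ) m n (fun ε => OpenChain.gmul m (T₁ ε) (T₂ ε))
          (OpenChain.gmul m T₂' T₁')) : FreeMono (m + n) →+* A)) i) j
      refine Eq.trans ?_ e.symm
      simp only [FreeAlgebra.lift_ι_apply, genVal, Nat.cast_zero, mul_zero]
      rw [IsMode.coeff_gmul_zero (h₁.mode _) (h₂.mode _), h₁.coeff_zero_yangian,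
        h₂.coeff_zero_yangian, gmul_gone]
    | lower s i j hij =>
      simp only [FreeAlgebra.lift_ι_apply, genVal, Nat.cast_zero, mul_zero, map_zero]
      rw [IsMode.coeff_gmul_zero (h₁.mode _) (h₂.mode _)]
      refine Finset.sum_eq_zero fun a _ => ?_
      rcases lt_or_ge i a with h | h
      · simp [h₁.coeff_zero_lower h]
      · simp [h₂.coeff_zero_lower (lt_of_le_of_lt h hij)]
    | upper s i j hij =>
      simp only [FreeAlgebra.lift_ι_apply, genVal, Nat.cast_zero, mul_zero, map_zero]
      rw [IsMode.coeff_gmul_zero (h₁.mode _) (h₂.mode _)]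
      refine Finset.sum_eq_zero fun a _ => ?_
      rcases lt_or_ge a i with h | h
      · simp [h₁.coeff_zero_upper h]
      · simp [h₂.coeff_zero_upper (lt_of_lt_of_le hij h)]
    | diag s i =>
      simp only [FreeAlgebra.lift_ι_apply, genVal, Nat.cast_zero, mul_zero, map_mul, map_one]
      rw [key .plus i, key .minus i, mul_assoc, ← mul_assoc ((T₂ .plus i i).coeff 0), hcomm,
        mul_assoc, h₂.coeff_zero_diag, mul_one, h₁.coeff_zero_diag]
      · intro a ha
        rcases lt_or_gt_of_ne ha with h | h
        · rw [h₁.coeff_zero_upper h, zero_mul]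
        · rw [h₂.coeff_zero_upper h, mul_zero]
      · intro a ha
        rcases lt_or_gt_of_ne ha with h | h
        · rw [h₂.coeff_zero_lower h, mul_zero]
        · rw [h₁.coeff_zero_lower h, zero_mul]
    | diag' s i =>
      simp only [FreeAlgebra.lift_ι_apply, genVal, Nat.cast_zero, mul_zero, map_mul, map_one]
      rw [key .plus i, key .minus i, mul_assoc, ← mul_assoc ((T₂ .minus i i).coeff 0), hcomm,
        mul_assoc, h₂.coeff_zero_diag', mul_one, h₁.coeff_zero_diag']
      · intro a ha
        rcases lt_or_gt_of_ne ha with h | h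
        · rw [h₁.coeff_zero_upper h, zero_mul]
        · rw [h₂.coeff_zero_upper h, mul_zero]
      · intro a ha
        rcases lt_or_gt_of_ne ha with h | h
        · rw [h₂.coeff_zero_lower h, mul_zero]
        · rw [h₁.coeff_zero_lower h, zero_mul]

end IsMonodromy

/-! ### The graded tensor product -/

lemma mem_eigenGrading_of_sign {σ : A →ₐ[ℂ] A} {e : ℕ} {a : A} (h : σ a = (-1) ^ e * a) :
    a ∈ eigenGrading σ (e : ZMod 2) := by
  rw [mem_eigenGrading, h, ZMod.val_natCast, ← neg_one_pow_eq_pow_mod_two]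
  rcases Nat.even_or_odd e with he | he <;> simp [he.neg_one_pow]

section Tensor

variable (σ : A →ₐ[ℂ] A) (τ : B →ₐ[ℂ] B) [GradedAlgebra (eigenGrading σ)]
  [GradedAlgebra (eigenGrading τ)]

/-- The source of all supercommutation between the two tensor factors, with parities given by
natural exponents to match the matrix signs. -/
lemma includeRight_mul_includeLeft {a : A} {b : B} {e f : ℕ} (ha : σ a = (-1) ^ e * a)
    (hb : τ b = (-1) ^ f * b) :
    GradedTensorProduct.includeRight (R := ℂ) (eigenGrading σ) (eigenGrading τ) b *
      GradedTensorProduct.includeLeft (R := ℂ) (eigenGrading σ) (eigenGrading τ) a =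
    (-1) ^ (f * e) *
      (GradedTensorProduct.includeLeft (R := ℂ) (eigenGrading σ) (eigenGrading τ) a *
        GradedTensorProduct.includeRight (R := ℂ) (eigenGrading σ) (eigenGrading τ) b) := by
  have h := GradedTensorProduct.tmul_coe_mul_coe_tmul (R := ℂ) (eigenGrading σ) (eigenGrading τ)
    1 ⟨b, mem_eigenGrading_of_sign hb⟩ ⟨a, mem_eigenGrading_of_sign ha⟩ 1
  have h' := GradedTensorProduct.tmul_one_mul_one_tmul (R := ℂ) (eigenGrading σ)
    (eigenGrading τ) a b
  simp only [one_mul, mul_one] at h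
  rw [GradedTensorProduct.includeRight_apply, GradedTensorProduct.includeLeft_apply, h', h,
    ← Nat.cast_mul, uzpow_natCast]
  rcases Nat.even_or_odd (f * e) with he | he <;> simp [he.neg_one_pow]

end Tensor

end Coproduct
end OpenChain
end

open scoped TensorProduct LaurentSeries
noncomputable section
namespace OpenChain

/-! ### Transformations of the spectral parameters -/

section Transformations

/-- The pairs `(F(X,Y), F(Y,X))`. -/
def swapSubring (A : Type) [Ring A] : Subring (Series₂ A × Series₂ A) where
  carrier := {p | Swap p.1 p.2}
  zero_mem' := Swap.zero
  one_mem' := Swap.one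
  add_mem' := Swap.add
  neg_mem' := Swap.neg
  mul_mem' := Swap.mul

/-- The pairs `(F(X,Y), F(x,x))`. -/
def diagSubring (A : Type) [Ring A] : Subring (Series₂ A × LaurentSeries A) where
  carrier := {p | Diag p.1 p.2}
  zero_mem' := Diag.zero
  one_mem' := Diag.one
  add_mem' := Diag.add
  neg_mem' := Diag.neg
  mul_mem' := Diag.mul

section Subrings

variable {A B : Type} [Ring A] [Ring B] (H : Subring (A × B))

/-- Exchange and restriction to the diagonal are partially defined, but their graphs are subrings.
Membership of pairs in a subring passes through sums and products, hence through graded matrix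
products. -/
lemma gmul₂_mem {m N : ℕ} {x y : Mat₂ N A} {x' y' : Mat₂ N B}
    (hx : ∀ i j k l, (x i j k l, x' i j k l) ∈ H) (hy : ∀ i j k l, (y i j k l, y' i j k l) ∈ H)
    (i j k l : Fin N) : (gmul₂ m x y i j k l, gmul₂ m x' y' i j k l) ∈ H := by
  have e : (gmul₂ m x y i j k l, gmul₂ m x' y' i j k l) =
      ∑ a, ∑ b, (-1) ^ ((deg m k + deg m b) * (deg m a + deg m j) +
        (deg m i + deg m a + deg m k + deg m b) * (deg m a + deg m j + deg m b + deg m l)) *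
        ((x i a k b, x' i a k b) * (y a j b l, y' a j b l)) := by
    ext
    · simp [gmul₂, Prod.fst_sum]
    · simp [gmul₂, Prod.snd_sum]
  rw [e]
  exact sum_mem fun a _ => sum_mem fun b _ => mul_mem (pow_mem (neg_mem (one_mem H)) _)
    (mul_mem (hx _ _ _ _) (hy _ _ _ _))

lemma inOne_mem {N : ℕ} {x : Fin N → Fin N → A} {x' : Fin N → Fin N → B}
    (hx : ∀ i j, (x i j, x' i j) ∈ H) (i j k l : Fin N) :
    (inOne x i j k l, inOne x' i j k l) ∈ H := by
  simp only [inOne]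
  split_ifs
  · exact hx i j
  · exact zero_mem H

lemma inTwo_mem {N : ℕ} {x : Fin N → Fin N → A} {x' : Fin N → Fin N → B}
    (hx : ∀ i j, (x i j, x' i j) ∈ H) (i j k l : Fin N) :
    (inTwo x i j k l, inTwo x' i j k l) ∈ H := by
  simp only [inTwo]
  split_ifs
  · exact hx k l
  · exact zero_mem H

end Subrings

section RMatrix

lemma Model.b_mem {S S' : Type} [Field S] [Field S'] (H : Subring (S × S')) {u v : S} {u' v' : S'}
    (hu : (u, u') ∈ H) (hui : (u⁻¹, u'⁻¹) ∈ H) (hv : (v, v') ∈ H) (hvi : (v⁻¹, v'⁻¹) ∈ H)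
    (M : Model) : (M.b u v, M.b u' v') ∈ H := by
  cases M with
  | yangian ħ => exact sub_mem hu hv
  | quantum s =>
    simp only [Model.b, div_eq_mul_inv]
    exact sub_mem (mul_mem hu hvi) (mul_mem hv hui)

variable {S S' : Type} [Field S] [Algebra ℂ S] [Field S'] [Algebra ℂ S'] (H : Subring (S × S'))
  (hc : ∀ c : ℂ, (algebraMap ℂ S c, algebraMap ℂ S' c) ∈ H) {u v : S} {u' v' : S'}
  (hu : (u, u') ∈ H) (hui : (u⁻¹, u'⁻¹) ∈ H) (hv : (v, v') ∈ H) (hvi : (v⁻¹, v'⁻¹) ∈ H)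

include hc hu hui hv hvi

lemma Model.a_mem (m : ℕ) (M : Model) (i : ℕ) : (M.a m i u v, M.a m i u' v') ∈ H := by
  cases M with
  | yangian ħ =>
    exact sub_mem (sub_mem hu hv) (mul_mem (pow_mem (neg_mem (one_mem H)) _) (hc ħ))
  | quantum s =>
    simp only [Model.a, div_eq_mul_inv]
    exact sub_mem (mul_mem (mul_mem hu hvi) (hc _)) (mul_mem (mul_mem hv hui) (hc _))

lemma Model.c_mem (m : ℕ) (M : Model) (i j : ℕ) : (M.c m i j u v, M.c m i j u' v') ∈ H := by
  cases M with
  | yangian ħ => exact neg_mem (mul_mem (pow_mem (neg_mem (one_mem H)) _) (hc ħ))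
  | quantum s =>
    simp only [Model.c, div_eq_mul_inv]
    refine mul_mem (s := H) (a := (_, _)) (b := (_, _)) (mul_mem (s := H) (a := (_, _))
      (b := (_, _)) (pow_mem (neg_mem (one_mem H)) _) (sub_mem (hc _) (hc _))) ?_
    rcases lt_trichotomy ((j : ℤ) - i) 0 with h | h | h
    · rw [Int.sign_eq_neg_one_of_neg h]
      simp only [zpow_neg_one, mul_inv, inv_inv]
      exact mul_mem hui hv
    · rw [h, Int.sign_zero, zpow_zero, zpow_zero]; exact one_mem H
    · rw [Int.sign_eq_one_of_pos h, zpow_one, zpow_one]; exact mul_mem hu hvi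

lemma Model.w_mem (m : ℕ) (M : Model) (i j : ℕ) : (M.w m i j u v, M.w m i j u' v') ∈ H := by
  simp only [Model.w]
  split_ifs
  · exact sub_mem (Model.a_mem H hc hu hui hv hvi m M i) (Model.b_mem H hu hui hv hvi M)
  · exact Model.c_mem H hc hu hui hv hvi m M i j

/-- The entries of `R` are Laurent polynomials in `u` and `v` with constant coefficients, so a
subring of pairs only has to contain the pairs of constants, of `u^{±1}` and of `v^{±1}`. -/
lemma R₁₂_mem (M : Model) (m n : ℕ) (i j k l : Fin (m + n)) :
    (R₁₂ M m n u v i j k l, R₁₂ M m n u' v' i j k l) ∈ H := by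
  simp only [R₁₂, ← Prod.mk_add_mk]
  refine add_mem ?_ ?_
  · split_ifs
    · exact Model.b_mem H hu hui hv hvi M
    · exact zero_mem H
  · split_ifs
    · exact Model.w_mem H hc hu hui hv hvi m M _ _
    · exact zero_mem H

end RMatrix

lemma R₁₂_map {S S' : Type} [Field S] [Algebra ℂ S] [Field S'] [Algebra ℂ S'] (φ : S →+* S')
    (hφ : ∀ c : ℂ, φ (algebraMap ℂ S c) = algebraMap ℂ S' c) (M : Model) (m n : ℕ) (u v : S)
    (i j k l : Fin (m + n)) :
    φ (R₁₂ M m n u v i j k l) = R₁₂ M m n (φ u) (φ v) i j k l := by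
  -- The subring used is the graph of `φ`.
  have h := R₁₂_mem ((RingHom.id S).prod φ).range (fun c => ⟨algebraMap ℂ S c, by simp [hφ]⟩)
    (u := u) (v := v) (u' := φ u) (v' := φ v) ⟨u, by simp⟩ ⟨u⁻¹, by simp⟩ ⟨v, by simp⟩
    ⟨v⁻¹, by simp⟩ M m n i j k l
  obtain ⟨x, hx⟩ := h
  simp only [RingHom.prod_apply, RingHom.id_apply, Prod.mk.injEq] at hx
  rw [← hx.2, hx.1]

lemma varX_eq : varX = inX (HahnSeries.single 1 1 : LaurentSeries ℂ) := by
  ext r s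
  rw [inX_coeff_coeff, varX]
  simp only [HahnSeries.coeff_single]
  split_ifs <;> simp_all [HahnSeries.coeff_one]

lemma inX_inv (f : LaurentSeries ℂ) : inX f⁻¹ = (inX f)⁻¹ :=
  map_inv₀ (coeffHom (HahnSeries.C : ℂ →+* LaurentSeries ℂ)) f

lemma inY_inv (f : LaurentSeries ℂ) : inY f⁻¹ = (inY f)⁻¹ :=
  map_inv₀ (HahnSeries.C : LaurentSeries ℂ →+* Series₂ ℂ) f

lemma varY_eq : varY = inY (HahnSeries.single 1 1 : LaurentSeries ℂ) := rfl

lemma algebraMap_mem_swapSubring (c : ℂ) :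
    (algebraMap ℂ (Series₂ ℂ) c, algebraMap ℂ (Series₂ ℂ) c) ∈ swapSubring ℂ := by
  intro r s
  rw [algebraMap_series₂]
  simp only [HahnSeries.C_apply, HahnSeries.coeff_single]
  split_ifs <;> simp_all

lemma algebraMap_mem_diagSubring (c : ℂ) :
    (algebraMap ℂ (Series₂ ℂ) c, algebraMap ℂ (LaurentSeries ℂ) c) ∈ diagSubring ℂ := by
  rw [algebraMap_series₂, algebraMap_laurent]
  exact Diag.inY (HahnSeries.C c)

lemma R₁₂_swap (M : Model) (m n : ℕ) (f g : LaurentSeries ℂ) (i j k l : Fin (m + n)) :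
    Swap (R₁₂ M m n (inX f) (inY g) i j k l) (R₁₂ M m n (inY f) (inX g) i j k l) := by
  have hf : ((inX f)⁻¹, (inY f)⁻¹) ∈ swapSubring ℂ := by
    rw [← inX_inv, ← inY_inv]; exact Swap.inX f⁻¹
  have hg : ((inY g)⁻¹, (inX g)⁻¹) ∈ swapSubring ℂ := by
    rw [← inX_inv, ← inY_inv]; exact Swap.inY g⁻¹
  have h := @R₁₂_mem (Series₂ ℂ) (Series₂ ℂ) _ _ _ _ (swapSubring ℂ)
  exact h algebraMap_mem_swapSubring (Swap.inX f) hf (Swap.inY g) hg M m n i j k l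

lemma R₁₂_diag (M : Model) (m n : ℕ) (f g : LaurentSeries ℂ) (i j k l : Fin (m + n)) :
    Diag (R₁₂ M m n (inX f) (inY g) i j k l) (R₁₂ M m n f g i j k l) := by
  have hf : ((inX f)⁻¹, f⁻¹) ∈ diagSubring ℂ := by
    rw [← inX_inv]; exact Diag.inX f⁻¹
  have hg : ((inY g)⁻¹, g⁻¹) ∈ diagSubring ℂ := by
    rw [← inY_inv]; exact Diag.inY g⁻¹
  have h := @R₁₂_mem (Series₂ ℂ) (LaurentSeries ℂ) _ _ _ _ (diagSubring ℂ)
  exact h algebraMap_mem_diagSubring (Diag.inX f) hf (Diag.inY g) hg M m n i j k l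

variable {A : Type} [Ring A] [Algebra ℂ A] {m n : ℕ}

/-- Substitution in the second variable. -/
def substY (A : Type) [Ring A] [Algebra ℂ A] {y : LaurentSeries ℂ} (hy : y.order = 1) :
    Series₂ A →+* Series₂ A := coeffHom (substHom A hy)

lemma subst_C {y : LaurentSeries ℂ} (hy : y.order = 1) (a : A) :
    subst (HahnSeries.C a : LaurentSeries A) y = HahnSeries.C a := by
  have h : ∀ n : ℤ, n ≠ 0 → (HahnSeries.C a : LaurentSeries A).coeff n = 0 := fun n hn => by
    rw [HahnSeries.C_apply, HahnSeries.coeff_single_of_ne hn]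
  ext r
  rw [subst_coeff_eq_sum hy (a := 0) (fun n hn => h n hn.ne) r
    (Finset.subset_insert 0 _), Finset.sum_eq_single 0]
  · simp only [HahnSeries.C_apply, HahnSeries.coeff_single, zpow_zero, HahnSeries.coeff_one]
    split_ifs <;> simp
  · intro n _ hn; rw [h n hn, smul_zero]
  · simp

lemma substY_inX {y : LaurentSeries ℂ} (hy : y.order = 1) (f : LaurentSeries A) :
    substY A hy (inX f) = inX f := by
  apply HahnSeries.ext
  funext r
  exact subst_C hy (f.coeff r)

lemma substY_inY {y : LaurentSeries ℂ} (hy : y.order = 1) (f : LaurentSeries A) :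
    substY A hy (inY f) = inY (subst f y) := by
  apply HahnSeries.ext
  funext r
  rw [substY, coeffHom_coeff, inY, inY, HahnSeries.C_apply, HahnSeries.C_apply,
    HahnSeries.coeff_single, HahnSeries.coeff_single]
  split_ifs
  · rfl
  · simp

lemma substY_scal₂ {y : LaurentSeries ℂ} (hy : y.order = 1) (f : Series₂ ℂ) :
    substY A hy (scal₂ A f) = scal₂ A (substY ℂ hy f) := by
  apply HahnSeries.ext
  funext r
  exact subst_scal hy (f.coeff r)

lemma substY_algebraMap {y : LaurentSeries ℂ} (hy : y.order = 1) (c : ℂ) :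
    substY ℂ hy (algebraMap ℂ (Series₂ ℂ) c) = algebraMap ℂ (Series₂ ℂ) c := by
  rw [algebraMap_series₂]
  exact (substY_inY hy (HahnSeries.C c)).trans (by rw [subst_C hy]; rfl)

lemma Intertwines.substY {M : Model} {f g : LaurentSeries ℂ}
    {x y : Fin (m + n) → Fin (m + n) → LaurentSeries A}
    (h : Intertwines m n (R₁₂ M m n (inX f) (inY g)) x y) {z : LaurentSeries ℂ}
    (hz : z.order = 1) :
    Intertwines m n (R₁₂ M m n (inX f) (inY (subst g z))) x fun i j => subst (y i j) z := by
  have hR : (fun i j k l => OpenChain.substY A hz (scalMat A (R₁₂ M m n (inX f) (inY g)) i j k l))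
      = scalMat A (R₁₂ M m n (inX f) (inY (subst g z))) := by
    ext1 i; ext1 j; ext1 k; ext1 l
    simp only [scalMat]
    rw [substY_scal₂]
    congr 1
    have h := R₁₂_map (S := Series₂ ℂ) (S' := Series₂ ℂ) (OpenChain.substY ℂ hz)
      (substY_algebraMap hz) M m n (inX f) (inY g) i j k l
    rw [substY_inX, substY_inY] at h
    exact h
  ext1 i; ext1 j; ext1 k; ext1 l
  have := congrArg (OpenChain.substY A hz) (congrFun (congrFun (congrFun (congrFun h i) j) k) l)
  simpa only [map_gmul₂, hR, map_inOne, map_inTwo, substY_inX, substY_inY] using this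

/-- The relation obtained by exchanging both the matrix factors and the spectral parameters. -/
def FlipIntertwines (m n : ℕ) (R : Mat₂ (m + n) (Series₂ ℂ))
    (x y : Fin (m + n) → Fin (m + n) → LaurentSeries A) : Prop :=
  gmul₂ m (gmul₂ m (scalMat A R) (inTwo fun i j => inY (x i j))) (inOne fun i j => inX (y i j)) =
    gmul₂ m (gmul₂ m (inOne fun i j => inX (y i j)) (inTwo fun i j => inY (x i j))) (scalMat A R)

/-- Exchanging `X` and `Y` gives the relation with `x` in the inner variable but in the first matrix
factor; the graded flip then puts `x` in the second factor and replaces `R₁₂` by `R₂₁`. -/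
lemma Intertwines.flip {M : Model} {f g : LaurentSeries ℂ}
    {x y : Fin (m + n) → Fin (m + n) → LaurentSeries A}
    (h : Intertwines m n (R₁₂ M m n (inX f) (inY g)) x y) :
    FlipIntertwines m n (R₂₁ M m n (inY f) (inX g)) x y := by
  have hR : ∀ i j k l, (scalMat A (R₁₂ M m n (inX f) (inY g)) i j k l,
      scalMat A (R₁₂ M m n (inY f) (inX g)) i j k l) ∈ swapSubring A := fun i j k l =>
    (R₁₂_swap M m n f g i j k l).scal₂
  have hx := inOne_mem (swapSubring A) fun i j => Swap.inX (x i j)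
  have hy := inTwo_mem (swapSubring A) fun i j => Swap.inY (y i j)
  have key : gmul₂ m (gmul₂ m (scalMat A (R₁₂ M m n (inY f) (inX g)))
        (inOne fun i j => inY (x i j))) (inTwo fun i j => inX (y i j)) =
      gmul₂ m (gmul₂ m (inTwo fun i j => inX (y i j)) (inOne fun i j => inY (x i j)))
        (scalMat A (R₁₂ M m n (inY f) (inX g))) := by
    ext1 i; ext1 j; ext1 k; ext1 l
    have e1 : Swap _ _ := gmul₂_mem (m := m) _ (gmul₂_mem (m := m) _ hR hx) hy i j k l
    have e2 : Swap _ _ := gmul₂_mem (m := m) _ (gmul₂_mem (m := m) _ hy hx) hR i j k l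
    have h' := congrFun (congrFun (congrFun (congrFun h i) j) k) l
    exact Swap.unique (F := gmul₂ m (gmul₂ m (inTwo fun i j => inY (y i j))
      (inOne fun i j => inX (x i j))) (scalMat A (R₁₂ M m n (inX f) (inY g))) i j k l)
      (by rw [← h']; exact e1) e2
  have := congrArg (gflip m) key
  simpa only [gflip_gmul₂, gflip_scalMat, gflip_R₁₂, gflip_inOne, gflip_inTwo,
    FlipIntertwines] using this

end Transformations
end OpenChain
end

open scoped TensorProduct LaurentSeries
noncomputable section
namespace OpenChain

/-! ### Dressing of solutions of the reflection equation -/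

section Dressing

namespace Model

/-- `(ι(u))⁻¹` is this constant times the parameter `loc u`. -/
def sgn : Model → ℂ
  | yangian _ => -1
  | quantum _ => 1

lemma sgn_ne_zero (M : Model) : M.sgn ≠ 0 := by cases M <;> simp [sgn]

lemma loc_loc {S : Type} [Field S] (M : Model) (u : S) : M.loc (M.loc u) = u := by
  cases M <;> simp [loc]

lemma inv_iota_loc_eq {S : Type} [Field S] [Algebra ℂ S] (M : Model) (x : S) :
    (M.iota (M.loc x))⁻¹ = algebraMap ℂ S M.sgn * x := by
  cases M <;> simp [iota, loc, sgn, inv_neg]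

lemma inv_iota_loc (M : Model) (x : LaurentSeries ℂ) :
    (M.iota (M.loc x))⁻¹ = HahnSeries.C M.sgn * x := by
  rw [inv_iota_loc_eq, algebraMap_laurent]

lemma loc_u₀ (M : Model) : M.loc M.u₀ = HahnSeries.single 1 1 := M.loc_loc _

lemma inv_iota_u₀ (M : Model) : (M.iota M.u₀)⁻¹ = HahnSeries.single 1 M.sgn := by
  rw [u₀, inv_iota_loc, HahnSeries.C_mul_eq_smul]
  ext r
  simp [HahnSeries.coeff_single]

lemma subst_inv_single (M : Model) :
    subst ((HahnSeries.single 1 1 : LaurentSeries ℂ)⁻¹) (HahnSeries.single 1 M.sgn) =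
      M.iota M.u₀ := by
  have h := order_single_one M.sgn_ne_zero
  rw [← substHom_apply h, map_inv₀, substHom_apply, subst_self_var h, ← inv_iota_u₀, inv_inv]

variable {S : Type} [Field S] (M : Model) (m : ℕ) (u v : S)

lemma b_iota_comm : M.b u (M.iota v) = M.b v (M.iota u) := by
  cases M
  · simp [b, iota, add_comm]
  · simp [b, iota, div_eq_mul_inv, mul_comm]

lemma b_iota_iota : M.b (M.iota v) (M.iota u) = M.b u v := by
  cases M
  · simp [b, iota]; ring
  · simp [b, iota, div_eq_mul_inv, mul_comm]

variable [Algebra ℂ S]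

lemma a_iota_comm (i : ℕ) : M.a m i u (M.iota v) = M.a m i v (M.iota u) := by
  cases M
  · simp [a, iota, add_comm]
  · simp [a, iota, div_eq_mul_inv, mul_comm]

lemma c_iota_comm (i j : ℕ) : M.c m i j u (M.iota v) = M.c m i j v (M.iota u) := by
  cases M
  · simp [c]
  · simp [c, iota, mul_comm]

lemma a_iota_iota (i : ℕ) : M.a m i (M.iota v) (M.iota u) = M.a m i u v := by
  cases M
  · simp [a, iota]; ring
  · simp [a, iota, div_eq_mul_inv, mul_comm]

lemma c_iota_iota (i j : ℕ) : M.c m i j (M.iota v) (M.iota u) = M.c m i j u v := by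
  cases M
  · simp [c]
  · simp [c, iota, div_eq_mul_inv, mul_comm]

end Model

section

variable {S : Type} [Field S] [Algebra ℂ S] (M : Model) (m n : ℕ) (u v : S)

/-- All structure functions depend only on `u - v` or `u / v`, and `ι` turns these into the
symmetric combinations `u + v` and `u v`. -/
lemma R₂₁_iota_comm : R₂₁ M m n u (M.iota v) = R₂₁ M m n v (M.iota u) := by
  ext i j k l
  simp only [R₂₁, Model.w, M.b_iota_comm u v, M.a_iota_comm m u v, M.c_iota_comm m u v]

lemma R₂₁_iota_iota : R₂₁ M m n (M.iota v) (M.iota u) = R₂₁ M m n u v := by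
  ext i j k l
  simp only [R₂₁, Model.w, M.b_iota_iota u v, M.a_iota_iota m u v, M.c_iota_iota m u v]

end

variable {A : Type} [Ring A] [Algebra ℂ A] {M : Model} {m n : ℕ}

lemma inX_loc (M : Model) (f : LaurentSeries ℂ) : M.loc (inX f) = inX (M.loc f) := by
  cases M <;> simp [Model.loc, inX_inv]

lemma inY_loc (M : Model) (f : LaurentSeries ℂ) : M.loc (inY f) = inY (M.loc f) := by
  cases M <;> simp [Model.loc, inY_inv]

lemma inY_iota (M : Model) (f : LaurentSeries ℂ) : M.iota (inY f) = inY (M.iota f) := by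
  cases M
  · exact (map_neg (HahnSeries.C : LaurentSeries ℂ →+* Series₂ ℂ) f).symm
  · simp [Model.iota, inY_inv]

lemma inX_iota (M : Model) (f : LaurentSeries ℂ) : M.iota (inX f) = inX (M.iota f) := by
  cases M
  · exact (map_neg (coeffHom (HahnSeries.C : ℂ →+* LaurentSeries ℂ)) f).symm
  · simp [Model.iota, inX_inv]

lemma loc_varX (M : Model) : M.loc varX = inX M.u₀ := by rw [varX_eq, inX_loc]; rfl
lemma loc_varY (M : Model) : M.loc varY = inY M.u₀ := by rw [varY_eq, inY_loc]; rfl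

lemma FlipIntertwines.substY {f g : LaurentSeries ℂ}
    {x y : Fin (m + n) → Fin (m + n) → LaurentSeries A}
    (h : FlipIntertwines m n (R₂₁ M m n (inY f) (inX g)) x y) {z : LaurentSeries ℂ}
    (hz : z.order = 1) :
    FlipIntertwines m n (R₂₁ M m n (inY (subst f z)) (inX g)) (fun i j => subst (x i j) z) y := by
  have hR : (fun i j k l => OpenChain.substY A hz (scalMat A (R₂₁ M m n (inY f) (inX g)) i j k l))
      = scalMat A (R₂₁ M m n (inY (subst f z)) (inX g)) := by
    rw [← gflip_R₁₂, ← gflip_R₁₂]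
    ext1 i; ext1 j; ext1 k; ext1 l
    simp only [scalMat]
    rw [substY_scal₂]
    congr 1
    have h := R₁₂_map (S := Series₂ ℂ) (S' := Series₂ ℂ) (OpenChain.substY ℂ hz)
      (substY_algebraMap hz) M m n (inY f) (inX g) k l i j
    rw [substY_inX, substY_inY] at h
    rw [gflip, gflip, map_mul, map_pow, map_neg, map_one, h]
  ext1 i; ext1 j; ext1 k; ext1 l
  have := congrArg (OpenChain.substY A hz) (congrFun (congrFun (congrFun (congrFun h i) j) k) l)
  simpa only [map_gmul₂, hR, map_inOne, map_inTwo, substY_inX, substY_inY] using this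

lemma CoeffSuperCommute.subst {N : ℕ} {x y : Fin N → Fin N → LaurentSeries A}
    (h : CoeffSuperCommute m x y) (z : LaurentSeries ℂ) :
    CoeffSuperCommute m x fun i j => subst (y i j) z := by
  intro r s i j k l
  simp only [subst_coeff, Finset.mul_sum, Finset.sum_mul]
  refine Finset.sum_congr rfl fun a _ => ?_
  rw [mul_smul_comm, h r a i j k l, smul_mul_assoc, mul_smul_comm]

/-- The algebra behind the dressing of a solution of the reflection equation. -/
lemma reflection_dressing {G : Type} [Monoid G]
    {R Q P S T₁ T₂ D₁ D₂ U₁ U₂ V₁ V₂ : G} (hD : R * D₁ * Q * D₂ = D₂ * P * D₁ * S)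
    (pp : R * T₁ * T₂ = T₂ * T₁ * R) (pm : P * T₁ * U₂ = U₂ * T₁ * P)
    (mp : Q * T₂ * U₁ = U₁ * T₂ * Q) (mm : S * U₂ * U₁ = U₁ * U₂ * S)
    (h₁ : U₁ * V₁ = 1) (h₁' : V₁ * U₁ = 1) (h₂ : U₂ * V₂ = 1) (h₂' : V₂ * U₂ = 1)
    (td : T₁ * D₂ = D₂ * T₁) (dt : D₁ * T₂ = T₂ * D₁)
    (dv : D₁ * V₂ = V₂ * D₁) (vd : V₁ * D₂ = D₂ * V₁) :
    R * (T₁ * D₁ * V₁) * Q * (T₂ * D₂ * V₂) = T₂ * D₂ * V₂ * P * (T₁ * D₁ * V₁) * S := by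
  -- Here `U` stands for `T⁻` at `ι` of the parameter and `V` for its inverse. Multiplying the
  -- exchange relations by `V` on both sides converts them into relations for the inverse matrices.
  have pm' : V₂ * P * T₁ = T₁ * P * V₂ := by
    calc V₂ * P * T₁ = V₂ * (P * T₁ * U₂) * V₂ := by simp only [mul_assoc, h₂, mul_one]
      _ = (V₂ * U₂) * T₁ * P * V₂ := by rw [pm]; simp only [mul_assoc]
      _ = T₁ * P * V₂ := by rw [h₂', one_mul]
  have mp' : V₁ * Q * T₂ = T₂ * Q * V₁ := by
    calc V₁ * Q * T₂ = V₁ * (Q * T₂ * U₁) * V₁ := by simp only [mul_assoc, h₁, mul_one]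
      _ = (V₁ * U₁) * T₂ * Q * V₁ := by rw [mp]; simp only [mul_assoc]
      _ = T₂ * Q * V₁ := by rw [h₁', one_mul]
  have mm' : V₂ * V₁ * S = S * V₁ * V₂ := by
    calc V₂ * V₁ * S = V₂ * V₁ * (S * (U₂ * ((U₁ * V₁) * V₂))) := by
          rw [h₁, one_mul, h₂, mul_one]
      _ = V₂ * V₁ * (S * U₂ * U₁) * V₁ * V₂ := by simp only [mul_assoc]
      _ = V₂ * ((V₁ * U₁) * U₂) * S * V₁ * V₂ := by rw [mm]; simp only [mul_assoc]
      _ = S * V₁ * V₂ := by rw [h₁', one_mul, h₂', one_mul]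
  -- The monodromy matrices are moved to the outside until `R D₁ Q D₂` appears as a block; after the
  -- reflection equation for `D` they are moved back in the opposite order.
  calc R * (T₁ * D₁ * V₁) * Q * (T₂ * D₂ * V₂)
      = R * T₁ * D₁ * (V₁ * Q * T₂) * D₂ * V₂ := by simp only [mul_assoc]
    _ = R * T₁ * (D₁ * T₂) * Q * (V₁ * D₂) * V₂ := by rw [mp']; simp only [mul_assoc]
    _ = (R * T₁ * T₂) * D₁ * Q * D₂ * V₁ * V₂ := by rw [dt, vd]; simp only [mul_assoc]
    _ = T₂ * T₁ * (R * D₁ * Q * D₂) * V₁ * V₂ := by rw [pp]; simp only [mul_assoc]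
    _ = T₂ * (T₁ * D₂) * P * D₁ * (S * V₁ * V₂) := by rw [hD]; simp only [mul_assoc]
    _ = T₂ * D₂ * T₁ * P * (D₁ * V₂) * V₁ * S := by rw [td, ← mm']; simp only [mul_assoc]
    _ = T₂ * D₂ * (T₁ * P * V₂) * D₁ * V₁ * S := by rw [dv]; simp only [mul_assoc]
    _ = T₂ * D₂ * V₂ * P * (T₁ * D₁ * V₁) * S := by rw [← pm']; simp only [mul_assoc]

namespace IsMonodromy

variable {T : Side → Fin (m + n) → Fin (m + n) → LaurentSeries A}
  {T' : Fin (m + n) → Fin (m + n) → LaurentSeries A}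

lemma plus_plus (h : IsMonodromy M m n T T') :
    Intertwines m n (R₁₂ M m n (M.loc varX) (M.loc varY)) (T .plus) (T .plus) :=
  h.rtt .plus .plus (by simp)

/-- The relation between `T(u)` and `T⁻` at `ι(v)`. -/
lemma plus_minus (h : IsMonodromy M m n T T') :
    Intertwines m n (R₁₂ M m n (inX M.u₀) (inY (M.iota M.u₀))) (T .plus)
      fun i j => subst (T .minus i j) (HahnSeries.single 1 M.sgn) := by
  have h1 := h.rtt .plus .minus (by simp)
  rw [specVar, specVar, loc_varX, varY_eq, ← inY_inv] at h1
  -- `T⁻` is expanded in the inverse of its argument; replacing that variable by `sgn · x` places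
  -- the argument at `ι(u)`.
  have h2 := h1.substY (order_single_one M.sgn_ne_zero)
  rwa [M.subst_inv_single] at h2

/-- The relation for the pair `(-,+)` is not among the defining ones; it comes from `(+,-)` by the
flip, using the symmetry of `R₂₁(u, ι(v))` in `u` and `v`. -/
lemma plus_minus_flip (h : IsMonodromy M m n T T') :
    FlipIntertwines m n (R₂₁ M m n (M.loc varX) (M.iota (M.loc varY))) (T .plus)
      fun i j => subst (T .minus i j) (HahnSeries.single 1 M.sgn) := by
  rw [R₂₁_iota_comm, loc_varX, loc_varY, inX_iota]
  exact h.plus_minus.flip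

lemma minus_minus_flip (h : IsMonodromy M m n T T') :
    FlipIntertwines m n (R₂₁ M m n (M.loc varX) (M.loc varY))
      (fun i j => subst (T .minus i j) (HahnSeries.single 1 M.sgn))
      fun i j => subst (T .minus i j) (HahnSeries.single 1 M.sgn) := by
  have h1 := h.rtt .minus .minus (by simp)
  rw [specVar, specVar, varX_eq, varY_eq, ← inY_inv, ← inX_inv] at h1
  -- Substitution acts on the inner variable, and the flip brings the other parameter there. The
  -- result has `R₂₁(ι(v), ι(u))`, which equals `R₂₁(u, v)`.
  have h2 := (h1.substY (order_single_one M.sgn_ne_zero)).flip.substY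
    (order_single_one M.sgn_ne_zero)
  rw [M.subst_inv_single] at h2
  rw [← R₂₁_iota_iota, loc_varX, loc_varY, inX_iota, inY_iota]
  exact h2

lemma subst_inv_right (h : IsMonodromy M m n T T') {z : LaurentSeries ℂ} (hz : z.order = 1) :
    OpenChain.gmul m (fun i j => subst (T .minus i j) z) (fun i j => subst (T' i j) z) = gone := by
  ext1 i; ext1 j
  have := map_gmul m (substHom A hz) (T .minus) T' i j
  rw [h.inv_right] at this
  exact this.symm.trans (congrFun (congrFun (map_gone (substHom A hz)) i) j)

lemma subst_inv_left (h : IsMonodromy M m n T T') {z : LaurentSeries ℂ} (hz : z.order = 1) :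
    OpenChain.gmul m (fun i j => subst (T' i j) z) (fun i j => subst (T .minus i j) z) = gone := by
  ext1 i; ext1 j
  have := map_gmul m (substHom A hz) T' (T .minus) i j
  rw [h.inv_left] at this
  exact this.symm.trans (congrFun (congrFun (map_gone (substHom A hz)) i) j)

/-- If `D` solves the reflection equation and supercommutes with the monodromy matrices, then
`T(u) D(u) T⁻¹(ι(u))` solves the reflection equation. -/
lemma dress (h : IsMonodromy M m n T T') {D : Fin (m + n) → Fin (m + n) → LaurentSeries A}
    (hD : reflL M m n D = reflR M m n D) (c : CoeffSuperCommute m D (T .plus))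
    (c' : CoeffSuperCommute m D T') :
    reflL M m n (OpenChain.gmul m (OpenChain.gmul m (T .plus) D)
        fun i j => subst (T' i j) (HahnSeries.single 1 M.sgn)) =
      reflR M m n (OpenChain.gmul m (OpenChain.gmul m (T .plus) D)
        fun i j => subst (T' i j) (HahnSeries.single 1 M.sgn)) := by
  have hz := order_single_one M.sgn_ne_zero
  have d' := c'.subst (HahnSeries.single 1 M.sgn)
  have pm := h.plus_minus
  rw [← inY_iota, ← loc_varX, ← loc_varY] at pm
  have inv₁ : ∀ {x y : Fin (m + n) → Fin (m + n) → LaurentSeries A}, OpenChain.gmul m x y = gone →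
      toMat₂ m (inOne fun i j => inX (x i j)) * toMat₂ m (inOne fun i j => inX (y i j)) = 1 := by
    intro x y hxy
    rw [← toMat₂_gmul₂, ← inOne_gmul, ← inX_gmul, hxy, ← toMat₂_gone₂, ← inOne_gone]
    congr 2
    exact map_gone (coeffHom (HahnSeries.C : A →+* LaurentSeries A))
  have inv₂ : ∀ {x y : Fin (m + n) → Fin (m + n) → LaurentSeries A}, OpenChain.gmul m x y = gone →
      toMat₂ m (inTwo fun i j => inY (x i j)) * toMat₂ m (inTwo fun i j => inY (y i j)) = 1 := by
    intro x y hxy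
    rw [← toMat₂_gmul₂, ← inTwo_gmul, ← inY_gmul, hxy, ← toMat₂_gone₂, ← inTwo_gone]
    congr 2
    exact map_gone (HahnSeries.C : LaurentSeries A →+* Series₂ A)
  apply toMat₂_injective m
  have e0 := congrArg (toMat₂ m) hD
  have e1 := congrArg (toMat₂ m) h.plus_plus
  have e2 := congrArg (toMat₂ m) pm
  have e3 := congrArg (toMat₂ m) h.plus_minus_flip
  have e4 := congrArg (toMat₂ m) h.minus_minus_flip
  have e5 := congrArg (toMat₂ m) c.inX_inY.inOne_inTwo
  have e6 := congrArg (toMat₂ m) c.symm.inX_inY.inOne_inTwo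
  have e7 := congrArg (toMat₂ m) d'.inX_inY.inOne_inTwo
  have e8 := congrArg (toMat₂ m) d'.symm.inX_inY.inOne_inTwo
  simp only [reflL, reflR, inX_gmul, inY_gmul, inOne_gmul, inTwo_gmul, toMat₂_gmul₂] at *
  exact reflection_dressing e0 e1 e2 e3 e4 (inv₁ (h.subst_inv_right hz))
    (inv₁ (h.subst_inv_left hz)) (inv₂ (h.subst_inv_right hz)) (inv₂ (h.subst_inv_left hz))
    e6 e5 e7 e8

lemma dress_pole (h : IsMonodromy M m n T T') {p : ℕ}
    {D : Fin (m + n) → Fin (m + n) → LaurentSeries A}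
    (hD : ∀ i j, ∀ r : ℤ, r < -(p : ℤ) → (D i j).coeff r = 0) (i j : Fin (m + n)) (r : ℤ)
    (hr : r < -(p : ℤ)) :
    (OpenChain.gmul m (OpenChain.gmul m (T .plus) D)
        (fun i j => subst (T' i j) (HahnSeries.single 1 M.sgn)) i j).coeff r = 0 := by
  have key : ∀ {f g : LaurentSeries A} {a b : ℤ}, (∀ r < a, f.coeff r = 0) →
      (∀ r < b, g.coeff r = 0) → ∀ r < a + b, (f * g).coeff r = 0 := by
    intro f g a b hf hg r hr
    rw [coeff_mul_eq_sum hf hg r subset_rfl, Finset.Icc_eq_empty (by omega), Finset.sum_empty]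
  simp only [OpenChain.gmul, HahnSeries.coeff_sum, coeff_neg_one_pow_mul]
  refine Finset.sum_eq_zero fun a _ => ?_
  rw [key (a := -p) (b := 0) _ _ r (by omega), mul_zero]
  · intro r hr
    simp only [HahnSeries.coeff_sum, coeff_neg_one_pow_mul]
    refine Finset.sum_eq_zero fun b _ => ?_
    rw [key (a := 0) (b := -p) (h.mode .plus i b).coeff_eq_zero_of_neg (hD b a) r (by omega),
      mul_zero]
  · intro r hr
    rw [subst_single_coeff M.sgn_ne_zero, (h.mode' a j).coeff_eq_zero_of_neg r hr, smul_zero]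

end IsMonodromy

end Dressing
end OpenChain
end

open scoped TensorProduct LaurentSeries
noncomputable section
namespace OpenChain

/-! ### The coproduct, the coaction and the dressing homomorphisms -/

section Coaction

variable {A B C : Type} [Ring A] [Ring B] [Ring C]

lemma coeffHom_coeffHom_comm {φ : A →+* B} {σ : B →+* B} {τ : A →+* A}
    (h : ∀ x, σ (φ x) = φ (τ x)) (f : LaurentSeries A) :
    coeffHom σ (coeffHom φ f) = coeffHom φ (coeffHom τ f) := by
  ext r; exact h _

lemma IsEven.coeffHom {N m : ℕ} {φ : A →+* B} {σ : B →+* B} {τ : A →+* A}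
    (h : ∀ x, σ (φ x) = φ (τ x)) {x : Fin N → Fin N → LaurentSeries A}
    (hx : IsEven m (coeffHom τ) x) :
    IsEven m (OpenChain.coeffHom σ) fun i j => OpenChain.coeffHom φ (x i j) := fun i j => by
  rw [coeffHom_coeffHom_comm h, hx i j, map_mul, map_pow, map_neg, map_one]

lemma IsEven.coeff {N m : ℕ} {σ : A →+* A} {x : Fin N → Fin N → LaurentSeries A}
    (hx : IsEven m (OpenChain.coeffHom σ) x) (i j : Fin N) (r : ℤ) :
    σ ((x i j).coeff r) = (-1) ^ (deg m i + deg m j) * (x i j).coeff r := by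
  rw [← coeff_neg_one_pow_mul, ← hx i j, coeffHom_coeff]

lemma IsEven.subst [Algebra ℂ A] {N m : ℕ} {σ : A →ₐ[ℂ] A} {x : Fin N → Fin N → LaurentSeries A}
    (hx : IsEven m (OpenChain.coeffHom (σ : A →+* A)) x) {z : LaurentSeries ℂ}
    (hz : z.order = 1) :
    IsEven m (OpenChain.coeffHom (σ : A →+* A)) fun i j => subst (x i j) z := fun i j => by
  simp only
  rw [coeffHom_subst σ hz, hx i j, ← substHom_apply hz, ← substHom_apply hz, map_mul, map_pow,
    map_neg, map_one]

variable (M : Model) (m n p : ℕ)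

lemma isEven_tSeries (ε : Side) : IsEven m
    (coeffHom (Mono.parity M m n : Mono M m n →+* Mono M m n)) (tSeries M m n ε) :=
  (isEven_freeT M m ε).coeffHom fun x => RingQuot.liftAlgHom_mkAlgHom_apply ℂ _ _ x

lemma isEven_t'Series : IsEven m
    (coeffHom (Mono.parity M m n : Mono M m n →+* Mono M m n)) (t'Series M m n) :=
  (isEven_freeT' M m).coeffHom fun x => RingQuot.liftAlgHom_mkAlgHom_apply ℂ _ _ x

lemma isEven_dSeries : IsEven m
    (coeffHom (Refl.parity M m n p : Refl M m n p →+* Refl M m n p)) (dSeries M m n p) :=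
  (isEven_freeD m p).coeffHom fun x => RingQuot.liftAlgHom_mkAlgHom_apply ℂ _ _ x

lemma coeffSuperCommute_include [Algebra ℂ A] [Algebra ℂ B] {N m : ℕ} {σ : A →ₐ[ℂ] A}
    {τ : B →ₐ[ℂ] B} [GradedAlgebra (eigenGrading σ)] [GradedAlgebra (eigenGrading τ)]
    {x : Fin N → Fin N → LaurentSeries A} {y : Fin N → Fin N → LaurentSeries B}
    (hx : IsEven m (coeffHom (σ : A →+* A)) x) (hy : IsEven m (coeffHom (τ : B →+* B)) y) :
    CoeffSuperCommute m
      (fun i j => coeffHom (GradedTensorProduct.includeLeft (R := ℂ) (eigenGrading σ)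
        (eigenGrading τ) : A →+* eigenGrading σ ᵍ⊗[ℂ] eigenGrading τ) (x i j))
      (fun i j => coeffHom (GradedTensorProduct.includeRight (R := ℂ) (eigenGrading σ)
        (eigenGrading τ) : B →+* eigenGrading σ ᵍ⊗[ℂ] eigenGrading τ) (y i j)) := by
  refine CoeffSuperCommute.symm fun r s i j k l => ?_
  exact includeRight_mul_includeLeft σ τ (hx.coeff k l s) (hy.coeff i j r)

instance : GradedAlgebra (eigenGrading (Mono.parity M m n)) :=
  inferInstanceAs (GradedAlgebra (Mono.grading M m n))

instance : GradedAlgebra (eigenGrading (Refl.parity M m n p)) :=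
  inferInstanceAs (GradedAlgebra (Refl.grading M m n p))

/-! #### The coproduct -/

variable {M m n p}

/-- `IsCoproduct` prescribes only `Δ(T^±)`. Uniqueness of inverses determines the remaining
generators, with the tensor factors in reverse order. -/
lemma IsCoproduct.map_inverse {Δ : Mono M m n →ₐ[ℂ] MonoMono M m n} (h : IsCoproduct M m n Δ) :
    (fun i j => coeffHom (Δ : Mono M m n →+* MonoMono M m n) (t'Series M m n i j)) =
    gmul m
      (fun i j => coeffHom (GradedTensorProduct.includeRight (Mono.grading M m n)
        (Mono.grading M m n) : Mono M m n →+* MonoMono M m n) (t'Series M m n i j))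
      (fun i j => coeffHom (GradedTensorProduct.includeLeft (Mono.grading M m n)
        (Mono.grading M m n) : Mono M m n →+* MonoMono M m n) (t'Series M m n i j)) := by
  have h0 := isMonodromy_tSeries M m n
  have h1 := gmul_eq_gone_map h0.inv_left (Δ : Mono M m n →+* MonoMono M m n)
  have e : (fun i j => coeffHom (Δ : Mono M m n →+* MonoMono M m n) (tSeries M m n .minus i j)) = _
    := funext fun i => funext fun j => h .minus i j
  rw [e] at h1
  exact gmul_left_inv_eq_right_inv h1 (gmul_gmul_inv (gmul_eq_gone_map h0.inv_right _)
    (gmul_eq_gone_map h0.inv_right _))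

variable (M m n p)

lemma existsUnique_coproduct : ∃! Δ : Mono M m n →ₐ[ℂ] MonoMono M m n, IsCoproduct M m n Δ := by
  have h₁ := (isMonodromy_tSeries M m n).map
    (GradedTensorProduct.includeLeft (Mono.grading M m n) (Mono.grading M m n))
  have h₂ := (isMonodromy_tSeries M m n).map
    (GradedTensorProduct.includeRight (Mono.grading M m n) (Mono.grading M m n))
  obtain ⟨Δ, hΔ, -⟩ := (h₁.gmul h₂ fun ε ε' => coeffSuperCommute_include
    (isEven_tSeries M m n ε) (isEven_tSeries M m n ε')).exists_lift
  refine ⟨Δ, hΔ, fun Δ' hΔ' => Mono.algHom_ext (fun ε i j => ?_) fun i j => ?_⟩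
  · exact (hΔ' ε i j).trans (hΔ ε i j).symm
  · exact (congrFun (congrFun hΔ'.map_inverse i) j).trans
      (congrFun (congrFun (IsCoproduct.map_inverse hΔ) i) j).symm

/-! #### The coaction -/

lemma D_u₀ : D M m n p M.u₀ = dSeries M m n p := by
  ext1 i; ext1 j
  rw [D, M.loc_u₀, subst_single_one]

lemma T_u₀ : T M m n M.u₀ = tSeries M m n .plus := by
  ext1 i; ext1 j
  rw [T, M.loc_u₀, subst_single_one]

lemma Tinv_u₀ : Tinv M m n M.u₀ =
    fun i j => subst (t'Series M m n i j) (HahnSeries.single 1 M.sgn) := by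
  ext1 i; ext1 j
  rw [Tinv, M.inv_iota_u₀]

/-- Dressing is applied in the graded tensor product: the monodromy matrices come from the first
factor and `D` from the second, so they supercommute. -/
lemma existsUnique_coaction :
    ∃! Δ : Refl M m n p →ₐ[ℂ] MonoRefl M m n p, IsCoaction M m n p Δ := by
  set iL := GradedTensorProduct.includeLeft (R := ℂ) (Mono.grading M m n) (Refl.grading M m n p)
  set iR := GradedTensorProduct.includeRight (R := ℂ) (Mono.grading M m n) (Refl.grading M m n p)
  have h := (isMonodromy_tSeries M m n).map iL
  have hD : reflL M m n (fun i j => coeffHom (iR : Refl M m n p →+* MonoRefl M m n p)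
        (dSeries M m n p i j)) =
      reflR M m n (fun i j => coeffHom (iR : Refl M m n p →+* MonoRefl M m n p)
        (dSeries M m n p i j)) := by
    ext1 i; ext1 j; ext1 k; ext1 l
    rw [← map_reflL, ← map_reflR, dSeries_reflection]
  have hp : ∀ i j, ∀ r : ℤ, r < -(p : ℤ) →
      (coeffHom (iR : Refl M m n p →+* MonoRefl M m n p) (dSeries M m n p i j)).coeff r = 0 :=
    fun i j r hr => by rw [coeffHom_coeff, dSeries_pole M m n p i j r hr, map_zero]
  obtain ⟨Δ, hΔ⟩ := Refl.exists_lift (h.dress_pole hp) (h.dress hD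
    (coeffSuperCommute_include (isEven_tSeries M m n .plus) (isEven_dSeries M m n p)).symm
    (coeffSuperCommute_include (isEven_t'Series M m n) (isEven_dSeries M m n p)).symm)
  have key : ∀ i j, gmul m (gmul m (fun i j => coeffHom (iL : Mono M m n →+* MonoRefl M m n p)
      (tSeries M m n .plus i j)) fun i j => coeffHom (iR : Refl M m n p →+* MonoRefl M m n p)
        (dSeries M m n p i j)) (fun i j => subst (coeffHom (iL : Mono M m n →+* MonoRefl M m n p)
          (t'Series M m n i j)) (HahnSeries.single 1 M.sgn)) i j =
      sandwich M m n p (T M m n M.u₀) (D M m n p M.u₀) (Tinv M m n M.u₀) i j := by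
    intro i j
    rw [D_u₀, T_u₀, Tinv_u₀, sandwich]
    congr 2
    ext1 i; ext1 j
    exact (coeffHom_subst iL (order_single_one M.sgn_ne_zero) _).symm
  refine ⟨Δ, fun i j => ?_, fun Δ' hΔ' => Refl.algHom_ext fun i j => ?_⟩
  · rw [← key, D_u₀]; exact hΔ i j
  · have := hΔ' i j
    rw [← key, D_u₀] at this
    exact this.trans (hΔ i j).symm

/-! #### The dressing homomorphisms -/

lemma isEven_Tinv_u₀ : IsEven m
    (coeffHom (Mono.parity M m n : Mono M m n →+* Mono M m n)) (Tinv M m n M.u₀) := by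
  rw [Tinv_u₀]
  exact (isEven_t'Series M m n).subst (order_single_one M.sgn_ne_zero)

variable {M m n p} {K : Fin (m + n) → Fin (m + n) → LaurentSeries ℂ}

lemma IsBoundary.isEven (hK : IsBoundary M m n p K) (σ : Mono M m n →ₐ[ℂ] Mono M m n) :
    IsEven m (coeffHom (σ : Mono M m n →+* Mono M m n))
      fun i j => scal (Mono M m n) (K i j) := fun i j => by
  rw [coeffHom_scal]
  by_cases h : deg m i = deg m j
  · rw [h, neg_one_pow_congr (f := 0) (by omega), pow_zero, one_mul]
  · simp only [hK.even i j h, map_zero, mul_zero]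

/-- Scalars commute with everything; since the odd entries of `K` vanish, this is also graded
commutation. -/
lemma IsBoundary.coeffSuperCommute (hK : IsBoundary M m n p K)
    (x : Fin (m + n) → Fin (m + n) → LaurentSeries (Mono M m n)) :
    CoeffSuperCommute m (fun i j => scal (Mono M m n) (K i j)) x := fun r s i j k l => by
  by_cases h : deg m i = deg m j
  · rw [h, neg_one_pow_congr (f := 0), pow_zero, one_mul]
    · exact Algebra.commutes _ _
    · rw [← two_mul, mul_assoc, Nat.mul_mod_right]
  · simp [hK.even i j h]

lemma IsBoundary.existsUnique_dressing (hK : IsBoundary M m n p K) :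
    ∃! φ : Refl M m n p →ₐ[ℂ] Mono M m n, IsDressing M m n p K φ := by
  have h := isMonodromy_tSeries M m n
  have hD : reflL M m n (fun i j => scal (Mono M m n) (K i j)) =
      reflR M m n fun i j => scal (Mono M m n) (K i j) := by
    ext1 i; ext1 j; ext1 k; ext1 l
    have e1 := map_reflL (M := M) (Algebra.ofId ℂ (Mono M m n)) K i j k l
    have e2 := map_reflR (M := M) (Algebra.ofId ℂ (Mono M m n)) K i j k l
    rw [hK.refl] at e1
    exact e1.symm.trans e2
  have hp : ∀ i j, ∀ r : ℤ, r < -(p : ℤ) → (scal (Mono M m n) (K i j)).coeff r = 0 :=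
    fun i j r hr => by rw [scal, coeffHom_coeff, hK.pole i j r hr, map_zero]
  obtain ⟨φ, hφ⟩ := Refl.exists_lift (h.dress_pole hp)
    (h.dress hD (hK.coeffSuperCommute _) (hK.coeffSuperCommute _))
  refine ⟨φ, fun i j => ?_, fun φ' hφ' => Refl.algHom_ext fun i j => ?_⟩
  · rw [D_u₀, T_u₀, Tinv_u₀]; exact hφ i j
  · have := hφ' i j
    rw [D_u₀, T_u₀, Tinv_u₀] at this
    exact this.trans (hφ i j).symm

/-- Because `K` is even, `φ` maps `d_{ij}` to elements of the same grade. Without this `id ⊗ φ` need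
not be multiplicative on the graded tensor product. -/
lemma IsDressing.parity {φ : Refl M m n p →ₐ[ℂ] Mono M m n} (hK : IsBoundary M m n p K)
    (h : IsDressing M m n p K φ) (x : Refl M m n p) :
    Mono.parity M m n (φ x) = φ (Refl.parity M m n p x) := by
  have e : (Mono.parity M m n).comp φ = φ.comp (Refl.parity M m n p) := by
    refine Refl.algHom_ext fun i j => ?_
    have h1 := h i j
    have h2 := ((((T_u₀ M m n).symm ▸ isEven_tSeries M m n .plus).gmul
      (hK.isEven (Mono.parity M m n))).gmul (isEven_Tinv_u₀ M m n)) i j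
    rw [← h1, D_u₀] at h2
    refine Eq.trans h2 ?_
    have h3 := congrArg (coeffHom (φ : Refl M m n p →+* Mono M m n)) (isEven_dSeries M m n p i j)
    rw [map_mul, map_pow, map_neg, map_one] at h3
    exact h3.symm
  exact DFunLike.congr_fun e x

lemma IsDressing.anticommute {φ : Refl M m n p →ₐ[ℂ] Mono M m n} (hK : IsBoundary M m n p K)
    (h : IsDressing M m n p K φ) ⦃i j : ZMod 2⦄ (a : Mono.grading M m n i)
    (b : Refl.grading M m n p j) :
    GradedTensorProduct.includeLeft (R := ℂ) (Mono.grading M m n) (Mono.grading M m n) a *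
      ((GradedTensorProduct.includeRight (R := ℂ) (Mono.grading M m n)
        (Mono.grading M m n)).comp φ) b =
    (-1 : ℤˣ) ^ (j * i) • (((GradedTensorProduct.includeRight (R := ℂ) (Mono.grading M m n)
        (Mono.grading M m n)).comp φ) b *
      GradedTensorProduct.includeLeft (R := ℂ) (Mono.grading M m n) (Mono.grading M m n) a) := by
  have hb : φ b ∈ Mono.grading M m n j := by
    have hb' : Refl.parity M m n p b = (-1 : ℂ) ^ j.val • (b : Refl M m n p) := b.2
    change Mono.parity M m n (φ b) = (-1 : ℂ) ^ j.val • φ b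
    rw [h.parity hK, hb', map_smul]
  -- The graded commutation of the two inclusions is read off from the universal property applied to
  -- the identity map.
  exact ((GradedTensorProduct.liftEquiv (R := ℂ) (Mono.grading M m n)
    (Mono.grading M m n)).symm (AlgHom.id ℂ _)).2 a ⟨φ b, hb⟩

/-- Identifies the linear map `id ⊗ φ` with an algebra homomorphism, so that the compatibility with
the coproducts can be checked on the generators `D(u)`. -/
lemma IsDressing.idTensor_apply {φ : Refl M m n p →ₐ[ℂ] Mono M m n} (hK : IsBoundary M m n p K)
    (h : IsDressing M m n p K φ) (x : MonoRefl M m n p) :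
    idTensor M m n p φ x = GradedTensorProduct.lift (Mono.grading M m n) (Refl.grading M m n p)
      (GradedTensorProduct.includeLeft (R := ℂ) (Mono.grading M m n) (Mono.grading M m n))
      ((GradedTensorProduct.includeRight (R := ℂ) (Mono.grading M m n)
        (Mono.grading M m n)).comp φ) (h.anticommute hK) x := by
  have e : idTensor M m n p φ = (GradedTensorProduct.lift (Mono.grading M m n)
      (Refl.grading M m n p)
      (GradedTensorProduct.includeLeft (R := ℂ) (Mono.grading M m n) (Mono.grading M m n))
      ((GradedTensorProduct.includeRight (R := ℂ) (Mono.grading M m n)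
        (Mono.grading M m n)).comp φ) (h.anticommute hK)).toLinearMap := by
    apply GradedTensorProduct.hom_ext
    apply TensorProduct.ext'
    intro a b
    exact (GradedTensorProduct.tmul_one_mul_one_tmul (R := ℂ) (Mono.grading M m n)
      (Mono.grading M m n) a (φ b)).symm
  exact DFunLike.congr_fun e x

lemma IsDressing.idTensor_coaction {φ : Refl M m n p →ₐ[ℂ] Mono M m n}
    {ΔA : Mono M m n →ₐ[ℂ] MonoMono M m n} {Δ : Refl M m n p →ₐ[ℂ] MonoRefl M m n p}
    (hK : IsBoundary M m n p K) (h : IsDressing M m n p K φ) (hA : IsCoproduct M m n ΔA)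
    (hΔ : IsCoaction M m n p Δ) (x : Refl M m n p) :
    idTensor M m n p φ (Δ x) = ΔA (φ x) := by
  rw [h.idTensor_apply hK]
  set jL := GradedTensorProduct.includeLeft (R := ℂ) (Mono.grading M m n) (Mono.grading M m n)
    with hjL
  set jR := GradedTensorProduct.includeRight (R := ℂ) (Mono.grading M m n) (Mono.grading M m n)
    with hjR
  set Ψ := GradedTensorProduct.lift (Mono.grading M m n) (Refl.grading M m n p) jL (jR.comp φ)
    (h.anticommute hK) with hΨ
  have hz := order_single_one M.sgn_ne_zero
  have hL : ∀ f, coeffHom (Ψ : MonoRefl M m n p →+* MonoMono M m n)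
      (coeffHom (GradedTensorProduct.includeLeft (R := ℂ) (Mono.grading M m n)
        (Refl.grading M m n p) : Mono M m n →+* MonoRefl M m n p) f) =
      coeffHom (jL : Mono M m n →+* MonoMono M m n) f := by
    intro f
    ext r
    change jL (f.coeff r) * (jR.comp φ) 1 = jL (f.coeff r)
    rw [map_one, mul_one]
  have hR : ∀ f, coeffHom (Ψ : MonoRefl M m n p →+* MonoMono M m n)
      (coeffHom (GradedTensorProduct.includeRight (R := ℂ) (Mono.grading M m n)
        (Refl.grading M m n p) : Refl M m n p →+* MonoRefl M m n p) f) =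
      coeffHom (jR : Mono M m n →+* MonoMono M m n)
        (coeffHom (φ : Refl M m n p →+* Mono M m n) f) := by
    intro f
    ext r
    change jL 1 * (jR.comp φ) (f.coeff r) = jR (φ (f.coeff r))
    rw [map_one, one_mul]; rfl
  have hinv : (fun i j => coeffHom (ΔA : Mono M m n →+* MonoMono M m n) (Tinv M m n M.u₀ i j)) =
      gmul m (fun i j => coeffHom (jR : Mono M m n →+* MonoMono M m n) (Tinv M m n M.u₀ i j))
        (fun i j => coeffHom (jL : Mono M m n →+* MonoMono M m n) (Tinv M m n M.u₀ i j)) := by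
    ext1 i; ext1 j
    have e := congrArg (substHom (MonoMono M m n) hz) (congrFun (congrFun hA.map_inverse i) j)
    rw [map_gmul] at e
    simp only [substHom_apply, ← coeffHom_subst _ hz] at e
    rw [Tinv_u₀]
    exact e
  have e : Ψ.comp Δ = ΔA.comp φ := by
    refine Refl.algHom_ext fun i j => ?_
    have e1 := congrArg (coeffHom (Ψ : MonoRefl M m n p →+* MonoMono M m n)) (hΔ i j)
    have e2 := congrArg (coeffHom (ΔA : Mono M m n →+* MonoMono M m n)) (h i j)
    have e3 : (fun i j => coeffHom (φ : Refl M m n p →+* Mono M m n) (D M m n p M.u₀ i j)) = _ :=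
      funext fun i => funext fun j => h i j
    have e4 : (fun i j => coeffHom (ΔA : Mono M m n →+* MonoMono M m n) (T M m n M.u₀ i j)) = _ :=
      (congrArg (fun f : Fin (m + n) → Fin (m + n) → LaurentSeries (Mono M m n) =>
        fun i j => coeffHom (ΔA : Mono M m n →+* MonoMono M m n) (f i j)) (T_u₀ M m n)).trans
          (funext fun i => funext fun j => hA .plus i j)
    simp only [sandwich, map_gmul, hL, hR] at e1
    simp only [map_gmul, hinv, e4, coeffHom_scal] at e2
    have e5 : (fun i j => coeffHom (jR : Mono M m n →+* MonoMono M m n)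
        (coeffHom (φ : Refl M m n p →+* Mono M m n) (D M m n p M.u₀ i j))) =
        gmul m (gmul m (fun i j => coeffHom (jR : Mono M m n →+* MonoMono M m n)
          (T M m n M.u₀ i j)) fun i j => scal (MonoMono M m n) (K i j))
          fun i j => coeffHom (jR : Mono M m n →+* MonoMono M m n) (Tinv M m n M.u₀ i j) := by
      ext1 i; ext1 j
      rw [h i j]
      simp only [map_gmul, coeffHom_scal]
    rw [e5] at e1
    rw [D_u₀] at e1 e2
    refine Eq.trans e1 (Eq.trans ?_ e2.symm)
    rw [T_u₀]
    simp only [gmul_assoc]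
    rfl
  exact DFunLike.congr_fun e x

end Coaction
end OpenChain
end

open scoped TensorProduct LaurentSeries
noncomputable section
namespace OpenChain

/-! ### The linear system satisfied by the reduced generators -/

section LinearSystem

variable {F : Type} [Field F]

/-- The data entering the linear relations between products of entries of the monodromy
matrices. -/
structure ExchangeData (F : Type) where
  κ : ℕ → F
  p : ℕ → F
  b : F
  ρ : F

namespace ExchangeData

variable (x : ExchangeData F)

/-- The diagonal coefficient `κ_l + p_l b = ρ κ_l + b / p_l`. -/
def a (l : ℕ) : F := x.κ l + x.p l * x.b

/-- The product `p_0 ⋯ p_{n-1}`. -/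
def E (n : ℕ) : F := ∏ l ∈ Finset.range n, x.p l

/-- The weights that make the recurrences below telescope. After division by `1 + Lam K` they become
the coefficients of `d_{aa}` in the reduced generators. -/
def lam (l : ℕ) : F := x.κ l / (x.b * x.E l * x.E (l + 1))

def Lam (n : ℕ) : F := ∑ l ∈ Finset.range n, x.lam l

/-- The nondegeneracy of the linear system up to the index `K`. -/
structure Regular (K : ℕ) : Prop where
  b_ne : x.b ≠ 0
  p_ne : ∀ l, x.p l ≠ 0
  a_eq : ∀ l, x.κ l + x.p l * x.b = x.ρ * x.κ l + x.b / x.p l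
  Lam_ne : ∀ n ≤ K, 1 + x.Lam n ≠ 0

lemma E_succ (n : ℕ) : x.E (n + 1) = x.E n * x.p n := Finset.prod_range_succ _ _

lemma Lam_succ (n : ℕ) : x.Lam (n + 1) = x.Lam n + x.lam n := Finset.sum_range_succ _ _

variable {x} {K : ℕ}

lemma Regular.E_ne (h : x.Regular K) (n : ℕ) : x.E n ≠ 0 :=
  Finset.prod_ne_zero_iff.2 fun l _ => h.p_ne l

lemma Regular.κ_eq (h : x.Regular K) (l : ℕ) :
    x.p l * ((x.ρ - 1) * x.κ l) = x.p l ^ 2 * x.b - x.b := by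
  have h1 := h.a_eq l
  have h2 := h.p_ne l
  field_simp at h1
  linear_combination -h1

lemma Regular.lam_mul (h : x.Regular K) (l : ℕ) :
    x.lam l * (x.b * x.E l ^ 2 * x.p l) = x.κ l := by
  have h1 := h.E_ne l
  have h2 := h.p_ne l
  have h3 := h.b_ne
  rw [lam, E_succ]
  field_simp

lemma Regular.lam_eq (h : x.Regular K) (l : ℕ) :
    (x.ρ - 1) * x.lam l * x.E (l + 1) ^ 2 = x.p l ^ 2 - 1 := by
  have h3 := h.b_ne
  apply mul_right_cancel₀ h3
  rw [E_succ]
  linear_combination (x.ρ - 1) * x.p l * h.lam_mul l + h.κ_eq l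

/-- Both expressions for the diagonal coefficient give `p (ρ - 1) κ = (p² - 1) b`, whose sum
telescopes. For `ρ = 1` the identity determines `E` but not `Lam`, so it is kept free of division.
-/
lemma Regular.Lam_eq (h : x.Regular K) (n : ℕ) :
    (x.ρ - 1) * x.Lam n * x.E n ^ 2 = x.E n ^ 2 - 1 := by
  induction n with
  | zero => simp [Lam, E]
  | succ n ih =>
    have h1 := h.lam_eq n
    rw [E_succ] at h1 ⊢
    rw [Lam_succ]
    linear_combination x.p n ^ 2 * ih + h1

/-- The weighted sum of the first `n` terms of `s`. -/
def B (x : ExchangeData F) (s : ℕ → F) (n : ℕ) : F :=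
  ∑ l ∈ Finset.range n, x.lam l * (x.E l * x.E (l + 1)) ^ 2 * s l

/-- The sum of the first `n` terms of `v`, weighted by `lam`. -/
def Q (x : ExchangeData F) (v : ℕ → F) (n : ℕ) : F := ∑ l ∈ Finset.range n, x.lam l * v l

lemma B_succ (s : ℕ → F) (n : ℕ) :
    x.B s (n + 1) = x.B s n + x.lam n * (x.E n * x.E (n + 1)) ^ 2 * s n :=
  Finset.sum_range_succ _ _

lemma Q_succ (v : ℕ → F) (n : ℕ) : x.Q v (n + 1) = x.Q v n + x.lam n * v n :=
  Finset.sum_range_succ _ _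

/-- Partial sums of the solution of an upper triangular system. -/
lemma Regular.upper (h : x.Regular K) {r s : ℕ → F} {v : F} {c : ℕ} (h0 : r 0 = 0)
    (hr : ∀ e < c, x.a e * (r (e + 1) - r e) + x.ρ * x.κ e * r e + x.κ e * (v - r (e + 1)) =
      x.κ e * s e) {n : ℕ} (hn : n ≤ c) :
    x.E n ^ 2 * r n = x.B s n - x.E n ^ 2 * x.Lam n * v := by
  induction n with
  | zero => simp [h0, B, Lam]
  | succ n ih =>
    have h1 := ih (by omega)
    have h2 := hr n (by omega)
    have h3 := h.lam_mul n
    have h4 := h.κ_eq n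
    have hb := h.b_ne
    have hp := h.p_ne n
    have h5 := h.lam_eq n
    have h6 := h.Lam_eq n
    rw [E_succ] at h5
    rw [B_succ, Lam_succ, E_succ]
    rw [a] at h2
    apply mul_right_cancel₀ hb
    -- In terms of partial sums each equation involves only `r (n + 1)`, `r n` and the total `v`.
    -- The identities for `κ`, `lam` and `Lam` remove `ρ` from the recurrence.
    linear_combination x.b * h1 + x.E n ^ 2 * x.p n * h2 - x.E n ^ 2 * r n * h4 +
      (v - s n) * x.E n ^ 2 * x.p n * h3 - x.b * v * x.Lam n * x.E n ^ 2 * h5 +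
      x.b * v * x.p n ^ 2 * x.E n ^ 2 * x.lam n * h6

/-- Partial sums of the solution of a lower triangular system. -/
lemma Regular.lower (h : x.Regular K) {s v : ℕ → F} {S : F} {c : ℕ} (h0 : s 0 = 0)
    (hs : ∀ d < c, x.ρ * x.κ d * v d = x.a d * (s (d + 1) - s d) + x.κ d * s d +
      x.ρ * x.κ d * (S - s (d + 1))) {n : ℕ} (hn : n ≤ c) :
    s n = -(x.ρ * x.E n ^ 2 * (x.Lam n * S - x.Q v n)) := by
  induction n with
  | zero => simp [h0, Q, Lam]
  | succ n ih =>
    have h1 := ih (by omega)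
    have h2 := hs n (by omega)
    have h3 := h.lam_mul n
    have h4 := h.κ_eq n
    have hb := h.b_ne
    rw [Q_succ, Lam_succ, E_succ]
    rw [a] at h2
    apply mul_right_cancel₀ hb
    linear_combination x.p n ^ 2 * x.b * h1 - x.p n * h2 + s (n + 1) * h4 -
      (v n - S) * x.ρ * x.p n * h3

/-- The linear system between two triangular arrays of vectors: `r c n` and `s c n` are the sums
of the first `n` entries of their rows `c`. -/
structure Rows {V : Type} [AddCommGroup V] [Module F V] (x : ExchangeData F) (K : ℕ)
    (r s : ℕ → ℕ → V) : Prop where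
  r_zero : ∀ c < K, r c 0 = 0
  s_zero : ∀ c < K, s c 0 = 0
  diag : ∀ c < K, x.a c • (r c (c + 1) - r c c) + (x.ρ * x.κ c) • r c c =
    x.a c • (s c (c + 1) - s c c) + x.κ c • s c c
  low : ∀ c < K, ∀ d < c, (x.ρ * x.κ d) • r d (d + 1) =
    x.a d • (s c (d + 1) - s c d) + x.κ d • s c d +
      (x.ρ * x.κ d) • (s c (c + 1) - s c (d + 1))
  up : ∀ c < K, ∀ e < c, x.a e • (r c (e + 1) - r c e) + (x.ρ * x.κ e) • r c e +
    x.κ e • (r c (c + 1) - r c (e + 1)) = x.κ e • s e (e + 1)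

lemma Rows.map {V : Type} [AddCommGroup V] [Module F V] {r s : ℕ → ℕ → V} (h : Rows x K r s)
    (φ : V →ₗ[F] F) : Rows x K (fun c n => φ (r c n)) fun c n => φ (s c n) where
  r_zero c hc := by rw [h.r_zero c hc, map_zero]
  s_zero c hc := by rw [h.s_zero c hc, map_zero]
  diag c hc := by simpa only [map_add, map_sub, map_smul] using congrArg φ (h.diag c hc)
  low c hc d hd := by simpa only [map_add, map_sub, map_smul] using congrArg φ (h.low c hc d hd)
  up c hc e he := by simpa only [map_add, map_sub, map_smul] using congrArg φ (h.up c hc e he)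

namespace Rows

variable {r s : ℕ → ℕ → F}

/-- The upper system gives `r c c`, the lower one gives `s c c`, and the diagonal equation relates
the last increments of row `c`. Eliminating `r c c` and `s c c` leaves one equation between the full
row sums `r c (c+1)` and `s c (c+1)`, which provides the induction step. -/
lemma weighted_sums (h : x.Regular K) (hR : Rows x K r s) {c : ℕ} (hc : c ≤ K) :
    x.B (fun l => s l (l + 1)) c = x.E c ^ 2 * x.Q (fun l => r l (l + 1)) c := by
  induction c with
  | zero => simp [B, Q]
  | succ c ih =>
    have ih := ih (by omega)
    have hU := h.upper (r := r c) (s := fun l => s l (l + 1)) (v := r c (c + 1)) (c := c)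
      (hR.r_zero c hc) (hR.up c hc) le_rfl
    have hL := h.lower (s := s c) (v := fun l => r l (l + 1)) (S := s c (c + 1)) (c := c)
      (hR.s_zero c hc) (hR.low c hc) le_rfl
    have hD := hR.diag c hc
    simp only [smul_eq_mul] at hD
    have h0 := h.Lam_ne (c + 1) hc
    have h3 := h.lam_mul c
    have h4 := h.κ_eq c
    have h5 := h.lam_eq c
    have h6 := h.Lam_eq c
    have hb := h.b_ne
    have hp := h.p_ne c
    have hE := h.E_ne c
    rw [Lam_succ] at h0
    rw [E_succ] at h5
    rw [a] at hD
    rw [B_succ, Q_succ, E_succ]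
    have key : r c (c + 1) = x.E c ^ 2 * s c (c + 1) -
        (x.ρ - 1) * x.B (fun l => s l (l + 1)) c := by
      have e1 : x.b * (x.E c ^ 2 * (x.p c ^ 2 * (x.lam c * x.E c ^ 2 + 1) + x.Lam c)) *
          r c (c + 1) = x.b * (x.B (fun l => s l (l + 1)) c +
          x.E c ^ 2 * x.p c ^ 2 * (x.lam c * x.E c ^ 2 + 1) * s c (c + 1) +
          x.p c ^ 2 * x.ρ * x.E c ^ 2 *
            (x.E c ^ 2 * x.Lam c * s c (c + 1) - x.B (fun l => s l (l + 1)) c)) := by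
        linear_combination x.p c * x.E c ^ 2 * hD - x.E c ^ 2 * r c c * h4 + x.b * hU -
          x.p c ^ 2 * x.b * x.E c ^ 2 * hL + x.p c ^ 2 * x.b * x.E c ^ 2 * x.ρ * ih +
          x.p c * x.E c ^ 2 * (r c (c + 1) - s c (c + 1)) * h3
      -- The coefficient of the row sum is, up to nonzero factors, `1 + Lam (c + 1)`; this is the
      -- use of `Lam_ne`.
      have hg : x.b * (x.E c ^ 2 * (x.p c ^ 2 * (x.lam c * x.E c ^ 2 + 1) + x.Lam c)) ≠ 0 := by
        have : x.b * (x.E c ^ 2 * (x.p c ^ 2 * (x.lam c * x.E c ^ 2 + 1) + x.Lam c)) =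
            x.b * x.E c ^ 2 * x.p c ^ 2 * (1 + (x.Lam c + x.lam c)) := by
          linear_combination x.b * x.E c ^ 2 * (x.Lam c * h5 - x.p c ^ 2 * x.lam c * h6)
        rw [this]
        positivity
      apply mul_left_cancel₀ hg
      rw [e1]
      linear_combination x.b * s c (c + 1) * x.E c ^ 2 *
        (x.p c ^ 2 * (x.lam c * x.E c ^ 2 + 1) * h6 - x.Lam c * x.E c ^ 2 * h5) +
        x.b * x.B (fun l => s l (l + 1)) c * (x.E c ^ 2 * h5 + h6)
    rw [key]
    linear_combination x.p c ^ 2 * ih + x.B (fun l => s l (l + 1)) c * h5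

/-- Partial sums of the rows of the upper triangular systems. -/
lemma partial_sum (h : x.Regular K) (hR : Rows x K r s) {q : ℕ → F} {v δ : F} {c : ℕ}
    (hc : c ≤ K) (h0 : q 0 = 0)
    (hq : ∀ e < c, x.a e * (q (e + 1) - q e) + x.ρ * x.κ e * q e + x.κ e * (v - q (e + 1)) =
      x.κ e * (δ * s e (e + 1))) {n : ℕ} (hn : n ≤ c) :
    q n = δ * x.Q (fun l => r l (l + 1)) n - x.Lam n * v := by
  have h1 := h.upper (s := fun e => δ * s e (e + 1)) h0 hq hn
  have h2 : x.B (fun e => δ * s e (e + 1)) n = δ * x.B (fun l => s l (l + 1)) n := by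
    rw [B, B, Finset.mul_sum]
    exact Finset.sum_congr rfl fun _ _ => by ring
  -- This eliminates `s`: the solution of the upper system is expressed through the row sums of `r`
  -- alone.
  rw [h2, hR.weighted_sums h (hn.trans hc)] at h1
  apply mul_left_cancel₀ (pow_ne_zero 2 (h.E_ne n))
  linear_combination h1

/-- The sum over a column of the array `Y`, weighted by `lam`. -/
lemma column_sum (h : x.Regular K) (hR : Rows x K r s) {c : ℕ} (hc : c < K) :
    ∑ a ∈ Finset.Ico c K, x.lam a * (r a (c + 1) - r a c) =
      x.lam c * ((1 + x.Lam K) * r c (c + 1) - x.Q (fun l => r l (l + 1)) K) := by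
  have hrow : ∀ a < K, ∀ n ≤ a, r a n = x.Q (fun l => r l (l + 1)) n - x.Lam n * r a (a + 1) := by
    intro a ha n hn
    have := hR.partial_sum h (q := r a) (δ := 1) ha.le (hR.r_zero a ha)
      (fun e he => by rw [one_mul]; exact hR.up a ha e he) hn
    rwa [one_mul] at this
  -- The induction runs over the upper limit of the sum, with `c` fixed, since the closed form of
  -- row `L` involves only `Q` and `Lam` at `c`, `c + 1` and its own row sum.
  have key : ∀ L, c < L → L ≤ K → ∑ a ∈ Finset.Ico c L, x.lam a * (r a (c + 1) - r a c) =
      x.lam c * ((1 + x.Lam L) * r c (c + 1) - x.Q (fun l => r l (l + 1)) L) := by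
    intro L hL
    induction L, hL using Nat.le_induction with
    | base =>
      intro _
      rw [Finset.sum_Ico_succ_top le_rfl, Finset.Ico_self, Finset.sum_empty,
        hrow c hc c le_rfl, Lam_succ, Q_succ]
      ring
    | succ L hL ih =>
      intro hLK
      rw [Finset.sum_Ico_succ_top (by omega), ih (by omega), hrow L hLK (c + 1) hL,
        hrow L hLK c (by omega), Lam_succ, Q_succ, Lam_succ, Q_succ]
      ring
  exact key K hc le_rfl

end Rows

/-- The scalar form of the identity between the reduced generators. -/
lemma Regular.reduced (h : x.Regular K) {r s : ℕ → ℕ → F} (hR : Rows x K r s) {q : ℕ → F}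
    {v δ : F} (h0 : q 0 = 0)
    (hq : ∀ e < K, x.a e * (q (e + 1) - q e) + x.ρ * x.κ e * q e + x.κ e * (v - q (e + 1)) =
      x.κ e * (δ * s e (e + 1))) {f : ℕ → F} (hf : ∀ c < K, f c * (1 + x.Lam K) = x.lam c)
    {c : ℕ} (hc : c < K) :
    q (c + 1) - q c + f c * (v - q K) =
      δ * ∑ a ∈ Finset.Ico c K, f a * (r a (c + 1) - r a c) := by
  have hL := h.Lam_ne K le_rfl
  have h1 := hR.partial_sum h le_rfl h0 hq (n := c) hc.le
  have h2 := hR.partial_sum h le_rfl h0 hq (n := c + 1) hc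
  have h3 := hR.partial_sum h le_rfl h0 hq (n := K) le_rfl
  have h4 := hR.column_sum h hc
  have h5 : ∑ a ∈ Finset.Ico c K, x.lam a * (r a (c + 1) - r a c) =
      (1 + x.Lam K) * ∑ a ∈ Finset.Ico c K, f a * (r a (c + 1) - r a c) := by
    rw [Finset.mul_sum]
    refine Finset.sum_congr rfl fun a ha => ?_
    rw [← hf a (Finset.mem_Ico.1 ha).2]
    ring
  rw [h5] at h4
  rw [Lam_succ, Q_succ] at h2
  have h6 := hf c hc
  apply mul_left_cancel₀ hL
  rw [h1, h2, h3]
  linear_combination (v - (δ * x.Q (fun l => r l (l + 1)) K - x.Lam K * v)) * h6 - δ * h4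

/-- The homogeneous lower triangular system has only the trivial solution. -/
lemma Regular.lower_eq_zero (h : x.Regular K) {s : ℕ → F} {L : ℕ} (hL : L ≤ K) (h0 : s 0 = 0)
    (hs : ∀ d < L, x.a d * (s (d + 1) - s d) + x.κ d * s d +
      x.ρ * x.κ d * (s L - s (d + 1)) = 0) {n : ℕ} (hn : n ≤ L) : s n = 0 := by
  have key : ∀ n ≤ L, s n = -(x.ρ * x.E n ^ 2 * (x.Lam n * s L)) := by
    intro n hn
    have := h.lower (v := fun _ => 0) (S := s L) h0 (fun d hd => by
      rw [hs d hd, mul_zero]) hn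
    simpa [Q] using this
  have h1 := key L le_rfl
  have h2 := h.Lam_eq L
  -- The closed form at `n = L` contains the unknown total `s L` on both sides; nondegeneracy forces
  -- it to vanish, and then all partial sums vanish.
  have h3 : x.E L ^ 2 * (1 + x.Lam L) * s L = 0 := by
    linear_combination h1 - s L * h2
  have h4 : s L = 0 := by
    rcases mul_eq_zero.1 h3 with h' | h'
    · exact absurd h' (mul_ne_zero (pow_ne_zero 2 (h.E_ne L)) (h.Lam_ne L hL))
    · exact h'
  rw [key n hn, h4]
  ring

section Vectors

variable {V : Type} [AddCommGroup V] [Module F V]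

/-- The identity between the reduced generators. -/
lemma Rows.reduced (h : x.Regular K) {r s : ℕ → ℕ → V} (hR : Rows x K r s) {q : ℕ → V}
    {v : V} {δ : F} (h0 : q 0 = 0)
    (hq : ∀ e < K, x.a e • (q (e + 1) - q e) + (x.ρ * x.κ e) • q e + x.κ e • (v - q (e + 1)) =
      (x.κ e * δ) • s e (e + 1)) {f : ℕ → F} (hf : ∀ c < K, f c * (1 + x.Lam K) = x.lam c)
    {c : ℕ} (hc : c < K) :
    q (c + 1) - q c + f c • (v - q K) =
      δ • ∑ a ∈ Finset.Ico c K, f a • (r a (c + 1) - r a c) := by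
  -- Over a field linear functionals separate vectors, and the whole system is linear; so the scalar
  -- case suffices.
  rw [← sub_eq_zero, ← Module.forall_dual_apply_eq_zero_iff F]
  intro φ
  have := h.reduced (hR.map φ) (q := fun n => φ (q n)) (v := φ v) (δ := δ)
    (by rw [h0, map_zero]) (fun e he => by
      have := congrArg φ (hq e he)
      simp only [map_add, map_sub, map_smul, smul_eq_mul] at this
      rw [this, mul_assoc]) hf hc
  simpa only [map_sub, map_add, map_smul, map_sum, smul_eq_mul, sub_eq_zero] using this

lemma Regular.eq_zero_of_lower (h : x.Regular K) {s : ℕ → V} {L : ℕ} (hL : L ≤ K)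
    (h0 : s 0 = 0) (hs : ∀ d < L, x.a d • (s (d + 1) - s d) + x.κ d • s d +
      (x.ρ * x.κ d) • (s L - s (d + 1)) = 0) {n : ℕ} (hn : n ≤ L) : s n = 0 := by
  rw [← Module.forall_dual_apply_eq_zero_iff F]
  intro φ
  refine h.lower_eq_zero (s := fun n => φ (s n)) hL (by rw [h0, map_zero]) (fun d hd => ?_) hn
  simpa only [map_add, map_sub, map_smul, map_zero, smul_eq_mul] using congrArg φ (hs d hd)

end Vectors

end ExchangeData

end LinearSystem
end OpenChain
end

open scoped TensorProduct LaurentSeries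
noncomputable section
namespace OpenChain

/-! ### The coefficients of the exchange relations at coinciding spectral parameters -/

section Exchange

lemma gr_eq_zero_or_one (m i : ℕ) : gr m i = 0 ∨ gr m i = 1 := by
  unfold gr; split_ifs <;> simp

lemma eq_of_one_add_neg_div {S : Type} [Field S] {a b : S} (hb : b ≠ 0) (h : 1 + -a / b = 0) :
    b = a := by
  rw [neg_div, ← sub_eq_add_neg, sub_eq_zero, eq_comm, div_eq_one_iff_eq hb] at h
  exact h.symm

namespace Model

variable {S : Type} [Field S] [Algebra ℂ S]

lemma sPow_add (s : ℂˣ) (e f : ℤ) : (sPow s (e + f) : S) = sPow s e * sPow s f := by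
  rw [sPow, sPow, sPow, zpow_add₀ s.ne_zero, map_mul]

lemma sPow_zero (s : ℂˣ) : (sPow s 0 : S) = 1 := by simp [sPow]

lemma sPow_neg (s : ℂˣ) (e : ℤ) : (sPow s (-e) : S) = (sPow s e)⁻¹ := by
  rw [sPow, sPow, zpow_neg, map_inv₀]

lemma sPow_ne_zero (s : ℂˣ) (e : ℤ) : (sPow s e : S) ≠ 0 := by
  rw [sPow, map_ne_zero]; exact zpow_ne_zero _ s.ne_zero

/-- The part of `𝔠_{ij}(w, ι(w))`, `i > j`, that does not depend on the indices. -/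
def γ : Model → S → S
  | yangian ħ, _ => -algebraMap ℂ S ħ
  | quantum s, w => (sPow s 2 - sPow s (-2)) * (w / w⁻¹)⁻¹

/-- The exchange data at the spectral parameters `w` and `ι(w)`. -/
def exchange (m : ℕ) (M : Model) (w : S) : ExchangeData S where
  κ l := (-1) ^ gr m (l + 1) * M.γ w
  p l := match M with
    | yangian _ => 1
    | quantum s => sPow s (2 * (1 - 2 * (gr m (l + 1) : ℤ)))
  b := M.b w (M.iota w)
  ρ := match M with
    | yangian _ => 1
    | quantum _ => (w / w⁻¹) ^ 2

variable (m : ℕ) (M : Model) {w : S}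

lemma c_of_lt {i j : ℕ} (h : j < i) :
    M.c m (i + 1) (j + 1) w (M.iota w) = (M.exchange m w).κ j := by
  have hs : Int.sign (((j + 1 : ℕ) : ℤ) - ((i + 1 : ℕ) : ℤ)) = -1 :=
    Int.sign_eq_neg_one_of_neg (by omega)
  cases M with
  | yangian ħ => simp [c, exchange, γ]
  | quantum s =>
    simp only [c, exchange, γ, iota, hs, zpow_neg_one]
    ring

lemma c_of_gt {i j : ℕ} (h : i < j) (hw : w ≠ 0) :
    M.c m (i + 1) (j + 1) w (M.iota w) = (M.exchange m w).ρ * (M.exchange m w).κ j := by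
  have hs : Int.sign (((j + 1 : ℕ) : ℤ) - ((i + 1 : ℕ) : ℤ)) = 1 :=
    Int.sign_eq_one_of_pos (by omega)
  cases M with
  | yangian ħ => simp [c, exchange, γ]
  | quantum s =>
    simp only [c, exchange, γ, iota, hs, zpow_one]
    field_simp

lemma a_eq_exchange (l : ℕ) : M.a m (l + 1) w (M.iota w) = (M.exchange m w).a l := by
  cases M with
  | yangian ħ => simp [a, b, exchange, ExchangeData.a, γ, iota]; ring
  | quantum s =>
    simp only [a, b, exchange, ExchangeData.a, γ, iota]
    rcases gr_eq_zero_or_one m (l + 1) with h | h <;> simp [h] <;> field_simp <;> ring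

lemma exchange_p_ne (l : ℕ) : (M.exchange m w).p l ≠ 0 := by
  cases M with
  | yangian ħ => simp [exchange]
  | quantum s => exact sPow_ne_zero _ _

/-- In the quantum case this is `p_l - p_l⁻¹ = (-1)^{[l]} (q - q⁻¹)` for `p_l = q^{1-2[l]}`. -/
lemma exchange_a_eq (hw : w ≠ 0) (l : ℕ) :
    (M.exchange m w).κ l + (M.exchange m w).p l * (M.exchange m w).b =
      (M.exchange m w).ρ * (M.exchange m w).κ l + (M.exchange m w).b / (M.exchange m w).p l := by
  cases M with
  | yangian ħ => simp [exchange]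
  | quantum s =>
    have hs := sPow_ne_zero (S := S) s 2
    simp only [exchange, γ, b, iota]
    rcases gr_eq_zero_or_one m (l + 1) with h | h
    · simp [h, sPow_neg]; field_simp; ring
    · simp [h, sPow_neg]; field_simp; ring

lemma shiftUpTo_yangian (ħ : ℂ) (n : ℕ) (u : S) : (yangian ħ).shiftUpTo m n u =
    u + algebraMap ℂ S (ħ / 2) * ∑ l ∈ Finset.range n, (-1) ^ gr m (l + 1) := by
  induction n with
  | zero => simp [shiftUpTo]
  | succ n ih => rw [shiftUpTo, shift, ih, Finset.sum_range_succ]; ring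

lemma add_shiftUpTo_yangian (ħ : ℂ) (n : ℕ) (u : S) :
    (yangian ħ).shiftUpTo m n u + (yangian ħ).shiftUpTo m n u =
      u + u + algebraMap ℂ S ħ * ∑ l ∈ Finset.range n, (-1) ^ gr m (l + 1) := by
  have h : algebraMap ℂ S ħ = algebraMap ℂ S (ħ / 2) + algebraMap ℂ S (ħ / 2) := by
    rw [← map_add, add_halves]
  rw [shiftUpTo_yangian, h]
  ring

lemma exchange_E_yangian (ħ : ℂ) (n : ℕ) : ((yangian ħ).exchange m w).E n = 1 := by
  simp [ExchangeData.E, exchange]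

lemma exchange_Lam_yangian (ħ : ℂ) (n : ℕ) : ((yangian ħ).exchange m w).Lam n =
    -(algebraMap ℂ S ħ * ∑ l ∈ Finset.range n, (-1) ^ gr m (l + 1)) / (w + w) := by
  simp only [ExchangeData.Lam, ExchangeData.lam, exchange_E_yangian]
  rw [Finset.mul_sum, ← Finset.sum_neg_distrib, Finset.sum_div]
  refine Finset.sum_congr rfl fun l _ => ?_
  simp only [exchange, γ, b, iota]
  ring

lemma exchange_E_quantum (s : ℂˣ) (n : ℕ) : ((quantum s).exchange m w).E n =
    sPow s (∑ l ∈ Finset.range n, 2 * (1 - 2 * (gr m (l + 1) : ℤ))) := by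
  induction n with
  | zero => simp [ExchangeData.E, sPow_zero]
  | succ n ih => rw [ExchangeData.E_succ, ih, Finset.sum_range_succ, sPow_add]; rfl

lemma shiftUpTo_quantum (s : ℂˣ) (n : ℕ) (u : S) : (quantum s).shiftUpTo m n u =
    u * sPow s (∑ l ∈ Finset.range n, (-1 + 2 * (gr m (l + 1) : ℤ))) := by
  induction n with
  | zero => simp [shiftUpTo, sPow_zero]
  | succ n ih =>
    rw [shiftUpTo, shift, ih, Finset.sum_range_succ, sPow_add _ (∑ l ∈ _, _), mul_assoc]

lemma sq_shiftUpTo_quantum (s : ℂˣ) (n : ℕ) (u : S) : (quantum s).shiftUpTo m n u ^ 2 *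
    sPow s (∑ l ∈ Finset.range n, 2 * (1 - 2 * (gr m (l + 1) : ℤ))) = u ^ 2 := by
  have h : (∑ l ∈ Finset.range n, (-1 + 2 * (gr m (l + 1) : ℤ))) +
      ((∑ l ∈ Finset.range n, (-1 + 2 * (gr m (l + 1) : ℤ))) +
        ∑ l ∈ Finset.range n, 2 * (1 - 2 * (gr m (l + 1) : ℤ))) = 0 := by
    rw [← Finset.sum_add_distrib, ← Finset.sum_add_distrib]
    exact Finset.sum_eq_zero fun _ _ => by ring
  rw [shiftUpTo_quantum, mul_pow, mul_assoc, sq (sPow s _), mul_assoc, ← sPow_add, ← sPow_add, h,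
    sPow_zero, mul_one]

/-- The power of `q` in the reduced generators is the product of the `p_l²` over the indices
strictly after `c` and below `K`. -/
lemma qFactor_quantum (s : ℂˣ) {K c : ℕ} (hc : c < K) :
    (quantum s).qFactor m (K + 1) (c + 1) * ((quantum s).exchange m w).E (c + 1) ^ 2 =
      ((quantum s).exchange m w).E K ^ 2 := by
  simp only [exchange_E_quantum, qFactor, sq, ← sPow_add]
  congr 1
  induction K, hc using Nat.le_induction with
  | base => simp
  | succ K hK ih =>
    rw [Finset.sum_Ico_succ_top (by omega), Finset.sum_range_succ _ K]
    push_cast at ih ⊢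
    linear_combination ih

section Parameter

variable {M}

lemma u₀_yangian (ħ : ℂ) : (yangian ħ).u₀ = HahnSeries.single (-1) 1 := by
  have := single_zpow 1 one_ne_zero (-1)
  rw [zpow_neg_one, one_zpow] at this
  exact this

lemma linear_ne_zero (ħ c : ℂ) :
    (yangian ħ).u₀ + (yangian ħ).u₀ + algebraMap ℂ (LaurentSeries ℂ) c ≠ 0 := by
  intro h
  have := congrArg (fun f : LaurentSeries ℂ => f.coeff (-1)) h
  rw [u₀_yangian, algebraMap_laurent] at this
  simp [HahnSeries.C_apply] at this

lemma quartic_ne (s : ℂˣ) (c d : ℂ) (hd : d ≠ 0) :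
    (quantum s).u₀ ^ 4 * algebraMap ℂ (LaurentSeries ℂ) c ≠ algebraMap ℂ (LaurentSeries ℂ) d := by
  intro h
  have h4 := single_zpow 1 one_ne_zero 4
  rw [one_zpow] at h4
  have h5 : (quantum s).u₀ ^ 4 = HahnSeries.single 4 1 := by
    rw [← h4]; rfl
  have := congrArg (fun f : LaurentSeries ℂ => f.coeff 0) h
  rw [h5, algebraMap_laurent, algebraMap_laurent, HahnSeries.C_apply, HahnSeries.C_apply,
    HahnSeries.single_mul_single] at this
  simp at this
  exact hd this.symm

/-- Shifts keep the local parameter of order one: `u + d` still has a simple pole in `x`, and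
rescaling by a nonzero constant is harmless. Hence evaluation at a shifted parameter is a ring
homomorphism. -/
lemma order_loc_shiftUpTo (M : Model) (m n : ℕ) : (M.loc (M.shiftUpTo m n M.u₀)).order = 1 := by
  cases M with
  | yangian ħ =>
    have h1 : ∃ d : ℂ, (yangian ħ).shiftUpTo m n (yangian ħ).u₀ =
        HahnSeries.single (-1) 1 + HahnSeries.C d := by
      refine ⟨ħ / 2 * ∑ l ∈ Finset.range n, (-1) ^ gr m (l + 1), ?_⟩
      rw [shiftUpTo_yangian, u₀_yangian, ← algebraMap_laurent]
      simp only [map_mul, map_sum, map_pow, map_neg, map_one]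
    obtain ⟨d, hd⟩ := h1
    have h2 : ((yangian ħ).shiftUpTo m n (yangian ħ).u₀).order = -1 := by
      rw [hd]
      have h3 : ((HahnSeries.single (-1) 1 : LaurentSeries ℂ) + HahnSeries.C d).coeff (-1) ≠ 0 := by
        simp [HahnSeries.C_apply]
      refine le_antisymm (HahnSeries.order_le_of_coeff_ne_zero h3) ?_
      have h4 := HahnSeries.min_order_le_order_add
        (x := (HahnSeries.single (-1) 1 : LaurentSeries ℂ)) (y := HahnSeries.C d)
        (fun h0 => h3 (by rw [h0]; rfl))
      rwa [HahnSeries.order_single one_ne_zero, HahnSeries.order_C, min_eq_left (by norm_num)]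
        at h4
    have h0 : (yangian ħ).shiftUpTo m n (yangian ħ).u₀ ≠ 0 := by
      intro h0
      rw [h0, HahnSeries.order_zero] at h2
      norm_num at h2
    have h5 := HahnSeries.order_mul h0 (inv_ne_zero h0)
    rw [mul_inv_cancel₀ h0, HahnSeries.order_one, h2] at h5
    rw [loc]
    omega
  | quantum s =>
    rw [loc, shiftUpTo_quantum, mul_comm, sPow, algebraMap_laurent]
    exact order_C_mul (zpow_ne_zero _ s.ne_zero) (order_single_one one_ne_zero)

lemma shiftUpTo_ne_zero (M : Model) (m n : ℕ) : M.shiftUpTo m n M.u₀ ≠ 0 := by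
  intro h
  have h1 := order_loc_shiftUpTo M m n
  rw [h] at h1
  cases M <;> simp [loc] at h1

/-- Since `w² E_K = u²`, equality would make `u⁴` a constant. -/
lemma quantum_quartic_ne (s : ℂˣ) (m K n : ℕ) :
    ((quantum s).exchange m ((quantum s).shiftUpTo m K (quantum s).u₀)).ρ *
      ((quantum s).exchange m ((quantum s).shiftUpTo m K (quantum s).u₀)).E n ^ 2 ≠ 1 := by
  intro h
  have h1 := sq_shiftUpTo_quantum m s K (quantum s).u₀
  have h0 := shiftUpTo_ne_zero (quantum s) m K
  rw [exchange_E_quantum] at h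
  simp only [exchange] at h
  set w := (quantum s).shiftUpTo m K (quantum s).u₀
  have h2 : w / w⁻¹ = w ^ 2 := by field_simp
  rw [h2] at h
  refine quartic_ne s (((s : ℂ) ^ (∑ l ∈ Finset.range n, 2 * (1 - 2 * (gr m (l + 1) : ℤ)))) ^ 2)
    (((s : ℂ) ^ (∑ l ∈ Finset.range K, 2 * (1 - 2 * (gr m (l + 1) : ℤ)))) ^ 2) ?_ ?_
  · exact pow_ne_zero 2 (zpow_ne_zero _ s.ne_zero)
  · rw [map_pow, map_pow]
    change _ * sPow s _ ^ 2 = sPow s _ ^ 2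
    rw [show (quantum s).u₀ ^ 4 = ((quantum s).u₀ ^ 2) ^ 2 by ring, ← h1]
    linear_combination (sPow s (∑ l ∈ Finset.range K, 2 * (1 - 2 * (gr m (l + 1) : ℤ)))) ^ 2 * h

/-- Nondegeneracy is generic in `u`. For the Yangian `1 + Lam n` is a quotient whose numerator has
the form `2u + const`; for the quantum case `(ρ - 1) E_n² (1 + Lam n) = ρ E_n² - 1`. No condition on
`ħ` or `q` is needed, because `u` is an indeterminate. -/
lemma exchange_regular (M : Model) (m K n : ℕ) :
    (M.exchange m (M.shiftUpTo m K M.u₀)).Regular n := by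
  have h0 := shiftUpTo_ne_zero M m K
  have hb : M.b (M.shiftUpTo m K M.u₀) (M.iota (M.shiftUpTo m K M.u₀)) ≠ 0 := by
    cases M with
    | yangian ħ =>
      intro h
      refine linear_ne_zero ħ (ħ * ∑ l ∈ Finset.range K, (-1) ^ gr m (l + 1)) ?_
      rw [← h, b, iota, sub_neg_eq_add, add_shiftUpTo_yangian]
      simp only [map_mul, map_sum, map_pow, map_neg, map_one]
    | quantum s =>
      intro h
      refine quantum_quartic_ne s m K 0 ?_
      set w := (quantum s).shiftUpTo m K (quantum s).u₀
      simp only [b, iota] at h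
      simp only [exchange, ExchangeData.E, Finset.range_zero, Finset.prod_empty]
      field_simp at h ⊢
      linear_combination h
  -- Regularity up to index `0` is immediate from `Lam 0 = 0`, and already makes `Lam_eq` available
  -- for every `n`.
  have hR : (M.exchange m (M.shiftUpTo m K M.u₀)).Regular 0 :=
    ⟨hb, exchange_p_ne m M, exchange_a_eq m M h0, fun n hn => by
      rw [Nat.le_zero.1 hn]; simp [ExchangeData.Lam]⟩
  refine ⟨hb, exchange_p_ne m M, exchange_a_eq m M h0, fun n _ h => ?_⟩
  cases M with
  | yangian ħ =>
    rw [exchange_Lam_yangian] at h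
    simp only [b, iota, sub_neg_eq_add] at hb
    have h := eq_of_one_add_neg_div hb h
    rw [add_shiftUpTo_yangian] at h
    refine linear_ne_zero ħ (ħ * (∑ l ∈ Finset.range K, (-1) ^ gr m (l + 1) -
      ∑ l ∈ Finset.range n, (-1) ^ gr m (l + 1))) ?_
    simp only [map_mul, map_sub, map_sum, map_pow, map_neg, map_one]
    linear_combination h
  | quantum s =>
    refine quantum_quartic_ne s m K n ?_
    have h1 := hR.Lam_eq n
    linear_combination ((((quantum s).exchange m _).ρ - 1) *
      ((quantum s).exchange m _).E n ^ 2) * h - h1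

/-- The shift is chosen so that the powers of `q` in the denominator of `ψ` cancel: `𝔞` at
`u^{(c+1)}` becomes `u² - u⁻²`, whatever the index. -/
lemma psi_quantum {S : Type} [Field S] [Algebra ℂ S] (m : ℕ) (s : ℂˣ) (c : ℕ) {u : S}
    (hu : u ≠ 0) (hu4 : u ^ 4 - 1 ≠ 0) :
    (quantum s).psi m (c + 1) ((quantum s).shift m (c + 1) u) * (u ^ 4 - 1) =
      (-1) ^ gr m (c + 1) * (sPow s 2 - sPow s (-2)) *
        sPow s (2 * (1 - 2 * (gr m (c + 1) : ℤ))) := by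
  have hs : Int.sign (((c + 1 : ℕ) : ℤ) - ((c + 1 + 1 : ℕ) : ℤ)) = -1 :=
    Int.sign_eq_neg_one_of_neg (by omega)
  have h1 : (sPow s (2 * (2 * (gr m (c + 1) : ℤ) - 1)) : S) =
      (sPow s (2 * (1 - 2 * (gr m (c + 1) : ℤ))))⁻¹ := by
    rw [← sPow_neg]; congr 1; ring
  have h2 : (sPow s (-1 + 2 * (gr m (c + 1) : ℤ)) : S) ^ 2 =
      (sPow s (2 * (1 - 2 * (gr m (c + 1) : ℤ))))⁻¹ := by
    rw [← sPow_neg, sq, ← sPow_add]; congr 1; ring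
  have h3 := sPow_ne_zero (S := S) s (-1 + 2 * (gr m (c + 1) : ℤ))
  have h4 := sPow_ne_zero (S := S) s (2 * (1 - 2 * (gr m (c + 1) : ℤ)))
  simp only [psi, Model.c, Model.a, shift, iota, hs, zpow_neg_one, h1]
  generalize (sPow s (2 * (1 - 2 * (gr m (c + 1) : ℤ))) : S) = P at *
  generalize (sPow s (-1 + 2 * (gr m (c + 1) : ℤ)) : S) = T at *
  have e1 : u * T / (u * T)⁻¹ = u ^ 2 * P⁻¹ := by
    rw [← h2]; field_simp
  have e2 : (u * T)⁻¹ / (u * T) = (u ^ 2 * P⁻¹)⁻¹ := by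
    rw [← h2]; field_simp
  have e3 : u ^ 2 * P⁻¹ * P - (u ^ 2 * P⁻¹)⁻¹ * P⁻¹ = (u ^ 4 - 1) / u ^ 2 := by
    field_simp
  rw [e1, e2, e3]
  field_simp

lemma coefficient_mul_aux {S : Type} [Field S] {qF ψ L E EK P b κ w u q l : S} (hw : w ≠ 0)
    (hu4 : u ^ 4 - 1 ≠ 0) (hE : E ≠ 0) (hP : P ≠ 0) (hb : b ≠ 0) (hψ : ψ * (u ^ 4 - 1) = q * P)
    (hL : (w ^ 4 - 1) * L * EK ^ 2 = EK ^ 2 - 1) (hq : qF * (E * P) ^ 2 = EK ^ 2)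
    (hwu : w ^ 2 * EK = u ^ 2) (hbw : b * w ^ 2 = w ^ 4 - 1) (hκ : κ * w ^ 2 = q)
    (hl : l * (b * E ^ 2 * P) = κ) : qF * ψ * (1 + L) = l := by
  have h1 : b * E ^ 2 * P ≠ 0 := mul_ne_zero (mul_ne_zero hb (pow_ne_zero 2 hE)) hP
  have h2 : P * w ^ 2 * (u ^ 4 - 1) ≠ 0 := mul_ne_zero (mul_ne_zero hP (pow_ne_zero 2 hw)) hu4
  -- The normalization `1 + Lam K` converts the denominator at the shifted parameter `w` into the
  -- one at `u` that occurs in `ψ`.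
  have h3 : EK ^ 2 * (1 + L) * (w ^ 4 - 1) = u ^ 4 - 1 := by
    linear_combination hL + (w ^ 2 * EK + u ^ 2) * hwu
  apply mul_right_cancel₀ h1
  apply mul_right_cancel₀ h2
  rw [hl]
  calc qF * ψ * (1 + L) * (b * E ^ 2 * P) * (P * w ^ 2 * (u ^ 4 - 1))
      = qF * (E * P) ^ 2 * (1 + L) * (b * w ^ 2) * (ψ * (u ^ 4 - 1)) := by ring
    _ = u ^ 4 * (q * P) - q * P := by rw [hq, hbw, h3, hψ]; ring
    _ = κ * (P * w ^ 2 * (u ^ 4 - 1)) := by rw [← hκ]; ring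

/-- The coefficients of the reduced generators. -/
lemma coefficient_mul (M : Model) (m : ℕ) {K c : ℕ} (hc : c < K) :
    (M.qFactor m (K + 1) (c + 1) * M.psi m (c + 1) (M.shift m (c + 1) M.u₀)) *
      (1 + (M.exchange m (M.shiftUpTo m K M.u₀)).Lam K) =
      (M.exchange m (M.shiftUpTo m K M.u₀)).lam c := by
  have hR := exchange_regular M m K 0
  cases M with
  | yangian ħ =>
    have hb := hR.b_ne
    have hu := linear_ne_zero ħ 0
    have hw := add_shiftUpTo_yangian m ħ K (yangian ħ).u₀
    have hh : algebraMap ℂ (LaurentSeries ℂ) ħ =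
        algebraMap ℂ (LaurentSeries ℂ) (ħ / 2) + algebraMap ℂ (LaurentSeries ℂ) (ħ / 2) := by
      rw [← map_add, add_halves]
    rw [exchange_Lam_yangian, ExchangeData.lam, exchange_E_yangian, exchange_E_yangian]
    simp only [exchange, γ, b, iota, sub_neg_eq_add, qFactor, psi, Model.c, Model.a,
      shift] at hb ⊢
    rw [map_zero, add_zero] at hu
    generalize (yangian ħ).shiftUpTo m K (yangian ħ).u₀ = w at *
    generalize (yangian ħ).u₀ = u at *
    generalize (∑ l ∈ Finset.range K, ((-1) ^ gr m (l + 1) : LaurentSeries ℂ)) = σ at *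
    have e1 : u + algebraMap ℂ (LaurentSeries ℂ) (ħ / 2) * (-1) ^ gr m (c + 1) +
        (u + algebraMap ℂ (LaurentSeries ℂ) (ħ / 2) * (-1) ^ gr m (c + 1)) -
        (-1) ^ gr m (c + 1) * algebraMap ℂ (LaurentSeries ℂ) ħ = u + u := by
      rw [hh]; ring
    -- The total shift `ħ σ` of `2w` relative to `2u` cancels against `Lam K`.
    have e2 : 1 + -(algebraMap ℂ (LaurentSeries ℂ) ħ * σ) / (w + w) = (u + u) / (w + w) := by
      rw [eq_div_iff hb, add_mul, div_mul_cancel₀ _ hb, one_mul, hw]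
      ring
    rw [e1, e2, one_mul, mul_one, mul_one, div_mul_div_cancel₀ hu]
    ring
  | quantum s =>
    have hb := hR.b_ne
    have h1 := hR.Lam_eq K
    have h2 := qFactor_quantum (S := LaurentSeries ℂ) m
      (w := (quantum s).shiftUpTo m K (quantum s).u₀) s hc
    have h3 := sq_shiftUpTo_quantum m s K (quantum s).u₀
    rw [← exchange_E_quantum m (w := (quantum s).shiftUpTo m K (quantum s).u₀)] at h3
    have h4 := hR.E_ne c
    have h5 := hR.p_ne c
    have h6 := hR.lam_mul c
    have h0 := shiftUpTo_ne_zero (quantum s) m K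
    have hu : (quantum s).u₀ ≠ 0 := HahnSeries.single_ne_zero one_ne_zero
    have hu4 : (quantum s).u₀ ^ 4 - 1 ≠ 0 := fun h => quartic_ne s 1 1 one_ne_zero (by
      rw [map_one, mul_one]; exact sub_eq_zero.1 h)
    have hψ := psi_quantum m s c hu hu4
    rw [ExchangeData.E_succ] at h2
    have e1 : ((quantum s).exchange m ((quantum s).shiftUpTo m K (quantum s).u₀)).ρ =
        ((quantum s).shiftUpTo m K (quantum s).u₀) ^ 4 := by
      simp only [exchange]; field_simp
    have e2 : ((quantum s).exchange m ((quantum s).shiftUpTo m K (quantum s).u₀)).b *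
        (quantum s).shiftUpTo m K (quantum s).u₀ ^ 2 =
          (quantum s).shiftUpTo m K (quantum s).u₀ ^ 4 - 1 := by
      simp only [exchange, b, iota]; field_simp
    have e3 : ((quantum s).exchange m ((quantum s).shiftUpTo m K (quantum s).u₀)).κ c *
        (quantum s).shiftUpTo m K (quantum s).u₀ ^ 2 =
          (-1) ^ gr m (c + 1) * (sPow s 2 - sPow s (-2)) := by
      simp only [exchange, γ]; field_simp
    have e4 : ((quantum s).exchange m ((quantum s).shiftUpTo m K (quantum s).u₀)).p c =
        sPow s (2 * (1 - 2 * (gr m (c + 1) : ℤ))) := rfl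
    rw [e1] at h1
    rw [← e4] at hψ
    refine coefficient_mul_aux h0 hu4 h4 h5 hb hψ h1 h2 h3 e2 e3 h6

end Parameter

end Model

end Exchange
end OpenChain
end

open scoped TensorProduct LaurentSeries
noncomputable section
namespace OpenChain

/-! ### Consequences of the exchange relations -/

section Relations

variable {F V : Type} [Field F] [AddCommGroup V] [Module F V]

/-- Vectors `xy i a b j` and `yx b j i a` (the classes of `t_{ia} t'_{bj}` and `t'_{bj} t_{ia}`)
subject to the exchange relations, with structure constants `w` and grades `ε`, and to the
vanishing relations that define the coset. -/
structure Exchange (x : ExchangeData F) (N K : ℕ) (ε : ℕ → ℕ) (w : ℕ → ℕ → F)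
    (xy yx : ℕ → ℕ → ℕ → ℕ → V) : Prop where
  rel : ∀ i < N, ∀ a < N, ∀ b < N, ∀ j < N,
    x.b • ((-1 : F) ^ ((ε i + ε a) * (ε b + ε j)) • xy i a b j) +
      (if a = b then ∑ c ∈ Finset.range N,
        w c a • ((-1 : F) ^ ((ε i + ε c) * (ε c + ε j)) • xy i c c j) else 0) =
    x.b • yx b j i a + if i = j then ∑ d ∈ Finset.range N,
        w i d • ((-1 : F) ^ ((ε i + ε d) * (ε b + ε a)) • yx b d d a) else 0
  xy_zero : ∀ i a b j, j < b → j < K → xy i a b j = 0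
  yx_zero : ∀ b j i a, a < i → a < K → yx b j i a = 0
  w_self : ∀ c, w c c = x.a c - x.b
  w_lt : ∀ i j, j < i → w i j = x.κ j
  w_gt : ∀ i j, i < j → w i j = x.ρ * x.κ j
  κ_sign : ∀ c d, x.κ d = (-1) ^ (ε c + ε d) * x.κ c

lemma sign_smul_sign (e : ℕ) (v : V) : (-1 : F) ^ e • ((-1 : F) ^ e • v) = v := by
  rw [smul_smul, ← pow_add, neg_one_pow_congr (f := 0) (by omega), pow_zero, one_smul]

lemma sum_range_split {N c : ℕ} (hc : c < N) (f : ℕ → V) :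
    ∑ d ∈ Finset.range N, f d =
      ∑ d ∈ Finset.range c, f d + f c + ∑ d ∈ Finset.Ico (c + 1) N, f d := by
  rw [← Finset.sum_range_succ, Finset.sum_range_add_sum_Ico f hc]

lemma sum_Ico_eq_sub' {N c : ℕ} (hc : c < N) (f : ℕ → V) :
    ∑ d ∈ Finset.Ico (c + 1) N, f d =
      ∑ d ∈ Finset.range N, f d - ∑ d ∈ Finset.range (c + 1), f d :=
  Finset.sum_Ico_eq_sub f hc

/-- Sums are not affected by terms that vanish. -/
lemma sum_range_eq_of_zero {N c : ℕ} (hc : c ≤ N) {f : ℕ → V} (h : ∀ d, c ≤ d → f d = 0) :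
    ∑ d ∈ Finset.range N, f d = ∑ d ∈ Finset.range c, f d := by
  rw [← Finset.sum_range_add_sum_Ico f hc,
    Finset.sum_eq_zero (s := Finset.Ico c N) fun d hd => h d (Finset.mem_Ico.1 hd).1, add_zero]

namespace Exchange

variable {x : ExchangeData F} {N K : ℕ} {ε : ℕ → ℕ} {w : ℕ → ℕ → F}
  {xy yx : ℕ → ℕ → ℕ → ℕ → V}

/-- In a column `w d c` depends on `d` only through the comparison with `c`, so the weighted sum is
a combination of three partial sums. -/
lemma sum_column (h : Exchange x N K ε w xy yx) {c : ℕ} (hc : c < N) (f : ℕ → V) :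
    x.b • f c + ∑ d ∈ Finset.range N, w d c • f d =
      x.a c • f c + (x.ρ * x.κ c) • ∑ d ∈ Finset.range c, f d +
        x.κ c • (∑ d ∈ Finset.range N, f d - ∑ d ∈ Finset.range (c + 1), f d) := by
  rw [← sum_Ico_eq_sub' hc, sum_range_split hc fun d => w d c • f d, h.w_self, sub_smul,
    Finset.smul_sum, Finset.smul_sum]
  rw [Finset.sum_congr rfl fun d hd => by rw [h.w_gt d c (Finset.mem_range.1 hd)],
    Finset.sum_congr (s₁ := Finset.Ico (c + 1) N) rfl fun d hd => by
      rw [h.w_lt d c (Finset.mem_Ico.1 hd).1]]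
  abel

/-- In a row `κ_d` varies with `d` by the sign `(-1)^{ε c + ε d}` only; the signs put on `f` absorb
it. -/
lemma sum_row (h : Exchange x N K ε w xy yx) {c : ℕ} (hc : c < N) (f : ℕ → V) :
    x.b • ((-1 : F) ^ ε c • f c) + ∑ d ∈ Finset.range N, w c d • ((-1 : F) ^ ε d • f d) =
      (-1 : F) ^ ε c • (x.a c • f c + x.κ c • ∑ d ∈ Finset.range c, f d +
        (x.ρ * x.κ c) • (∑ d ∈ Finset.range N, f d - ∑ d ∈ Finset.range (c + 1), f d)) := by
  have key : ∀ d, x.κ d * (-1) ^ ε d = (-1) ^ ε c * x.κ c := by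
    intro d
    rw [h.κ_sign c d, pow_add]
    have : ((-1 : F) ^ ε d) * (-1) ^ ε d = 1 := by
      rw [← pow_add, neg_one_pow_congr (f := 0) (by omega), pow_zero]
    linear_combination (-1) ^ ε c * x.κ c * this
  rw [← sum_Ico_eq_sub' hc, sum_range_split hc fun d => w c d • ((-1 : F) ^ ε d • f d), h.w_self,
    smul_add, smul_add, Finset.smul_sum, Finset.smul_sum, Finset.smul_sum, Finset.smul_sum]
  have e1 : ∀ d ∈ Finset.range c, w c d • ((-1 : F) ^ ε d • f d) =
      (-1 : F) ^ ε c • (x.κ c • f d) := fun d hd => by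
    rw [h.w_lt c d (Finset.mem_range.1 hd), smul_smul, key, smul_smul]
  have e2 : ∀ d ∈ Finset.Ico (c + 1) N, w c d • ((-1 : F) ^ ε d • f d) =
      (-1 : F) ^ ε c • ((x.ρ * x.κ c) • f d) := fun d hd => by
    rw [h.w_gt c d (Finset.mem_Ico.1 hd).1, smul_smul, mul_assoc, key, smul_smul]
    congr 1; ring
  rw [Finset.sum_congr rfl e1, Finset.sum_congr rfl e2]
  module

/-- The class of `(-1)^{([i]+[a])([a]+[j])} t_{ia} t'_{aj}`. -/
def tau (F : Type) [Field F] [Module F V] (ε : ℕ → ℕ) (xy : ℕ → ℕ → ℕ → ℕ → V) (i j a : ℕ) : V :=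
  (-1 : F) ^ ((ε i + ε a) * (ε a + ε j)) • xy i a a j

/-- The class of `(-1)^{[c]+[d]} t'_{cd} t_{dc}`. -/
def zeta (F : Type) [Field F] [Module F V] (ε : ℕ → ℕ) (yx : ℕ → ℕ → ℕ → ℕ → V) (c d : ℕ) : V :=
  (-1 : F) ^ (ε c + ε d) • yx c d d c

lemma tau_eq_zero (h : Exchange x N K ε w xy yx) {i j a : ℕ} (h1 : j < a) (h2 : j < K) :
    tau F ε xy i j a = 0 := by rw [tau, h.xy_zero i a a j h1 h2, smul_zero]

lemma zeta_eq_zero (h : Exchange x N K ε w xy yx) {c d : ℕ} (h1 : c < d) (h2 : c < K) :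
    zeta F ε yx c d = 0 := by rw [zeta, h.yx_zero c d d c h1 h2, smul_zero]

/-- The exchange relation with both inner indices equal to `e`; the signs on the right disappear
because their exponents contain `ε e + ε e`. -/
lemma column_eq (h : Exchange x N K ε w xy yx) {i j e : ℕ} (hi : i < N) (hj : j < N)
    (he : e < N) :
    x.a e • tau F ε xy i j e + (x.ρ * x.κ e) • ∑ d ∈ Finset.range e, tau F ε xy i j d +
        x.κ e • (∑ d ∈ Finset.range N, tau F ε xy i j d -
          ∑ d ∈ Finset.range (e + 1), tau F ε xy i j d) =
      x.b • yx e j i e +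
        if i = j then ∑ d ∈ Finset.range N, w i d • yx e d d e else 0 := by
  have h1 := h.rel i hi e he e he j hj
  rw [if_pos rfl] at h1
  have h2 : ∀ d, (-1 : F) ^ ((ε i + ε d) * (ε e + ε e)) = 1 := fun d => by
    rw [neg_one_pow_congr (f := 0), pow_zero]
    rw [← two_mul, mul_left_comm, Nat.mul_mod_right]
  simp only [h2, one_smul] at h1
  rw [← h1, ← h.sum_column he]
  rfl

lemma row_eq (h : Exchange x N K ε w xy yx) {i e : ℕ} (hi : i < N) :
    x.b • yx e i i e + ∑ d ∈ Finset.range N, w i d • yx e d d e =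
      (-1 : F) ^ (ε i + ε e) • (x.a i • zeta F ε yx e i +
        x.κ i • ∑ d ∈ Finset.range i, zeta F ε yx e d +
        (x.ρ * x.κ i) • (∑ d ∈ Finset.range N, zeta F ε yx e d -
          ∑ d ∈ Finset.range (i + 1), zeta F ε yx e d)) := by
  have h1 := h.sum_row hi fun d => (-1 : F) ^ ε e • zeta F ε yx e d
  have h2 : ∀ d, (-1 : F) ^ ε d • ((-1 : F) ^ ε e • zeta F ε yx e d) = yx e d d e := fun d => by
    rw [zeta, pow_add, mul_smul, sign_smul_sign, sign_smul_sign]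
  simp only [h2, ← Finset.smul_sum] at h1
  rw [h1, pow_add]
  module

/-- For `e < i` the vanishing relations remove the `𝔟`-term, and for `i = j` leave only `d ≤ e`,
where all coefficients are of the same type. Up to `δ_{ij}` the right side does not depend on `i`
and `j`, so row `i` satisfies the same upper system as the rows below `K`. -/
lemma column_of_lt (h : Exchange x N K ε w xy yx) {i j e : ℕ} (hi : i < N) (hj : j < N)
    (hei : e < i) (he : e < K) :
    x.a e • tau F ε xy i j e + (x.ρ * x.κ e) • ∑ d ∈ Finset.range e, tau F ε xy i j d +
        x.κ e • (∑ d ∈ Finset.range N, tau F ε xy i j d -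
          ∑ d ∈ Finset.range (e + 1), tau F ε xy i j d) =
      (x.κ e * if i = j then 1 else 0) • ∑ d ∈ Finset.range (e + 1), zeta F ε yx e d := by
  rw [h.column_eq hi hj (hei.trans hi), h.yx_zero e j i e hei he, smul_zero, zero_add]
  by_cases hij : i = j
  · have hz : ∀ d, e + 1 ≤ d → zeta F ε yx e d = 0 := fun d hd => h.zeta_eq_zero hd he
    have h1 := h.row_eq (e := e) hi
    rw [h.yx_zero e i i e hei he, smul_zero, zero_add, hz i hei,
      sum_range_eq_of_zero (show e + 1 ≤ N by omega) hz,
      sum_range_eq_of_zero (show e + 1 ≤ i by omega) hz,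
      sum_range_eq_of_zero (show e + 1 ≤ i + 1 by omega) hz, sub_self, smul_zero, smul_zero,
      zero_add, add_zero, smul_smul] at h1
    rw [if_pos hij, if_pos hij, h1, mul_one, h.κ_sign i e]
  · rw [if_neg hij, if_neg hij, mul_zero, zero_smul]

/-- The products of entries of the monodromy matrices solve the linear system. -/
lemma rows (h : Exchange x N K ε w xy yx) (hK : K ≤ N) :
    x.Rows K (fun c n => ∑ d ∈ Finset.range n, tau F ε xy c c d)
      fun c n => ∑ d ∈ Finset.range n, zeta F ε yx c d where
  r_zero _ _ := Finset.sum_range_zero _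
  s_zero _ _ := Finset.sum_range_zero _
  diag c hc := by
    have h1 := h.column_eq (i := c) (j := c) (e := c) (by omega) (by omega) (by omega)
    rw [if_pos rfl, h.row_eq (by omega), neg_one_pow_congr (f := 0) (by omega), pow_zero, one_smul,
      sum_range_eq_of_zero (show c + 1 ≤ N by omega) fun d hd => h.zeta_eq_zero hd hc,
      sum_range_eq_of_zero (show c + 1 ≤ N by omega) fun d hd => h.tau_eq_zero hd hc,
      sub_self, sub_self, smul_zero, smul_zero, add_zero, add_zero] at h1
    simpa only [Finset.sum_range_succ_sub_sum] using h1
  low c hc d hd := by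
    have h1 := h.column_eq (i := d) (j := d) (e := c) (by omega) (by omega) (by omega)
    have hz : ∀ e, d + 1 ≤ e → tau F ε xy d d e = 0 := fun e he =>
      h.tau_eq_zero he (by omega)
    rw [if_pos rfl, h.row_eq (by omega), hz c hd,
      sum_range_eq_of_zero (show c + 1 ≤ N by omega) fun d hd => h.zeta_eq_zero hd hc,
      sum_range_eq_of_zero (show d + 1 ≤ N by omega) hz,
      sum_range_eq_of_zero (show d + 1 ≤ c by omega) hz,
      sum_range_eq_of_zero (show d + 1 ≤ c + 1 by omega) hz,
      sub_self, smul_zero, smul_zero, add_zero, zero_add, h.κ_sign d c] at h1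
    have h2 := congrArg (fun v => (-1 : F) ^ (ε d + ε c) • v) h1
    simp only [sign_smul_sign] at h2
    rw [mul_left_comm, mul_smul, sign_smul_sign] at h2
    simpa only [Finset.sum_range_succ_sub_sum] using h2
  up c hc e he := by
    have h1 := h.column_of_lt (i := c) (j := c) (e := e) (by omega) (by omega) he (by omega)
    rw [if_pos rfl, mul_one,
      sum_range_eq_of_zero (show c + 1 ≤ N by omega) fun d hd => h.tau_eq_zero hd hc] at h1
    simpa only [Finset.sum_range_succ_sub_sum] using h1

/-- The identity behind the coproduct of the reduced generators. -/
lemma reduced (h : Exchange x N K ε w xy yx) (hx : x.Regular K) (hK : K ≤ N) {i j : ℕ}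
    (hi : i < N) (hj : j < N) (hKi : K ≤ i) {f : ℕ → F}
    (hf : ∀ c < K, f c * (1 + x.Lam K) = x.lam c) {c : ℕ} (hc : c < K) :
    tau F ε xy i j c + f c • ∑ a ∈ Finset.Ico K N, tau F ε xy i j a =
      (if i = j then 1 else 0 : F) • ∑ a ∈ Finset.range K, f a • tau F ε xy a a c := by
  have h1 := (h.rows hK).reduced hx (q := fun n => ∑ d ∈ Finset.range n, tau F ε xy i j d)
    (v := ∑ d ∈ Finset.range N, tau F ε xy i j d) (δ := if i = j then 1 else 0)
    (Finset.sum_range_zero _) (fun e he => by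
      have h1 := h.column_of_lt hi hj (by omega) he
      simpa only [Finset.sum_range_succ_sub_sum] using h1) hf hc
  simp only [Finset.sum_range_succ_sub_sum, ← Finset.sum_Ico_eq_sub _ hK] at h1
  rw [h1, ← Finset.sum_range_add_sum_Ico _ hc.le, Finset.sum_eq_zero (s := Finset.range c),
    zero_add]
  intro a ha
  rw [h.tau_eq_zero (Finset.mem_range.1 ha) (by have := Finset.mem_range.1 ha; omega), smul_zero]

/-- Vanishing of the off-diagonal products. -/
lemma xy_eq_zero (h : Exchange x N K ε w xy yx) (hx : x.Regular K) {i j a b : ℕ} (hi : i < N)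
    (hj : j < N) (hb : b < N) (hab : a < b) (haK : a < K) (hai : a < i) : xy i a b j = 0 := by
  set g : ℕ → V := fun d => (-1 : F) ^ ε d • ((-1 : F) ^ (ε d * (ε b + ε a)) • yx b d d a)
    with hg
  have hg0 : ∀ d, a + 1 ≤ d → g d = 0 := fun d hd => by
    simp only [hg, h.yx_zero b d d a hd haK, smul_zero]
  have hyx : ∀ d, g d = 0 → yx b d d a = 0 := fun d hd => by
    have := congrArg (fun v => (-1 : F) ^ (ε d * (ε b + ε a)) • ((-1 : F) ^ ε d • v)) hd
    simpa only [hg, sign_smul_sign, smul_zero] using this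
  -- For `e ≤ a` the relation with outer indices `(e, e)` and inner indices `(a, b)` has zero left
  -- side, since `e < b` and `e < K`. The vectors `g d` thus solve the homogeneous lower system.
  have h1 : ∀ e ≤ a, x.a e • g e + x.κ e • ∑ d ∈ Finset.range e, g d +
      (x.ρ * x.κ e) • (∑ d ∈ Finset.range N, g d - ∑ d ∈ Finset.range (e + 1), g d) = 0 := by
    intro e he
    have h2 := h.rel e (by omega) a (by omega) b hb e (by omega)
    rw [if_neg hab.ne, if_pos rfl, h.xy_zero e a b e (by omega) (by omega), smul_zero, smul_zero,
      add_zero] at h2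
    have h3 := h.sum_row (c := e) (by omega) g
    simp only [hg, sign_smul_sign] at h3
    have h4 : ∀ d, (-1 : F) ^ ((ε e + ε d) * (ε b + ε a)) • yx b d d a =
        (-1 : F) ^ (ε e * (ε b + ε a)) • ((-1 : F) ^ (ε d * (ε b + ε a)) • yx b d d a) := fun d => by
      rw [add_mul, pow_add, mul_smul]
    simp only [h4, smul_comm _ ((-1 : F) ^ (ε e * (ε b + ε a))), ← Finset.smul_sum] at h2
    have h5 := congrArg (fun v => (-1 : F) ^ (ε e * (ε b + ε a)) • v) h2
    simp only [smul_add, smul_zero, sign_smul_sign] at h5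
    rw [smul_comm _ x.b, h3] at h5
    have h6 := congrArg (fun v => (-1 : F) ^ ε e • v) h5
    simp only [smul_zero, sign_smul_sign] at h6
    exact h6.symm
  have h2 : ∀ d ≤ a, g d = 0 := by
    intro d hd
    have hs : ∀ n ≤ a + 1, ∑ d ∈ Finset.range n, g d = 0 := fun n hn =>
      hx.eq_zero_of_lower (s := fun n => ∑ d ∈ Finset.range n, g d) (L := a + 1) haK
        (Finset.sum_range_zero _) (fun e he => by
          simp only [Finset.sum_range_succ_sub_sum]
          rw [← sum_range_eq_of_zero (show a + 1 ≤ N by omega) hg0]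
          exact h1 e (by omega)) hn
    rw [← Finset.sum_range_succ_sub_sum g, hs _ (by omega), hs _ (by omega), sub_zero]
  have h3 : ∀ d, yx b d d a = 0 := fun d => hyx d (by
    rcases Nat.lt_or_ge a d with hd | hd
    · exact hg0 d hd
    · exact h2 d hd)
  -- Once all `yx b d d a` vanish, this relation reduces to `𝔟 · xy i a b j = 0`, up to a sign.
  have h4 := h.rel i hi a (by omega) b hb j hj
  rw [if_neg hab.ne, h.yx_zero b j i a hai haK] at h4
  simp only [h3, smul_zero, Finset.sum_const_zero, ite_self, add_zero] at h4
  have h5 := congrArg (fun v => (-1 : F) ^ ((ε i + ε a) * (ε b + ε j)) • (x.b⁻¹ • v)) h4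
  simpa only [smul_zero, inv_smul_smul₀ hx.b_ne, sign_smul_sign] using h5

end Exchange

end Relations
end OpenChain
end

open scoped TensorProduct LaurentSeries
noncomputable section
namespace OpenChain

/-! ### The exchange relation between `T(w)` and `T⁻¹(ι(w))` -/

section Components

variable {A : Type} [Ring A] {N : ℕ}

/-- The element `β 1 ⊗ 1 + ∑ ω_{ij} E_{ij} ⊗ E_{ji}`. -/
def exchangeMat (β : A) (ω : Fin N → Fin N → A) : Mat₂ N A := fun i j k l =>
  (if i = j ∧ k = l then β else 0) + if k = j ∧ l = i then ω i j else 0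

variable (m : ℕ) {β : A} {ω : Fin N → Fin N → A}

lemma gmul₂_inTwo_right (r : Mat₂ N A) (y : Fin N → Fin N → A) (i q k s : Fin N) :
    gmul₂ m r (inTwo y) i q k s = ∑ l, (-1) ^ ((deg m i + deg m q + deg m k + deg m l) *
      (deg m l + deg m s)) * (r i q k l * y l s) := by
  simp only [gmul₂, inTwo, mul_ite, mul_zero]
  rw [Finset.sum_eq_single q]
  · simp only [if_true]
    refine Finset.sum_congr rfl fun l _ => sign_mul_congr ?_ _
    rcases deg_eq_zero_or_one m i with h1 | h1 <;> rcases deg_eq_zero_or_one m k with h3 | h3 <;>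
      rcases deg_eq_zero_or_one m l with h4 | h4 <;> rcases deg_eq_zero_or_one m q with h5 | h5 <;>
      rcases deg_eq_zero_or_one m s with h6 | h6 <;> simp only [h1, h3, h4, h5, h6]
  · intro j _ hj; simp [hj]
  · simp

lemma gmul₂_inOne_right (r : Mat₂ N A) (x : Fin N → Fin N → A) (i q k s : Fin N) :
    gmul₂ m r (inOne x) i q k s = ∑ j, (-1) ^ ((deg m i + deg m j) * (deg m j + deg m q)) *
      (r i j k s * x j q) := by
  simp only [gmul₂, inOne, mul_ite, mul_zero]
  refine Finset.sum_congr rfl fun j _ => ?_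
  rw [Finset.sum_eq_single s]
  · simp only [if_true]
    refine sign_mul_congr ?_ _
    rcases deg_eq_zero_or_one m i with h1 | h1 <;> rcases deg_eq_zero_or_one m k with h3 | h3 <;>
      rcases deg_eq_zero_or_one m j with h4 | h4 <;> rcases deg_eq_zero_or_one m q with h5 | h5 <;>
      rcases deg_eq_zero_or_one m s with h6 | h6 <;> simp only [h1, h3, h4, h5, h6]
  · intro l _ hl; simp [hl]
  · simp

lemma gmul₂_inOne_exchangeMat (x : Fin N → Fin N → A) (i q k s : Fin N) :
    gmul₂ m (inOne x) (exchangeMat β ω) i q k s =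
      (if k = s then x i q * β else 0) + if k = q then x i s * ω s q else 0 := by
  have h1 : gmul₂ m (inOne x) (exchangeMat β ω) i q k s =
      ∑ j, (-1) ^ ((deg m i + deg m j) * (deg m j + deg m q + deg m k + deg m s)) *
        (x i j * exchangeMat β ω j q k s) := by
    simp only [gmul₂, inOne, ite_mul, zero_mul, mul_ite, mul_zero]
    refine Finset.sum_congr rfl fun j _ => ?_
    rw [Finset.sum_eq_single k]
    · simp only [if_true]
      refine sign_mul_congr ?_ _
      rcases deg_eq_zero_or_one m i with h1 | h1 <;> rcases deg_eq_zero_or_one m k with h3 | h3 <;>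
        rcases deg_eq_zero_or_one m j with h4 | h4 <;>
        rcases deg_eq_zero_or_one m q with h5 | h5 <;>
        rcases deg_eq_zero_or_one m s with h6 | h6 <;> simp only [h1, h3, h4, h5, h6]
    · intro l _ hl; simp [Ne.symm hl]
    · simp
  rw [h1]
  simp only [exchangeMat, mul_add, Finset.sum_add_distrib]
  congr 1
  · rw [Finset.sum_eq_single q]
    · by_cases h : k = s
      · subst h
        simp only [and_self, if_true]
        rw [sign_mul_congr (b := 0), pow_zero, one_mul]
        rcases deg_eq_zero_or_one m i with h4 | h4 <;>
          rcases deg_eq_zero_or_one m q with h5 | h5 <;>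
          rcases deg_eq_zero_or_one m k with h6 | h6 <;> simp only [h4, h5, h6]
      · simp [h]
    · intro j _ hj; simp [hj]
    · simp
  · rw [Finset.sum_eq_single s]
    · by_cases h : k = q
      · subst h
        simp only [and_self, if_true]
        rw [sign_mul_congr (b := 0), pow_zero, one_mul]
        rcases deg_eq_zero_or_one m i with h4 | h4 <;>
          rcases deg_eq_zero_or_one m s with h5 | h5 <;>
          rcases deg_eq_zero_or_one m k with h6 | h6 <;> simp only [h4, h5, h6]
      · simp [h]
    · intro j _ hj; simp [Ne.symm hj]
    · simp

lemma gmul₂_inTwo_exchangeMat (y : Fin N → Fin N → A) (i q k s : Fin N) :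
    gmul₂ m (inTwo y) (exchangeMat β ω) i q k s =
      (if i = q then y k s * β else 0) + if s = i then
        (-1) ^ ((deg m k + deg m q) * (deg m i + deg m q)) * (y k q * ω i q) else 0 := by
  have h1 : gmul₂ m (inTwo y) (exchangeMat β ω) i q k s =
      ∑ l, (-1) ^ ((deg m k + deg m l) * (deg m l + deg m s)) *
        (y k l * exchangeMat β ω i q l s) := by
    simp only [gmul₂, inTwo, ite_mul, zero_mul, mul_ite, mul_zero]
    rw [Finset.sum_comm]
    refine Finset.sum_congr rfl fun l _ => ?_
    rw [Finset.sum_eq_single i]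
    · simp only [if_true]
      refine sign_mul_congr ?_ _
      rcases deg_eq_zero_or_one m i with h1 | h1 <;> rcases deg_eq_zero_or_one m k with h3 | h3 <;>
        rcases deg_eq_zero_or_one m l with h4 | h4 <;>
        rcases deg_eq_zero_or_one m q with h5 | h5 <;>
        rcases deg_eq_zero_or_one m s with h6 | h6 <;> simp only [h1, h3, h4, h5, h6]
    · intro j _ hj; simp [Ne.symm hj]
    · simp
  rw [h1]
  simp only [exchangeMat, mul_add, Finset.sum_add_distrib]
  congr 1
  · rw [Finset.sum_eq_single s]
    · by_cases h : i = q
      · subst h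
        simp only [and_self, if_true]
        rw [sign_mul_congr (b := 0), pow_zero, one_mul]
        rcases deg_eq_zero_or_one m k with h5 | h5 <;>
          rcases deg_eq_zero_or_one m s with h6 | h6 <;> simp only [h5, h6]
      · simp [h]
    · intro j _ hj; simp [hj]
    · simp
  · rw [Finset.sum_eq_single q]
    · by_cases h : s = i
      · subst h
        simp only [and_self, if_true]
        refine sign_mul_congr ?_ _
        rcases deg_eq_zero_or_one m k with h4 | h4 <;>
          rcases deg_eq_zero_or_one m q with h5 | h5 <;>
          rcases deg_eq_zero_or_one m s with h6 | h6 <;> simp only [h4, h5, h6]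
      · simp [h]
    · intro j _ hj; simp [hj]
    · simp

variable (hβ : ∀ z, z * β = β * z) (hω : ∀ i j z, z * ω i j = ω i j * z)
include hβ hω

/-- All scalars are collected on the left, so that the components can be read modulo a left ideal.
-/
lemma exchange_left (x y : Fin N → Fin N → A) (i a b j : Fin N) :
    gmul₂ m (gmul₂ m (inOne x) (exchangeMat β ω)) (inTwo y) i a b j =
      β * ((-1) ^ ((deg m i + deg m a) * (deg m b + deg m j)) * (x i a * y b j)) +
        if a = b then ∑ c, ω c a *
          ((-1) ^ ((deg m i + deg m c) * (deg m c + deg m j)) * (x i c * y c j)) else 0 := by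
  rw [gmul₂_inTwo_right]
  simp only [gmul₂_inOne_exchangeMat, add_mul, mul_add, Finset.sum_add_distrib]
  congr 1
  · rw [Finset.sum_eq_single b]
    · rw [if_pos rfl, hβ, mul_assoc, ← neg_one_pow_mul_left]
      congr 1
      refine sign_mul_congr ?_ _
      rcases deg_eq_zero_or_one m i with h1 | h1 <;> rcases deg_eq_zero_or_one m b with h3 | h3 <;>
        rcases deg_eq_zero_or_one m a with h4 | h4 <;>
        rcases deg_eq_zero_or_one m j with h5 | h5 <;> simp only [h1, h3, h4, h5]
    · intro l _ hl; simp [Ne.symm hl]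
    · simp
  · by_cases h : a = b
    · subst h
      simp only [if_true]
      refine Finset.sum_congr rfl fun c _ => ?_
      rw [hω, mul_assoc, ← neg_one_pow_mul_left]
      congr 1
      refine sign_mul_congr ?_ _
      rcases deg_eq_zero_or_one m i with h1 | h1 <;> rcases deg_eq_zero_or_one m c with h3 | h3 <;>
        rcases deg_eq_zero_or_one m a with h4 | h4 <;>
        rcases deg_eq_zero_or_one m j with h5 | h5 <;> simp only [h1, h3, h4, h5]
    · simp [h, Ne.symm h]

lemma exchange_right (x y : Fin N → Fin N → A) (i a b j : Fin N) :
    gmul₂ m (gmul₂ m (inTwo y) (exchangeMat β ω)) (inOne x) i a b j =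
      β * (y b j * x i a) +
        if i = j then ∑ d, ω i d *
          ((-1) ^ ((deg m i + deg m d) * (deg m b + deg m a)) * (y b d * x d a)) else 0 := by
  rw [gmul₂_inOne_right]
  simp only [gmul₂_inTwo_exchangeMat, add_mul, mul_add, Finset.sum_add_distrib]
  congr 1
  · rw [Finset.sum_eq_single i]
    · rw [if_pos rfl, hβ, mul_assoc, sign_mul_congr (b := 0), pow_zero, one_mul]
      rcases deg_eq_zero_or_one m i with h5 | h5 <;>
        rcases deg_eq_zero_or_one m a with h6 | h6 <;> simp only [h5, h6]
    · intro l _ hl; simp [Ne.symm hl]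
    · simp
  · by_cases h : i = j
    · subst h
      simp only [if_true]
      refine Finset.sum_congr rfl fun d _ => ?_
      rw [hω, mul_assoc, mul_assoc, sign_mul_sign, ← neg_one_pow_mul_left]
      congr 1
      refine sign_mul_congr ?_ _
      rcases deg_eq_zero_or_one m i with h1 | h1 <;> rcases deg_eq_zero_or_one m b with h3 | h3 <;>
        rcases deg_eq_zero_or_one m a with h4 | h4 <;>
        rcases deg_eq_zero_or_one m d with h5 | h5 <;> simp only [h1, h3, h4, h5]
    · simp [h, Ne.symm h]

end Components

section Coinciding

variable {A : Type} [Ring A] [Algebra ℂ A] {M : Model} {m n : ℕ}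
  {T : Side → Fin (m + n) → Fin (m + n) → LaurentSeries A}
  {T' : Fin (m + n) → Fin (m + n) → LaurentSeries A}

/-- `T₁(w) R₁₂(w, ι(w)) T₂⁻¹(ι(w)) = T₂⁻¹(ι(w)) R₁₂(w, ι(w)) T₁(w)` at `w = u`. -/
lemma IsMonodromy.exchange_u₀ (h : IsMonodromy M m n T T') :
    gmul₂ m (gmul₂ m (inOne (T .plus))
      fun i j k l => scal A (R₁₂ M m n M.u₀ (M.iota M.u₀) i j k l))
      (inTwo fun i j => subst (T' i j) (HahnSeries.single 1 M.sgn)) =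
    gmul₂ m (gmul₂ m (inTwo fun i j => subst (T' i j) (HahnSeries.single 1 M.sgn))
      fun i j k l => scal A (R₁₂ M m n M.u₀ (M.iota M.u₀) i j k l)) (inOne (T .plus)) := by
  have hz := order_single_one M.sgn_ne_zero
  -- The relation is first proved for independent parameters, by multiplying the `(+,-)` relation on
  -- both sides by the inverse of `T⁻`.
  have h2 : gmul₂ m (gmul₂ m (inOne fun i j => inX (T .plus i j))
        (scalMat A (R₁₂ M m n (inX M.u₀) (inY (M.iota M.u₀)))))
        (inTwo fun i j => inY (subst (T' i j) (HahnSeries.single 1 M.sgn))) =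
      gmul₂ m (gmul₂ m (inTwo fun i j => inY (subst (T' i j) (HahnSeries.single 1 M.sgn)))
        (scalMat A (R₁₂ M m n (inX M.u₀) (inY (M.iota M.u₀)))))
        (inOne fun i j => inX (T .plus i j)) := by
    have inv₂ : ∀ {x y : Fin (m + n) → Fin (m + n) → LaurentSeries A}, OpenChain.gmul m x y = gone →
        toMat₂ m (inTwo fun i j => inY (x i j)) * toMat₂ m (inTwo fun i j => inY (y i j)) = 1 := by
      intro x y hxy
      rw [← toMat₂_gmul₂, ← inTwo_gmul, ← inY_gmul, hxy, ← toMat₂_gone₂, ← inTwo_gone]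
      congr 2
      exact map_gone (HahnSeries.C : LaurentSeries A →+* Series₂ A)
    have e1 := inv₂ (h.subst_inv_right hz)
    have e2 := inv₂ (h.subst_inv_left hz)
    have e3 := congrArg (toMat₂ m) h.plus_minus
    apply toMat₂_injective m
    simp only [toMat₂_gmul₂] at *
    generalize toMat₂ m (inTwo fun i j => inY (subst (T' i j) (HahnSeries.single 1 M.sgn))) = V at *
    generalize toMat₂ m (inTwo fun i j =>
      inY (subst (T .minus i j) (HahnSeries.single 1 M.sgn))) = U at *
    generalize toMat₂ m (inOne fun i j => inX (T .plus i j)) = t at *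
    generalize toMat₂ m (scalMat A (R₁₂ M m n (inX M.u₀) (inY (M.iota M.u₀)))) = R at *
    calc t * R * V = (V * U) * t * R * V := by rw [e2, one_mul]
      _ = V * (R * t * U) * V := by rw [e3]; simp only [mul_assoc]
      _ = V * R * t := by simp only [mul_assoc, e1, mul_one]
  ext1 i; ext1 j; ext1 k; ext1 l
  -- All entries lie in `diagSubring` together with their restrictions, so `X = Y` may be imposed on
  -- both sides.
  have hR : ∀ i j k l, (scalMat A (R₁₂ M m n (inX M.u₀) (inY (M.iota M.u₀))) i j k l,
      scal A (R₁₂ M m n M.u₀ (M.iota M.u₀) i j k l)) ∈ diagSubring A := fun i j k l =>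
    (R₁₂_diag M m n M.u₀ (M.iota M.u₀) i j k l).scal₂
  have hx := inOne_mem (diagSubring A) fun i j => Diag.inX (T .plus i j)
  have hy := inTwo_mem (diagSubring A) fun i j =>
    Diag.inY (subst (T' i j) (HahnSeries.single 1 M.sgn))
  have e1 : Diag _ _ := gmul₂_mem (m := m) _ (gmul₂_mem (m := m) _ hx hR) hy i j k l
  have e2 : Diag _ _ := gmul₂_mem (m := m) _ (gmul₂_mem (m := m) _ hy hR) hx i j k l
  have h' := congrFun (congrFun (congrFun (congrFun h2 i) j) k) l
  exact Diag.unique (F := gmul₂ m (gmul₂ m (inTwo fun i j =>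
    inY (subst (T' i j) (HahnSeries.single 1 M.sgn)))
      (scalMat A (R₁₂ M m n (inX M.u₀) (inY (M.iota M.u₀)))))
      (inOne fun i j => inX (T .plus i j)) i j k l) (by rw [← h']; exact e1) e2

end Coinciding
end OpenChain
end

open scoped TensorProduct LaurentSeries
noncomputable section
namespace OpenChain

/-! ### Classes of series modulo a left ideal -/

section SeriesCoset

variable {A : Type} [Ring A]

/-- The series all of whose coefficients belong to a left ideal. -/
def seriesIdeal (J : Ideal A) : Submodule (LaurentSeries A) (LaurentSeries A) where
  carrier := {f | ∀ r, f.coeff r ∈ J}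
  zero_mem' r := J.zero_mem
  add_mem' hf hg r := J.add_mem (hf r) (hg r)
  smul_mem' g f hf r := by
    rw [smul_eq_mul, HahnSeries.coeff_mul]
    exact J.sum_mem fun _ _ => J.mul_mem_left _ (hf _)

lemma mul_mem_seriesIdeal {J : Ideal A} (g : LaurentSeries A) {f : LaurentSeries A}
    (hf : f ∈ seriesIdeal J) : g * f ∈ seriesIdeal J := (seriesIdeal J).smul_mem g hf

variable [Algebra ℂ A]

lemma subst_mem_seriesIdeal {J : Ideal A} {f : LaurentSeries A} (hf : f ∈ seriesIdeal J)
    (z : LaurentSeries ℂ) : subst f z ∈ seriesIdeal J := fun r => by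
  rw [subst_coeff]
  exact J.sum_mem fun n _ => by
    rw [Algebra.smul_def]; exact J.mul_mem_left _ (hf n)

/-- The quotient of the series with coefficients in `A` by `seriesIdeal J`, as a vector space over
the field of scalar series. -/
def SeriesCoset (J : Ideal A) : Type := LaurentSeries A ⧸ seriesIdeal J

instance (J : Ideal A) : AddCommGroup (SeriesCoset J) :=
  inferInstanceAs (AddCommGroup (LaurentSeries A ⧸ seriesIdeal J))

instance (J : Ideal A) : Module (LaurentSeries A) (SeriesCoset J) :=
  inferInstanceAs (Module (LaurentSeries A) (LaurentSeries A ⧸ seriesIdeal J))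

instance (J : Ideal A) : Module (LaurentSeries ℂ) (SeriesCoset J) :=
  Module.compHom (SeriesCoset J) (scal A)

/-- The class of a series. -/
def SeriesCoset.mk (J : Ideal A) : LaurentSeries A →+ SeriesCoset J :=
  (seriesIdeal J).mkQ.toAddMonoidHom

namespace SeriesCoset

variable (J : Ideal A)

omit [Algebra ℂ A] in
lemma mk_eq_zero {f : LaurentSeries A} : mk J f = 0 ↔ f ∈ seriesIdeal J :=
  Submodule.Quotient.mk_eq_zero _

lemma mk_scal_mul (f : LaurentSeries ℂ) (g : LaurentSeries A) :
    mk J (scal A f * g) = f • mk J g := rfl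

lemma mk_sign_mul (e : ℕ) (g : LaurentSeries A) :
    mk J ((-1) ^ e * g) = (-1 : LaurentSeries ℂ) ^ e • mk J g := by
  rw [← mk_scal_mul, map_pow, map_neg, map_one]

end SeriesCoset

end SeriesCoset

/-! ### The exchange relations of the monodromy matrices -/

section MonodromyExchange

/-- A square matrix, extended by zero to all natural indices. -/
def zeroExtend {R : Type} [Zero R] {N : ℕ} (x : Fin N → Fin N → R) (i j : ℕ) : R :=
  if h : i < N ∧ j < N then x ⟨i, h.1⟩ ⟨j, h.2⟩ else 0

lemma zeroExtend_coe {R : Type} [Zero R] {N : ℕ} (x : Fin N → Fin N → R) (i j : Fin N) :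
    zeroExtend x i j = x i j := dif_pos ⟨i.2, j.2⟩

variable (M : Model) (m n : ℕ) {z : LaurentSeries ℂ}

/-- Obtained from the relation at `u` by the substitution homomorphism that sends `u` to `z`. -/
lemma T_exchange (hz : (M.loc z).order = 1) :
    gmul₂ m (gmul₂ m (inOne (T M m n z)) (exchangeMat (scal (Mono M m n) (M.b z (M.iota z)))
      fun i j => scal (Mono M m n) (M.w m (i + 1) (j + 1) z (M.iota z)))) (inTwo (Tinv M m n z)) =
    gmul₂ m (gmul₂ m (inTwo (Tinv M m n z)) (exchangeMat (scal (Mono M m n) (M.b z (M.iota z)))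
      fun i j => scal (Mono M m n) (M.w m (i + 1) (j + 1) z (M.iota z))))
        (inOne (T M m n z)) := by
  have hu : substHom ℂ hz M.u₀ = z := by
    have h1 : M.loc (substHom ℂ hz M.u₀) = M.loc z := by
      refine Eq.trans ?_ (subst_self_var hz)
      rw [← substHom_apply hz, ← M.loc_u₀]
      cases M
      · exact (map_inv₀ _ _).symm
      · rfl
    rw [← M.loc_loc (substHom ℂ hz M.u₀), h1, M.loc_loc]
  have hiu : substHom ℂ hz (M.iota M.u₀) = M.iota z := by
    rw [← congrArg M.iota hu]
    cases M
    · exact map_neg _ _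
    · exact map_inv₀ _ _
  have hR : (fun i j k l => substHom (Mono M m n) hz
      (scal (Mono M m n) (R₁₂ M m n M.u₀ (M.iota M.u₀) i j k l))) =
      exchangeMat (scal (Mono M m n) (M.b z (M.iota z)))
        fun i j => scal (Mono M m n) (M.w m (i + 1) (j + 1) z (M.iota z)) := by
    ext1 i; ext1 j; ext1 k; ext1 l
    rw [substHom_apply, subst_scal hz, ← substHom_apply hz,
      R₁₂_map (substHom ℂ hz) (subst_algebraMap hz), hu, hiu, R₁₂, exchangeMat, map_add]
    split_ifs <;> simp
  have hT : (fun i j => substHom (Mono M m n) hz (tSeries M m n .plus i j)) = T M m n z := rfl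
  have hT' : (fun i j => substHom (Mono M m n) hz
      (subst (t'Series M m n i j) (HahnSeries.single 1 M.sgn))) = Tinv M m n z := by
    ext1 i; ext1 j
    rw [substHom_apply, subst_subst_single M.sgn_ne_zero hz, ← M.inv_iota_loc, M.loc_loc]
    rfl
  ext1 i; ext1 j; ext1 k; ext1 l
  have h := congrArg (substHom (Mono M m n) hz) (congrFun (congrFun (congrFun (congrFun
    (isMonodromy_tSeries M m n).exchange_u₀ i) j) k) l)
  simpa only [map_gmul₂, map_inOne, map_inTwo, hR, hT, hT'] using h

variable {M m n} {K : ℕ}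

lemma T_mem_seriesIdeal {i j : Fin (m + n)} (hij : j < i) (hj : (j : ℕ) < K) :
    T M m n z i j ∈ seriesIdeal (idealJ M m n (K + 1)) :=
  subst_mem_seriesIdeal (fun r => by
    apply Ideal.subset_span
    exact ⟨i, j, r, hij, Nat.succ_lt_succ hj, Or.inl rfl⟩) _

lemma Tinv_mem_seriesIdeal {i j : Fin (m + n)} (hij : j < i) (hj : (j : ℕ) < K) :
    Tinv M m n z i j ∈ seriesIdeal (idealJ M m n (K + 1)) :=
  subst_mem_seriesIdeal (fun r => by
    apply Ideal.subset_span
    exact ⟨i, j, r, hij, Nat.succ_lt_succ hj, Or.inr rfl⟩) _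

lemma D_mem_seriesIdeal {p : ℕ} {i j : Fin (m + n)} (hij : j < i) (hj : (j : ℕ) < K) :
    D M m n p z i j ∈ seriesIdeal (idealI M m n p (K + 1)) :=
  subst_mem_seriesIdeal (fun r => by
    apply Ideal.subset_span
    exact ⟨i, j, r, hij, Nat.succ_lt_succ hj, rfl⟩) _

lemma zeroExtend_mem {R : Type} [Ring R] {J : Ideal R} {N : ℕ}
    {x : Fin N → Fin N → LaurentSeries R}
    (h : ∀ i j : Fin N, j < i → (j : ℕ) < K → x i j ∈ seriesIdeal J) {i j : ℕ} (hij : j < i)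
    (hj : j < K) : zeroExtend x i j ∈ seriesIdeal J := by
  rw [zeroExtend]
  split_ifs with h'
  · exact h _ _ hij hj
  · exact zero_mem _

variable (M m n K)

/-- The class of `t_{ia}(z) t'_{bj}(ι(z))` modulo `J_{K+1}`. -/
def classTT' (z : LaurentSeries ℂ) (i a b j : ℕ) : SeriesCoset (idealJ M m n (K + 1)) :=
  SeriesCoset.mk _ (zeroExtend (T M m n z) i a * zeroExtend (Tinv M m n z) b j)

/-- The class of `t'_{bj}(ι(z)) t_{ia}(z)` modulo `J_{K+1}`. -/
def classT'T (z : LaurentSeries ℂ) (b j i a : ℕ) : SeriesCoset (idealJ M m n (K + 1)) :=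
  SeriesCoset.mk _ (zeroExtend (Tinv M m n z) b j * zeroExtend (T M m n z) i a)

/-- In a product the right factor decides membership in the left ideal: `t'_{bj}` gives `xy_zero`
and `t_{ia}` gives `yx_zero`. Indices start at `0` here, so the removed ones are those below `K`,
and the ideal is `J_{K+1}`. -/
lemma exchange_classes (hz : (M.loc z).order = 1) :
    Exchange (M.exchange m z) (m + n) K (fun l => gr m (l + 1))
      (fun i j => M.w m (i + 1) (j + 1) z (M.iota z)) (classTT' M m n K z)
      (classT'T M m n K z) where
  rel i hi a ha b hb j hj := by
    have h := congrFun (congrFun (congrFun (congrFun (T_exchange M m n hz) ⟨i, hi⟩) ⟨a, ha⟩)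
      ⟨b, hb⟩) ⟨j, hj⟩
    rw [exchange_left m (fun f => (scal_commute _ f).symm) (fun _ _ f => (scal_commute _ f).symm),
      exchange_right m (fun f => (scal_commute _ f).symm)
        (fun _ _ f => (scal_commute _ f).symm)] at h
    have h1 := congrArg (SeriesCoset.mk (idealJ M m n (K + 1))) h
    have e : ∀ (x y : Fin (m + n) → Fin (m + n) → LaurentSeries (Mono M m n)) i j k l,
      x i j * y k l = zeroExtend x i j * zeroExtend y k l := fun x y i j k l => by
        rw [zeroExtend_coe, zeroExtend_coe]
    simp only [map_add, apply_ite (SeriesCoset.mk (idealJ M m n (K + 1))), map_zero, map_sum,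
      SeriesCoset.mk_scal_mul, SeriesCoset.mk_sign_mul, Fin.mk.injEq, e] at h1
    simp only [Finset.sum_range]
    exact h1
  xy_zero i a b j h1 h2 := (SeriesCoset.mk_eq_zero _).2 (mul_mem_seriesIdeal _
    (zeroExtend_mem (fun _ _ => Tinv_mem_seriesIdeal) h1 h2))
  yx_zero b j i a h1 h2 := (SeriesCoset.mk_eq_zero _).2 (mul_mem_seriesIdeal _
    (zeroExtend_mem (fun _ _ => T_mem_seriesIdeal) h1 h2))
  w_self c := by rw [Model.w, if_pos rfl, M.a_eq_exchange]; rfl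
  w_lt i j h := by rw [Model.w, if_neg (by omega), M.c_of_lt m h]
  w_gt i j h := by
    rw [Model.w, if_neg (by omega), M.c_of_gt m h]
    -- `z = 0` is excluded, since then `loc z` would be zero and not of order one.
    rintro rfl
    cases M <;> simp [Model.loc] at hz
  κ_sign c d := by
    simp only [Model.exchange]
    rw [← mul_assoc, ← pow_add]
    congr 1
    exact neg_one_pow_congr (by omega)

variable {M m n K} (hz : (M.loc z).order = 1) (hx : (M.exchange m z).Regular K)
include hz hx

lemma T_mul_Tinv_mem {i a b : Fin (m + n)} (j : Fin (m + n)) (hab : a < b) (haK : (a : ℕ) < K)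
    (hai : a < i) : T M m n z i a * Tinv M m n z b j ∈ seriesIdeal (idealJ M m n (K + 1)) := by
  have h := (exchange_classes M m n K hz).xy_eq_zero hx i.2 j.2 b.2 hab haK hai
  rw [classTT', zeroExtend_coe, zeroExtend_coe] at h
  exact (SeriesCoset.mk_eq_zero _).1 h

/-- The product `(-1)^{([i]+[a])([a]+[j])} t_{ia} t'_{bj}` in the coproduct of `d_{ij}`. -/
def ttProd (M : Model) (m n : ℕ) (z : LaurentSeries ℂ) (i j a b : Fin (m + n)) :
    LaurentSeries (Mono M m n) :=
  (-1) ^ ((deg m i + deg m a) * (deg m a + deg m j)) * (T M m n z i a * Tinv M m n z b j)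

omit hz hx in
lemma mk_ttProd (i j a : Fin (m + n)) : SeriesCoset.mk (idealJ M m n (K + 1))
    (ttProd M m n z i j a a) = Exchange.tau (LaurentSeries ℂ) (fun l => gr m (l + 1))
      (classTT' M m n K z) i j a := by
  rw [ttProd, SeriesCoset.mk_sign_mul, Exchange.tau, classTT', zeroExtend_coe, zeroExtend_coe]
  rfl

lemma ttProd_reduced_mem (hK : K ≤ m + n) {f : ℕ → LaurentSeries ℂ}
    (hf : ∀ c < K, f c * (1 + (M.exchange m z).Lam K) = (M.exchange m z).lam c)
    {i : Fin (m + n)} (j : Fin (m + n)) (hi : K ≤ i) {c : Fin (m + n)} (hc : (c : ℕ) < K) :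
    ttProd M m n z i j c c +
        scal _ (f c) * (∑ a : Fin (m + n), if K ≤ (a : ℕ) then ttProd M m n z i j a a else 0) -
        (if i = j then ∑ a : Fin (m + n),
          if (a : ℕ) < K then scal _ (f a) * ttProd M m n z a a c c else 0 else 0) ∈
      seriesIdeal (idealJ M m n (K + 1)) := by
  rw [← SeriesCoset.mk_eq_zero, map_sub, map_add, SeriesCoset.mk_scal_mul,
    apply_ite (SeriesCoset.mk (idealJ M m n (K + 1)))]
  simp only [map_sum, apply_ite (SeriesCoset.mk (idealJ M m n (K + 1))), map_zero,
    SeriesCoset.mk_scal_mul, mk_ttProd]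
  have h := (exchange_classes M m n K hz).reduced hx hK i.2 j.2 hi hf hc
  rw [sub_eq_zero]
  have e1 : Finset.Ico K (m + n) = (Finset.range (m + n)).filter fun a => K ≤ a := by
    ext a; simp [and_comm]
  have e2 : Finset.range K = (Finset.range (m + n)).filter fun a => a < K := by
    ext a; simp; omega
  rw [e1, e2, Finset.sum_filter, Finset.sum_filter, Finset.sum_range, Finset.sum_range] at h
  rw [h]
  by_cases hij : i = j
  · subst hij; simp
  · rw [if_neg hij, if_neg fun h' => hij (Fin.ext h')]
    exact zero_smul (LaurentSeries ℂ) (_ : SeriesCoset (idealJ M m n (K + 1)))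

end MonodromyExchange
end OpenChain
end

open scoped TensorProduct LaurentSeries
noncomputable section
namespace OpenChain

/-! ### The coproduct of the reduced generators -/

section Reduced

variable (M : Model) (m n p : ℕ)

/-- Series with coefficients in `A_{m|n}`, as series in the graded tensor product. -/
def inLeft : LaurentSeries (Mono M m n) →+* LaurentSeries (MonoRefl M m n p) :=
  coeffHom (GradedTensorProduct.includeLeft (Mono.grading M m n)
    (Refl.grading M m n p) : Mono M m n →+* MonoRefl M m n p)

/-- Series with coefficients in the reflection algebra, as series in the graded tensor product. -/
def inRight : LaurentSeries (Refl M m n p) →+* LaurentSeries (MonoRefl M m n p) :=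
  coeffHom (GradedTensorProduct.includeRight (Mono.grading M m n)
    (Refl.grading M m n p) : Refl M m n p →+* MonoRefl M m n p)

lemma inLeft_scal (f : LaurentSeries ℂ) : inLeft M m n p (scal _ f) = scal _ f :=
  coeffHom_scal _ f

lemma inRight_scal (f : LaurentSeries ℂ) : inRight M m n p (scal _ f) = scal _ f :=
  coeffHom_scal _ f

/-- The series that vanish in `A_{m|n} / J_k ⊗ 𝔇_{m|n} / I_k`. -/
def nullSeries (k : ℕ) : AddSubgroup (LaurentSeries (MonoRefl M m n p)) where
  carrier := {F | ∀ r, coset M m n p k (F.coeff r) = 0}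
  zero_mem' r := map_zero _
  add_mem' hF hG r := by rw [HahnSeries.coeff_add, map_add, hF r, hG r, add_zero]
  neg_mem' hF r := by rw [HahnSeries.coeff_neg, map_neg, hF r, neg_zero]

variable {M m n p} {k : ℕ}

lemma coset_coeff_eq {F G : LaurentSeries (MonoRefl M m n p)} (h : F - G ∈ nullSeries M m n p k)
    (r : ℤ) : coset M m n p k (F.coeff r) = coset M m n p k (G.coeff r) := by
  have h' := h r
  rwa [HahnSeries.coeff_sub, map_sub, sub_eq_zero] at h'

lemma coset_include_mul (x : Mono M m n) (y : Refl M m n p) :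
    coset M m n p k (GradedTensorProduct.includeLeft (Mono.grading M m n) (Refl.grading M m n p) x *
      GradedTensorProduct.includeRight (Mono.grading M m n) (Refl.grading M m n p) y) =
    ((idealJ M m n k).restrictScalars ℂ).mkQ x ⊗ₜ[ℂ]
      ((idealI M m n p k).restrictScalars ℂ).mkQ y := by
  rw [GradedTensorProduct.includeLeft_apply, GradedTensorProduct.includeRight_apply,
    GradedTensorProduct.tmul_one_mul_one_tmul]
  rfl

lemma mul_mem_nullSeries {f : LaurentSeries (Mono M m n)} {g : LaurentSeries (Refl M m n p)}
    (h : f ∈ seriesIdeal (idealJ M m n k) ∨ g ∈ seriesIdeal (idealI M m n p k)) :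
    inLeft M m n p f * inRight M m n p g ∈ nullSeries M m n p k := fun r => by
  rw [HahnSeries.coeff_mul, map_sum]
  refine Finset.sum_eq_zero fun s _ => ?_
  refine (coset_include_mul _ _).trans ?_
  rcases h with h | h
  · rw [Submodule.mkQ_apply,
      (Submodule.Quotient.mk_eq_zero ((idealJ M m n k).restrictScalars ℂ)).2 (h s.1),
      TensorProduct.zero_tmul]
  · rw [Submodule.mkQ_apply ((idealI M m n p k).restrictScalars ℂ),
      (Submodule.Quotient.mk_eq_zero ((idealI M m n p k).restrictScalars ℂ)).2 (h s.2),
      TensorProduct.tmul_zero]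

lemma scal_mul_mem_nullSeries (f : LaurentSeries ℂ) {F : LaurentSeries (MonoRefl M m n p)}
    (h : F ∈ nullSeries M m n p k) : scal _ f * F ∈ nullSeries M m n p k := fun r => by
  rw [HahnSeries.coeff_mul, map_sum]
  refine Finset.sum_eq_zero fun s _ => ?_
  rw [scal, coeffHom_coeff, ← Algebra.smul_def, map_smul, h, smul_zero]

/-- Moving `Z` past `Y` collects all factors of `A_{m|n}` on the left. The signs combine to
`([i]+[a])([a]+[j])`, independent of `b`. -/
lemma sandwich_apply {X Z : Fin (m + n) → Fin (m + n) → LaurentSeries (Mono M m n)}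
    {Y : Fin (m + n) → Fin (m + n) → LaurentSeries (Refl M m n p)}
    (hY : IsEven m (coeffHom (Refl.parity M m n p : Refl M m n p →+* Refl M m n p)) Y)
    (hZ : IsEven m (coeffHom (Mono.parity M m n : Mono M m n →+* Mono M m n)) Z)
    (i j : Fin (m + n)) :
    sandwich M m n p X Y Z i j = ∑ a, ∑ b, inLeft M m n p
      ((-1) ^ ((deg m i + deg m a) * (deg m a + deg m j)) * (X i a * Z b j)) *
        inRight M m n p (Y a b) := by
  have hc := (coeffSuperCommute_include hZ hY).symm.superCommute
  rw [Finset.sum_comm]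
  simp only [sandwich, gmul, Finset.sum_mul, Finset.mul_sum]
  refine Finset.sum_congr rfl fun b _ => Finset.sum_congr rfl fun a _ => ?_
  have h : inRight M m n p (Y a b) * inLeft M m n p (Z b j) =
      (-1) ^ ((deg m a + deg m b) * (deg m b + deg m j)) *
        (inLeft M m n p (Z b j) * inRight M m n p (Y a b)) := hc a b b j
  change (-1) ^ _ * ((-1) ^ _ * (inLeft M m n p (X i a) * inRight M m n p (Y a b)) *
    inLeft M m n p (Z b j)) = _
  rw [mul_assoc, mul_assoc, h, map_mul, map_pow, map_neg, map_one, map_mul, sign_mul_sign,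
    neg_one_pow_mul_left _ (inLeft M m n p (X i a)), sign_mul_sign, mul_assoc, mul_assoc]
  refine sign_mul_congr ?_ _
  rcases deg_eq_zero_or_one m i with h1 | h1 <;> rcases deg_eq_zero_or_one m j with h3 | h3 <;>
    rcases deg_eq_zero_or_one m a with h4 | h4 <;>
    rcases deg_eq_zero_or_one m b with h5 | h5 <;> simp only [h1, h3, h4, h5]

lemma IsEven.cut {A : Type} [Ring A] {N : ℕ} {θ : A →+* A} {x : Fin N → Fin N → A}
    (hx : IsEven m θ x) (k : ℕ) : IsEven m θ (cut k x) := fun i j => by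
  rw [OpenChain.cut]
  split_ifs
  · exact hx i j
  · simp

section Evaluation

variable (p) {z : LaurentSeries ℂ} (hz : (M.loc z).order = 1)
include hz

lemma isEven_D : IsEven m (coeffHom (Refl.parity M m n p : Refl M m n p →+* Refl M m n p))
    (D M m n p z) := (isEven_dSeries M m n p).subst hz

lemma isEven_Tinv : IsEven m (coeffHom (Mono.parity M m n : Mono M m n →+* Mono M m n))
    (Tinv M m n z) := by
  have h : (M.iota z)⁻¹ = HahnSeries.C M.sgn * M.loc z := by
    rw [← M.inv_iota_loc, M.loc_loc]
  have h' := (isEven_t'Series M m n).subst (order_C_mul M.sgn_ne_zero hz)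
  rw [← h] at h'
  exact h'

/-- The coaction at an arbitrary value of the spectral parameter. -/
lemma IsCoaction.apply_D {Δ : Refl M m n p →ₐ[ℂ] MonoRefl M m n p} (hΔ : IsCoaction M m n p Δ)
    (i j : Fin (m + n)) :
    coeffHom (Δ : Refl M m n p →+* MonoRefl M m n p) (D M m n p z i j) =
      ∑ a, ∑ b, inLeft M m n p (ttProd M m n z i j a b) * inRight M m n p (D M m n p z a b) := by
  have h := congrArg (substHom (MonoRefl M m n p) hz) (hΔ i j)
  rw [D_u₀, substHom_apply, ← coeffHom_subst _ hz] at h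
  refine h.trans (Eq.trans ?_ (sandwich_apply (isEven_D p hz) (isEven_Tinv hz) i j))
  rw [T_u₀, Tinv_u₀]
  simp only [sandwich, map_gmul, substHom_apply, ← coeffHom_subst _ hz,
    subst_subst_single M.sgn_ne_zero hz, ← M.inv_iota_loc, M.loc_loc]
  rfl

end Evaluation

variable (M m) in
/-- The coefficient of `d_{aa}` in the reduced generators. -/
def redCoeff (k c : ℕ) : LaurentSeries ℂ :=
  M.qFactor m k (c + 1) * M.psi m (c + 1) (M.shift m (c + 1) M.u₀)

variable {K : ℕ}

/-- All terms of the coproduct of `d_{ij}` vanish in the coset, except for those that contain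
reduced entries or `d_{aa}` with `a < k`. -/
lemma term_mem_nullSeries {z : LaurentSeries ℂ} (hz : (M.loc z).order = 1)
    (hx : (M.exchange m z).Regular K) {i j : Fin (m + n)}
    (hij : (K ≤ (i : ℕ) ∧ K ≤ (j : ℕ)) ∨ i = j) {a b : Fin (m + n)}
    (hab : ¬(a = b ∧ (a : ℕ) < K))
    (hK : ¬((K ≤ (i : ℕ) ∧ K ≤ (j : ℕ)) ∧ K ≤ (a : ℕ) ∧ K ≤ (b : ℕ))) :
    inLeft M m n p (ttProd M m n z i j a b) * inRight M m n p (D M m n p z a b) ∈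
      nullSeries M m n p (K + 1) := by
  apply mul_mem_nullSeries
  by_cases h1 : b < a ∧ (b : ℕ) < K
  · exact Or.inr (D_mem_seriesIdeal h1.1 h1.2)
  left
  apply mul_mem_seriesIdeal
  by_cases h2 : j < b ∧ (j : ℕ) < K
  · exact mul_mem_seriesIdeal _ (Tinv_mem_seriesIdeal h2.1 h2.2)
  -- In the cases left over, the index inequalities force `a < b`, `a < K` and `a < i`. Neither
  -- factor need lie in the ideal, but the product does.
  simp only [Fin.lt_def, Fin.ext_iff] at *
  exact T_mul_Tinv_mem hz hx j (by rw [Fin.lt_def]; omega) (by omega) (by rw [Fin.lt_def]; omega)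

lemma IsCoaction.apply_D_sub_mem {z : LaurentSeries ℂ} (hz : (M.loc z).order = 1)
    (hx : (M.exchange m z).Regular K) {Δ : Refl M m n p →ₐ[ℂ] MonoRefl M m n p}
    (hΔ : IsCoaction M m n p Δ) {i j : Fin (m + n)}
    (hij : (K ≤ (i : ℕ) ∧ K ≤ (j : ℕ)) ∨ i = j) :
    coeffHom (Δ : Refl M m n p →+* MonoRefl M m n p) (D M m n p z i j) -
      ((∑ a : Fin (m + n), ∑ b : Fin (m + n), if (K ≤ (i : ℕ) ∧ K ≤ (j : ℕ)) ∧ K ≤ (a : ℕ) ∧ K ≤ (b : ℕ) then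
          inLeft M m n p (ttProd M m n z i j a b) * inRight M m n p (D M m n p z a b) else 0) +
        ∑ c : Fin (m + n), if (c : ℕ) < K then
          inLeft M m n p (ttProd M m n z i j c c) * inRight M m n p (D M m n p z c c) else 0) ∈
      nullSeries M m n p (K + 1) := by
  have h : (∑ c : Fin (m + n), if (c : ℕ) < K then
      inLeft M m n p (ttProd M m n z i j c c) * inRight M m n p (D M m n p z c c) else 0) =
      ∑ a : Fin (m + n), ∑ b, if a = b ∧ (a : ℕ) < K then
        inLeft M m n p (ttProd M m n z i j a b) * inRight M m n p (D M m n p z a b) else 0 := by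
    refine Finset.sum_congr rfl fun a _ => ?_
    rw [Finset.sum_eq_single a (fun b _ hb => if_neg fun h => hb h.1.symm) (by simp)]
    simp
  rw [hΔ.apply_D p hz, h, ← Finset.sum_add_distrib, ← Finset.sum_sub_distrib]
  refine sum_mem fun a _ => ?_
  rw [← Finset.sum_add_distrib, ← Finset.sum_sub_distrib]
  refine sum_mem fun b _ => ?_
  by_cases h1 : (K ≤ (i : ℕ) ∧ K ≤ (j : ℕ)) ∧ K ≤ (a : ℕ) ∧ K ≤ (b : ℕ)
  · rw [if_pos h1, if_neg (by omega), add_zero, sub_self]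
    exact zero_mem _
  by_cases h2 : a = b ∧ (a : ℕ) < K
  · rw [if_neg h1, if_pos h2, zero_add, sub_self]
    exact zero_mem _
  rw [if_neg h1, if_neg h2, add_zero, sub_zero]
  exact term_mem_nullSeries hz hx hij h2 h1

lemma Dred_succ_apply {i j : Fin (m + n)} (hi : K ≤ (i : ℕ)) (hj : K ≤ (j : ℕ)) :
    Dred M m n p (K + 1) i j = D M m n p (M.shiftUpTo m K M.u₀) i j -
      if i = j then ∑ a : Fin (m + n), if (a : ℕ) < K then
        scal _ (redCoeff M m (K + 1) a) * D M m n p (M.shiftUpTo m K M.u₀) a a else 0 else 0 := by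
  rw [Dred, cut, if_pos ⟨by omega, by omega⟩]
  simp only [Nat.add_lt_add_iff_right]
  rfl

lemma isEven_Dred : IsEven m (coeffHom (Refl.parity M m n p : Refl M m n p →+* Refl M m n p))
    (Dred M m n p (K + 1)) := by
  refine IsEven.cut (fun i j => ?_) _
  have hD := isEven_D (M := M) (m := m) (n := n) p (M.order_loc_shiftUpTo m K)
  rw [map_sub, mul_sub, Nat.add_sub_cancel, hD i j]
  congr 1
  by_cases h : i = j
  · subst h
    rw [if_pos rfl, neg_one_pow_congr (f := 0) (by omega), pow_zero, one_mul, map_sum]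
    refine Finset.sum_congr rfl fun a _ => ?_
    split_ifs
    · rw [map_mul, coeffHom_scal, hD a a, neg_one_pow_congr (f := 0) (by omega), pow_zero, one_mul]
    · exact map_zero _
  · rw [if_neg h, map_zero, mul_zero]

lemma sandwich_reduced {i j : Fin (m + n)} (hi : K ≤ (i : ℕ)) (hj : K ≤ (j : ℕ)) :
    sandwich M m n p (Tred M m n (K + 1)) (Dred M m n p (K + 1)) (Tinvred M m n (K + 1)) i j =
      ∑ a : Fin (m + n), ∑ b : Fin (m + n), if K ≤ (a : ℕ) ∧ K ≤ (b : ℕ) then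
        inLeft M m n p (ttProd M m n (M.shiftUpTo m K M.u₀) i j a b) *
          inRight M m n p (Dred M m n p (K + 1) a b) else 0 := by
  have hT : IsEven m (coeffHom (Mono.parity M m n : Mono M m n →+* Mono M m n))
      (Tinvred M m n (K + 1)) := (isEven_Tinv (M.order_loc_shiftUpTo m K)).cut _
  rw [sandwich_apply isEven_Dred hT]
  refine Finset.sum_congr rfl fun a _ => Finset.sum_congr rfl fun b _ => ?_
  by_cases h : K ≤ (a : ℕ) ∧ K ≤ (b : ℕ)
  · rw [if_pos h, Tred, Tinvred, cut, cut, if_pos ⟨by omega, by omega⟩,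
      if_pos ⟨by omega, by omega⟩]
    rfl
  · rw [if_neg h, Dred, cut, if_neg (by omega), map_zero, mul_zero]

/-- The coproduct of the reduced generators. -/
lemma IsCoaction.apply_Dred_sub_mem {Δ : Refl M m n p →ₐ[ℂ] MonoRefl M m n p}
    (hΔ : IsCoaction M m n p Δ) {i j : Fin (m + n)} (hi : K ≤ (i : ℕ)) (hj : K ≤ (j : ℕ)) :
    coeffHom (Δ : Refl M m n p →+* MonoRefl M m n p) (Dred M m n p (K + 1) i j) -
      sandwich M m n p (Tred M m n (K + 1)) (Dred M m n p (K + 1)) (Tinvred M m n (K + 1)) i j ∈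
        nullSeries M m n p (K + 1) := by
  set z := M.shiftUpTo m K M.u₀ with hzdef
  have hz : (M.loc z).order = 1 := M.order_loc_shiftUpTo m K
  have hx : (M.exchange m z).Regular K := M.exchange_regular m K K
  set f := redCoeff M m (K + 1) with hf
  set Λ := inLeft M m n p
  set Ρ := inRight M m n p
  set t := ttProd M m n z
  set d := D M m n p z
  set S : LaurentSeries (MonoRefl M m n p) := ∑ a : Fin (m + n), ∑ b : Fin (m + n),
    if K ≤ (a : ℕ) ∧ K ≤ (b : ℕ) then Λ (t i j a b) * Ρ (d a b) else 0 with hS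
  set Q : Fin (m + n) → Fin (m + n) → LaurentSeries (MonoRefl M m n p) := fun i j =>
    ∑ c : Fin (m + n), if (c : ℕ) < K then Λ (t i j c c) * Ρ (d c c) else 0 with hQ
  -- Modulo null series `Δ(d_{ij})` is `S`, the part with inner indices at least `K`, plus `Q i j`,
  -- the part with `d_{cc}` for `c < K`. For `a < K` only `Q a a` remains in `Δ(d_{aa})`.
  have e1 : coeffHom (Δ : Refl M m n p →+* MonoRefl M m n p) (d i j) - (S + Q i j) ∈
      nullSeries M m n p (K + 1) := by
    have h := hΔ.apply_D_sub_mem hz hx (Or.inl ⟨hi, hj⟩)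
    simpa only [hi, hj, and_self, true_and] using h
  have e2 : ∀ a : Fin (m + n), (a : ℕ) < K →
      coeffHom (Δ : Refl M m n p →+* MonoRefl M m n p) (d a a) - Q a a ∈
        nullSeries M m n p (K + 1) := fun a ha => by
    have h := hΔ.apply_D_sub_mem hz hx (i := a) (j := a) (Or.inr rfl)
    simpa only [ha.not_ge, false_and, if_false, Finset.sum_const_zero, zero_add] using h
  -- The linear identity between the products in `A_{m|n}`, multiplied by `d_{cc}`.
  have e3 : ∀ c : Fin (m + n), (c : ℕ) < K →
      Λ (t i j c c + scal _ (f c) *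
        (∑ a : Fin (m + n), if K ≤ (a : ℕ) then t i j a a else 0) -
        (if i = j then ∑ a : Fin (m + n),
          if (a : ℕ) < K then scal _ (f a) * t a a c c else 0 else 0)) * Ρ (d c c) ∈
      nullSeries M m n p (K + 1) := fun c hc =>
    mul_mem_nullSeries (Or.inl (ttProd_reduced_mem hz hx
      (by omega) (fun c hc => M.coefficient_mul m hc) j hi hc))
  have e4 : coeffHom (Δ : Refl M m n p →+* MonoRefl M m n p) (Dred M m n p (K + 1) i j) =
      coeffHom (Δ : Refl M m n p →+* MonoRefl M m n p) (d i j) -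
        if i = j then ∑ a : Fin (m + n), if (a : ℕ) < K then
          scal _ (f a) * coeffHom (Δ : Refl M m n p →+* MonoRefl M m n p) (d a a) else 0 else 0 := by
    rw [Dred_succ_apply hi hj, map_sub, apply_ite (coeffHom (Δ : Refl M m n p →+* MonoRefl M m n p)),
      map_sum, map_zero]
    simp only [apply_ite (coeffHom (Δ : Refl M m n p →+* MonoRefl M m n p)), map_mul,
      coeffHom_scal, map_zero]
    rfl
  -- The corrections to `D^{(k)}` are diagonal, so in the reduced product each `d_{cc}` is
  -- multiplied by `f_c` times the sum of the diagonal terms.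
  have e5 : sandwich M m n p (Tred M m n (K + 1)) (Dred M m n p (K + 1)) (Tinvred M m n (K + 1))
      i j = S - ∑ c : Fin (m + n), if (c : ℕ) < K then
        Λ (scal _ (f c) * ∑ a : Fin (m + n), if K ≤ (a : ℕ) then t i j a a else 0) *
          Ρ (d c c) else 0 := by
    have h : ∀ a b : Fin (m + n), (if K ≤ (a : ℕ) ∧ K ≤ (b : ℕ) then
        Λ (t i j a b) * Ρ (Dred M m n p (K + 1) a b) else 0) =
        (if K ≤ (a : ℕ) ∧ K ≤ (b : ℕ) then Λ (t i j a b) * Ρ (d a b) else 0) -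
        if b = a then if K ≤ (a : ℕ) then ∑ c : Fin (m + n), if (c : ℕ) < K then
          scal _ (f c) * (Λ (t i j a a) * Ρ (d c c)) else 0 else 0 else 0 := by
      intro a b
      by_cases h : K ≤ (a : ℕ) ∧ K ≤ (b : ℕ)
      · rw [if_pos h, if_pos h, if_pos h.1, Dred_succ_apply h.1 h.2, map_sub, mul_sub]
        congr 1
        by_cases hab : a = b
        · subst hab
          rw [if_pos rfl, if_pos rfl, map_sum, Finset.mul_sum]
          refine Finset.sum_congr rfl fun c _ => ?_
          split_ifs
          · rw [map_mul, inRight_scal, ← mul_assoc, ← scal_commute, mul_assoc]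
          · rw [map_zero, mul_zero]
        · rw [if_neg hab, if_neg (Ne.symm hab), map_zero, mul_zero]
      · rw [if_neg h, if_neg h, zero_sub, eq_comm, neg_eq_zero]
        by_cases hab : b = a
        · subst hab
          rw [if_pos rfl, if_neg fun h' => h ⟨h', h'⟩]
        · rw [if_neg hab]
    refine (sandwich_reduced hi hj).trans ?_
    change (∑ a : Fin (m + n), ∑ b : Fin (m + n), if K ≤ (a : ℕ) ∧ K ≤ (b : ℕ) then
      Λ (t i j a b) * Ρ (Dred M m n p (K + 1) a b) else 0) = _
    simp only [h, Finset.sum_sub_distrib, Finset.sum_ite_eq', Finset.mem_univ, if_true]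
    congr 1
    simp only [map_mul, map_sum, Finset.mul_sum, Finset.sum_mul, inLeft_scal, Λ,
      apply_ite (inLeft M m n p), map_zero, mul_ite, ite_mul, mul_zero, zero_mul]
    have h2 : ∀ a : Fin (m + n), (if K ≤ (a : ℕ) then ∑ c : Fin (m + n), if (c : ℕ) < K then
          scal _ (f c) * (inLeft M m n p (t i j a a) * Ρ (d c c)) else 0 else 0) =
        ∑ c : Fin (m + n), if (c : ℕ) < K then if K ≤ (a : ℕ) then
          scal _ (f c) * inLeft M m n p (t i j a a) * Ρ (d c c) else 0 else 0 := fun a => by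
      split_ifs
      · simp only [mul_assoc]
      · simp
    simp only [h2]
    rw [Finset.sum_comm]
    refine Finset.sum_congr rfl fun c _ => ?_
    split_ifs
    · rfl
    · simp
  have e6 : (∑ c : Fin (m + n), if (c : ℕ) < K then Λ (t i j c c + scal _ (f c) *
        (∑ a : Fin (m + n), if K ≤ (a : ℕ) then t i j a a else 0) -
        (if i = j then ∑ a : Fin (m + n),
          if (a : ℕ) < K then scal _ (f a) * t a a c c else 0 else 0)) * Ρ (d c c) else 0) =
      Q i j + (∑ c : Fin (m + n), if (c : ℕ) < K then
        Λ (scal _ (f c) * ∑ a : Fin (m + n), if K ≤ (a : ℕ) then t i j a a else 0) *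
          Ρ (d c c) else 0) -
      if i = j then ∑ a : Fin (m + n), if (a : ℕ) < K then scal _ (f a) * Q a a else 0 else 0 := by
    have h : (if i = j then ∑ a : Fin (m + n), if (a : ℕ) < K then
        scal _ (f a) * Q a a else 0 else 0) =
        ∑ c : Fin (m + n), if (c : ℕ) < K then Λ (if i = j then ∑ a : Fin (m + n),
          if (a : ℕ) < K then scal _ (f a) * t a a c c else 0 else 0) * Ρ (d c c) else 0 := by
      split_ifs
      · have h1 : ∀ a : Fin (m + n), (if (a : ℕ) < K then scal _ (f a) * Q a a else 0) =
            ∑ c : Fin (m + n), if (c : ℕ) < K then if (a : ℕ) < K then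
              scal _ (f a) * (Λ (t a a c c) * Ρ (d c c)) else 0 else 0 := fun a => by
          split_ifs
          · simp only [hQ, Finset.mul_sum, mul_ite, mul_zero]
          · simp
        simp only [h1]
        rw [Finset.sum_comm]
        refine Finset.sum_congr rfl fun c _ => ?_
        split_ifs
        · rw [map_sum, Finset.sum_mul]
          refine Finset.sum_congr rfl fun a _ => ?_
          split_ifs
          · rw [map_mul, inLeft_scal, mul_assoc]
          · rw [map_zero, zero_mul]
        · simp
      · simp
    rw [h, hQ, ← Finset.sum_add_distrib, ← Finset.sum_sub_distrib]
    refine Finset.sum_congr rfl fun c _ => ?_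
    by_cases hc : (c : ℕ) < K
    · simp only [if_pos hc]
      rw [map_sub, map_add, sub_mul, add_mul]
    · simp only [if_neg hc, add_zero, sub_zero]
  have e7 : (if i = j then ∑ a : Fin (m + n), if (a : ℕ) < K then scal _ (f a) *
      (coeffHom (Δ : Refl M m n p →+* MonoRefl M m n p) (d a a) - Q a a) else 0 else 0) ∈
        nullSeries M m n p (K + 1) := by
    split_ifs
    · refine sum_mem fun a _ => ?_
      split_ifs with ha
      · exact scal_mul_mem_nullSeries _ (e2 a ha)
      · exact zero_mem _
    · exact zero_mem _
  -- `e1` and `e7` replace `Δ` by its surviving terms, in `d_{ij}` and in the corrections; the sum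
  -- of the `e3` then accounts for the coefficients of the `d_{cc}`.
  have e8 := add_mem (sub_mem e1 e7) (sum_mem (t := Finset.univ) fun (c : Fin (m + n)) _ =>
    (show (if (c : ℕ) < K then _ else 0) ∈ nullSeries M m n p (K + 1) by
      split_ifs with hc
      exacts [e3 c hc, zero_mem _]))
  rw [e6] at e8
  rw [e4, e5]
  convert e8 using 1
  by_cases hij : i = j
  · simp only [if_pos hij, mul_sub]
    have : ∀ a : Fin (m + n), (if (a : ℕ) < K then
        scal (MonoRefl M m n p) (f a) * coeffHom (Δ : Refl M m n p →+* MonoRefl M m n p) (d a a) -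
          scal _ (f a) * Q a a else 0) =
        (if (a : ℕ) < K then scal (MonoRefl M m n p) (f a) *
          coeffHom (Δ : Refl M m n p →+* MonoRefl M m n p) (d a a) else 0) -
        if (a : ℕ) < K then scal _ (f a) * Q a a else 0 := fun a => by split_ifs <;> simp
    simp only [this, Finset.sum_sub_distrib]
    abel
  · simp only [if_neg hij]
    abel

end Reduced
end OpenChain
end

theorem mainTheorem4 (M : Model) (m n p k : ℕ) (hk : 1 ≤ k) (hkN : k + 1 ≤ m + n) :
    (∃! Δ : Mono M m n →ₐ[ℂ] MonoMono M m n, IsCoproduct M m n Δ) ∧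
    (∃! Δ : Refl M m n p →ₐ[ℂ] MonoRefl M m n p, IsCoaction M m n p Δ) ∧
    (∀ K : Fin (m + n) → Fin (m + n) → LaurentSeries ℂ, IsBoundary M m n p K →
      (∃! φ : Refl M m n p →ₐ[ℂ] Mono M m n, IsDressing M m n p K φ) ∧
      ∀ (φ : Refl M m n p →ₐ[ℂ] Mono M m n) (ΔA : Mono M m n →ₐ[ℂ] MonoMono M m n)
        (Δ : Refl M m n p →ₐ[ℂ] MonoRefl M m n p),
        IsDressing M m n p K φ → IsCoproduct M m n ΔA → IsCoaction M m n p Δ →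
          ∀ x, idTensor M m n p φ (Δ x) = ΔA (φ x)) ∧
    ∀ Δ : Refl M m n p →ₐ[ℂ] MonoRefl M m n p, IsCoaction M m n p Δ →
      ∀ i j : Fin (m + n), k ≤ (i : ℕ) + 1 → k ≤ (j : ℕ) + 1 → ∀ r : ℤ,
        coset M m n p k
            ((coeffHom (Δ : Refl M m n p →+* MonoRefl M m n p) (Dred M m n p k i j)).coeff r) =
          coset M m n p k
            ((sandwich M m n p (Tred M m n k) (Dred M m n p k) (Tinvred M m n k) i j).coeff r) := by
  refine ⟨existsUnique_coproduct M m n, existsUnique_coaction M m n p, fun K hK =>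
    ⟨hK.existsUnique_dressing, fun φ ΔA Δ hφ hA hΔ x => hφ.idTensor_coaction hK hA hΔ x⟩, ?_⟩
  -- `K` counts the removed indices, which are those below `K` when counting from `0`.
  obtain ⟨K, rfl⟩ : ∃ K, k = K + 1 := ⟨k - 1, by omega⟩
  intro Δ hΔ i j hi hj r
  exact coset_coeff_eq (hΔ.apply_Dred_sub_mem (by omega) (by omega)) r
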